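/- \textbf{Setting.} Let $\mathbb K$ be a field of characteristic $0$, $(X,\mathcal O)$ a ringed space whose structure sheaf is a sheaf of commutative $\mathbb K$-algebras, and $\mathcal L$ a Lie algebroid over it: a sheaf of $\mathcal O$-modules with a $\mathbb K$-linear Lie bracket and an $\mathcal O$-linear Lie algebra map (anchor) $\rho:\mathcal L\to\mathrm{Der}_{\mathbb K}(\mathcal O)$ with $[x,ry]=r[x,y]+\rho(x)(r)\,y$. Assume that $\mathcal L$ is locally free of constant finite rank, and let $\mathcal E$ be a sheaf of $\mathcal O$-modules that is locally free of constant finite rank. An $\mathcal L$-connection on an $\mathcal O$-module $\mathcal M$ is a $\mathbb K$-bilinear map of sheaves $(x,m)\mapsto\nabla_xm$, $\mathcal L\times\mathcal M\to\mathcal M$, that is $\mathcal O$-linear in $x$ and satisfies $\nabla_x(rm)=r\nabla_xm+\rho(x)(r)m$. Let $\nabla^{\mathcal L}$, $\nabla^{\mathcal E}$ be $\mathcal L$-connections on $\mathcal L$ and on $\mathcal E$. \textbf{Notation.} $\mathcal U(\mathcal L)$ is the universal enveloping algebra of $\mathcal L$, with its left $\mathcal O$-module structure, its counit $\varepsilon(D)=D(1)$,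 its coproduct over $\mathcal O$ (with $\Delta(r)=r\otimes 1$, $\Delta(x)=x\otimes1+1\otimes x$ on generators $r\in\mathcal O$, $x\in\mathcal L$) and its filtration by order. The sheaf of jets is the sheaf of commutative rings $\mathcal J(\mathcal L)=\mathcal Hom_{\mathcal O}(\mathcal U(\mathcal L),\mathcal O)$, with the product dual to the coproduct. It is an $\mathcal O$-algebra in two ways, $\alpha_1(r)(D)=r\,\varepsilon(D)$ and $\alpha_2(r)(D)=\varepsilon(Dr)$; write $\mathcal O_{X_1}$, $\mathcal O_{X_2}$ for $\mathcal O$ acting through $\alpha_1$, $\alpha_2$. For $x\in\mathcal L$ put $(\nabla^{(2)}_x\varphi)(D)=\varphi(Dx)$. Let $\widehat{\mathrm{Sym}}(\mathcal L^\vee)=\mathcal Hom_{\mathcal O}(\mathrm{Sym}_{\mathcal O}\mathcal L,\mathcal O)$ (the jets of $\mathcal L$ with zero bracket and anchor), with the product dual to the coproduct of $\mathrm{Sym}\,\mathcal L$. Sections of $\widehat{\mathrm{Sym}}(\mathcal L^\vee)\otimes_{\mathcal O}\mathcal E$ are evaluated on $a\in\mathrm{Sym}\,\mathcal L$ by $(\beta\otimes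 e)(a)=\beta(a)e$. Let $\mathcal J(\mathcal L;\mathcal E)=\mathcal J(\mathcal L)\otimes_{\mathcal O_{X_2}}\mathcal E$, a sheaf of $\mathcal J(\mathcal L)$-modules, and let $\mathcal U(\mathcal L;\mathcal E)=\mathcal Hom^{\mathrm{cont}}_{\mathcal O_{X_1}}(\mathcal J(\mathcal L;\mathcal E),\mathcal E)$ be the sheaf of $\mathcal O_{X_1}$-linear maps that are continuous, i.e. that locally, for some $k$, vanish on $\varphi s$ for all sections $s$ of $\mathcal J(\mathcal L;\mathcal E)$ and all jets $\varphi$ that vanish on operators of order at most $k$. For a module $\mathcal M$ with operators $\nabla_x$ ($x\in\mathcal L$), the symmetrized derivative of an $\mathcal M$-valued form $\alpha$ in $n$ arguments from $\mathcal L$ is \[(D\alpha)(x_0,\dots,x_n)=\sum_{i=0}^n(\nabla_{x_i}\alpha)(x_0,\dots,\widehat{x_i},\dots,x_n),\qquad (\nabla_x\alpha)(y_1,\dots,y_n)=\nabla_x\bigl(\alpha(y_1,\dots,y_n)\bigr)-\sum_k\alpha(y_1,\dots,\nabla^{\mathcal L}_xy_k,\dots,y_n).\] It is used for $\mathcal M=\mathcal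 J(\mathcal L)$ with $\nabla^{(2)}$, and for $\mathcal M=\mathcal J(\mathcal L;\mathcal E)$ with $\nabla^{(2)}\otimes1+1\otimes\nabla^{\mathcal E}$; $D^n s$ is the form in $n$ arguments obtained from $s\in\mathcal M$. Put $\mathrm{ev}_1(\varphi)=\varphi(1)$ and $\mathrm{ev}_1(\varphi\otimes e)=\varphi(1)e$. \textbf{Theorem.} The pair $(\nabla^{\mathcal L},\nabla^{\mathcal E})$ induces an $\mathcal O_{X_1}$-linear isomorphism of $\mathcal J(\mathcal L)$-modules and an isomorphism of sheaves of $\mathcal O$-modules \[j:\mathcal J(\mathcal L;\mathcal E)\to\widehat{\mathrm{Sym}}(\mathcal L^\vee)\otimes_{\mathcal O}\mathcal E,\qquad j^*:\mathrm{Sym}_{\mathcal O}(\mathcal L)\otimes_{\mathcal O}\mathcal End_{\mathcal O}(\mathcal E)\to\mathcal U(\mathcal L;\mathcal E).\] Explicitly, there are an isomorphism of sheaves of rings $j_{\mathcal L}:\mathcal J(\mathcal L)\to\widehat{\mathrm{Sym}}(\mathcal L^\vee)$ with $j_{\mathcal L}(\alpha_1(r))=r$, and isomorphisms $j$, $j^*$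 of sheaves, such that for all sections over every open set: \begin{enumerate} \item $j_{\mathcal L}(\varphi)(x_1\cdots x_n)=\frac1{n!}\,\mathrm{ev}_1\bigl((D^n\varphi)(x_1,\dots,x_n)\bigr)$ for $n\ge0$, $\varphi\in\mathcal J(\mathcal L)$, $x_i\in\mathcal L$; \item $j(s)(x_1\cdots x_n)=\frac1{n!}\,\mathrm{ev}_1\bigl((D^ns)(x_1,\dots,x_n)\bigr)$ for $n\ge0$, $s$ a finite sum of tensors $\varphi\otimes e$, $x_i\in\mathcal L$; that is, $j=\mathrm{ev}_1\circ\exp(D)\circ(1\otimes-)$; \item $j(\varphi s)=j_{\mathcal L}(\varphi)\,j(s)$ for $\varphi\in\mathcal J(\mathcal L)$, $s\in\mathcal J(\mathcal L;\mathcal E)$; in particular $j(\alpha_1(r)s)=r\,j(s)$ for $r\in\mathcal O$; \item $j^*$ is $\mathcal O$-linear and dual to $j$: $j^*(a\otimes T)(s)=T\bigl(j(s)(a)\bigr)$ for $a\in\mathrm{Sym}(\mathcal L)$, $T\in\mathcal End(\mathcal E)$, $s\in\mathcal J(\mathcal L;\mathcal E)$. \end{enumerate} -/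

import Mathlib

open CategoryTheory Opposite TopologicalSpace
open scoped TensorProduct

universe u

noncomputable section

namespace LieAlgd

section Der

variable {R M N : Type*} [CommRing R] [AddCommGroup M] [Module R M] [AddCommGroup N] [Module R N]

/-- The operator `f ⊗ 1 + 1 ⊗ g` on `M ⊗[R] N`, for additive operators `f`, `g` that satisfy the
Leibniz rule over the same map `δ : R → R`. -/
def tensorDer (δ : R → R) (f : M →+ M) (g : N →+ N)
    (hf : ∀ r m, f (r • m) = r • f m + δ r • m) (hg : ∀ r n, g (r • n) = r • g n + δ r • n) :
    M ⊗[R] N →+ M ⊗[R] N :=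
  TensorProduct.liftAddHom
    { toFun := fun m =>
        { toFun := fun n => f m ⊗ₜ[R] n + m ⊗ₜ[R] g n
          map_zero' := by simp
          map_add' := fun a b => by simp only [TensorProduct.tmul_add, map_add]; abel }
      map_zero' := by ext; simp
      map_add' := fun a b => by
        ext n
        simp only [AddMonoidHom.coe_mk, ZeroHom.coe_mk, AddMonoidHom.add_apply,
          TensorProduct.add_tmul, map_add]
        abel }
    (fun r m n => by
      simp only [AddMonoidHom.coe_mk, ZeroHom.coe_mk, hf, hg, TensorProduct.add_tmul,
        TensorProduct.tmul_add, TensorProduct.smul_tmul]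
      abel)

@[simp] lemma tensorDer_tmul (δ : R → R) (f : M →+ M) (g : N →+ N)
    (hf : ∀ r m, f (r • m) = r • f m + δ r • m) (hg : ∀ r n, g (r • n) = r • g n + δ r • n)
    (m : M) (n : N) :
    tensorDer δ f g hf hg (m ⊗ₜ n) = f m ⊗ₜ n + m ⊗ₜ g n := rfl

lemma tensorDer_leibniz (δ : R → R) (f : M →+ M) (g : N →+ N)
    (hf : ∀ r m, f (r • m) = r • f m + δ r • m) (hg : ∀ r n, g (r • n) = r • g n + δ r • n)
    (r : R) (t : M ⊗[R] N) :
    tensorDer δ f g hf hg (r • t) = r • tensorDer δ f g hf hg t + δ r • t := by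
  induction t with
  | zero => simp
  | tmul m n =>
    simp only [TensorProduct.smul_tmul', tensorDer_tmul, hf, TensorProduct.add_tmul, smul_add]
    abel
  | add a b ha hb => simp only [smul_add, map_add, ha, hb]; abel

end Der

section UEnv

variable (K R L : Type*) [CommRing K] [CommRing R] [Algebra K R] [LieRing L] [Module R L]
  [LieRingModule L R] [LieAlgebra K L] [LieRinehartRing R L] [LieRinehartAlgebra K R L]

/-- The relations imposed on the tensor algebra of `R ⊕ L` over `K` to obtain the universal
enveloping algebra of the Lie--Rinehart algebra `(R, L)`. -/
inductive UEnvRel : TensorAlgebra K (R × L) → TensorAlgebra K (R × L) → Prop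
  | one : UEnvRel (TensorAlgebra.ι K (1, 0)) 1
  | mul (r s : R) : UEnvRel (TensorAlgebra.ι K (r, 0) * TensorAlgebra.ι K (s, 0))
      (TensorAlgebra.ι K (r * s, 0))
  | smul (r : R) (x : L) : UEnvRel (TensorAlgebra.ι K (r, 0) * TensorAlgebra.ι K (0, x))
      (TensorAlgebra.ι K (0, r • x))
  | lie (x y : L) : UEnvRel (TensorAlgebra.ι K (0, x) * TensorAlgebra.ι K (0, y))
      (TensorAlgebra.ι K (0, y) * TensorAlgebra.ι K (0, x) + TensorAlgebra.ι K (0, ⁅x, y⁆))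
  | anchor (x : L) (r : R) : UEnvRel (TensorAlgebra.ι K (0, x) * TensorAlgebra.ι K (r, 0))
      (TensorAlgebra.ι K (r, 0) * TensorAlgebra.ι K (0, x) + TensorAlgebra.ι K (⁅x, r⁆, 0))

/-- The universal enveloping algebra `𝓤(L, R)` of the Lie--Rinehart algebra `(R, L)`: the
`K`-algebra generated by the vector space `R ⊕ L` subject to the relations that make
`i_R : R → 𝓤` a unital algebra map and `i_L : L → 𝓤` a Lie algebra map with
`i_R r * i_L x = i_L (r • x)` and `i_L x * i_R r - i_R r * i_L x = i_R (ρ(x)(r))`. -/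
def UEnv := RingQuot (UEnvRel K R L)

namespace UEnv

instance : Ring (UEnv K R L) := inferInstanceAs (Ring (RingQuot (UEnvRel K R L)))
instance : Algebra K (UEnv K R L) := inferInstanceAs (Algebra K (RingQuot (UEnvRel K R L)))

/-- The projection from the tensor algebra. -/
def proj : TensorAlgebra K (R × L) →ₐ[K] UEnv K R L := RingQuot.mkAlgHom K (UEnvRel K R L)

lemma proj_rel {a b : TensorAlgebra K (R × L)} (h : UEnvRel K R L a b) :
    proj K R L a = proj K R L b := RingQuot.mkAlgHom_rel K h

/-- The canonical map `i_R : R → 𝓤(L, R)`. -/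
def iR : R →ₐ[K] UEnv K R L :=
  AlgHom.ofLinearMap ((proj K R L).toLinearMap ∘ₗ TensorAlgebra.ι K ∘ₗ LinearMap.inl K R L)
    (by simpa using proj_rel K R L UEnvRel.one)
    (fun r s => by simpa using (proj_rel K R L (UEnvRel.mul r s)).symm)

/-- The canonical map `i_L : L → 𝓤(L, R)`. -/
def iL : L →ₗ[K] UEnv K R L :=
  (proj K R L).toLinearMap ∘ₗ TensorAlgebra.ι K ∘ₗ LinearMap.inr K R L

variable {R L}

lemma iR_mul_iL (r : R) (x : L) : iR K R L r * iL K R L x = iL K R L (r • x) := by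
  simpa [iR, iL] using (proj_rel K R L (UEnvRel.smul r x))

lemma iL_mul_iL (x y : L) :
    iL K R L x * iL K R L y = iL K R L y * iL K R L x + iL K R L ⁅x, y⁆ := by
  simpa [iR, iL] using (proj_rel K R L (UEnvRel.lie x y))

lemma iL_mul_iR (x : L) (r : R) :
    iL K R L x * iR K R L r = iR K R L r * iL K R L x + iR K R L ⁅x, r⁆ := by
  simpa [iR, iL] using (proj_rel K R L (UEnvRel.anchor x r))

variable (R L)

/-- `𝓤(L, R)` as an `R`-module by left multiplication. -/
instance : Module R (UEnv K R L) := Module.compHom _ (iR K R L).toRingHom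

variable {K R L}

lemma smul_def (r : R) (D : UEnv K R L) : r • D = iR K R L r * D := rfl

instance : IsScalarTower K R (UEnv K R L) where
  smul_assoc k r D := by rw [smul_def, smul_def, map_smul, smul_mul_assoc]

instance : IsScalarTower R (UEnv K R L) (UEnv K R L) where
  smul_assoc r D E := by simp only [smul_def, smul_eq_mul, mul_assoc]

lemma iL_mul_smul (x : L) (r : R) (D : UEnv K R L) :
    iL K R L x * (r • D) = r • (iL K R L x * D) + ⁅x, r⁆ • D := by
  simp only [smul_def, ← mul_assoc, iL_mul_iR, add_mul]

/-- The universal property of `𝓤(L, R)`. -/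
def lift {A : Type*} [Ring A] [Algebra K A] (fR : R →ₐ[K] A) (fL : L →ₗ[K] A)
    (h₁ : ∀ r x, fR r * fL x = fL (r • x))
    (h₂ : ∀ x y, fL x * fL y = fL y * fL x + fL ⁅x, y⁆)
    (h₃ : ∀ x r, fL x * fR r = fR r * fL x + fR ⁅x, r⁆) : UEnv K R L →ₐ[K] A :=
  RingQuot.liftAlgHom K ⟨TensorAlgebra.lift K (fR.toLinearMap.coprod fL), by
    intro a b h
    induction h with
    | one => simp
    | mul r s => simp
    | smul r x => simpa using h₁ r x
    | lie x y => simpa using h₂ x y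
    | anchor x r => simpa using h₃ x r⟩

section lift
variable {A : Type*} [Ring A] [Algebra K A] (fR : R →ₐ[K] A) (fL : L →ₗ[K] A)
    (h₁ : ∀ r x, fR r * fL x = fL (r • x))
    (h₂ : ∀ x y, fL x * fL y = fL y * fL x + fL ⁅x, y⁆)
    (h₃ : ∀ x r, fL x * fR r = fR r * fL x + fR ⁅x, r⁆)

@[simp] lemma lift_iR (r : R) : lift fR fL h₁ h₂ h₃ (iR K R L r) = fR r := by
  simp only [lift, iR, AlgHom.ofLinearMap_apply, LinearMap.comp_apply, proj]
  erw [RingQuot.liftAlgHom_mkAlgHom_apply]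
  simp

@[simp] lemma lift_iL (x : L) : lift fR fL h₁ h₂ h₃ (iL K R L x) = fL x := by
  simp only [lift, iL, LinearMap.comp_apply, proj]
  erw [RingQuot.liftAlgHom_mkAlgHom_apply]
  simp

end lift

/-- `𝓤(L, R)` is generated from `1` by sums and left multiplication by elements of `R` and `L`. -/
lemma induction {P : UEnv K R L → Prop} (one : P 1) (add : ∀ a b, P a → P b → P (a + b))
    (smul : ∀ (r : R) a, P a → P (r • a)) (mul : ∀ (x : L) a, P a → P (iL K R L x * a))
    (D : UEnv K R L) : P D := by
  have key : ∀ t : TensorAlgebra K (R × L), ∀ D, P D → P (proj K R L t * D) := by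
    intro t
    induction t using TensorAlgebra.induction with
    | algebraMap k =>
      intro D hD
      have : proj K R L (algebraMap K _ k) * D = (algebraMap K R k) • D := by
        rw [smul_def, AlgHom.commutes, AlgHom.commutes]
      rw [this]; exact smul _ _ hD
    | ι z =>
      intro D hD
      have : proj K R L (TensorAlgebra.ι K z) = iR K R L z.1 + iL K R L z.2 := by
        simp only [iR, iL, AlgHom.ofLinearMap_apply, LinearMap.comp_apply,
          AlgHom.toLinearMap_apply, ← map_add]
        congr 2
        simp
      rw [this, add_mul]
      exact add _ _ (smul _ _ hD) (mul _ _ hD)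
    | mul a b ha hb => intro D hD; rw [map_mul, mul_assoc]; exact ha _ (hb _ hD)
    | add a b ha hb => intro D hD; rw [map_add, add_mul]; exact add _ _ (ha _ hD) (hb _ hD)
  obtain ⟨t, rfl⟩ := RingQuot.mkAlgHom_surjective K (UEnvRel K R L) D
  have := key t 1 one
  rwa [mul_one] at this

section action
variable {M : Type*} [AddCommGroup M] [Module R M] [Module K M] [IsScalarTower K R M]

/-- The algebra map `𝓤(L, R) → End_K M` given by a flat `L`-connection on the `R`-module `M`. -/
def act (nab : L → M →+ M) (hadd : ∀ x y m, nab (x + y) m = nab x m + nab y m)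
    (hsmul : ∀ (r : R) x m, nab (r • x) m = r • nab x m)
    (hleib : ∀ x (r : R) m, nab x (r • m) = r • nab x m + ⁅x, r⁆ • m)
    (hflat : ∀ x y m, nab x (nab y m) = nab y (nab x m) + nab ⁅x, y⁆ m) :
    UEnv K R L →ₐ[K] Module.End K M :=
  have hK : ∀ (k : K) x m, nab x (k • m) = k • nab x m := fun k x m => by
    have h0 : ⁅x, algebraMap K R k⁆ = 0 := by
      rw [Algebra.algebraMap_eq_smul_one]
      refine ((LieModule.toEnd K L R x).map_smul k 1).trans ?_
      have := LieRinehartRing.leibniz_mul_right x (1 : R) 1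
      simp only [mul_one, smul_eq_mul, one_mul, left_eq_add] at this
      rw [LieModule.toEnd_apply_apply, this, smul_zero]
    rw [← algebraMap_smul R k m, hleib, h0, zero_smul, add_zero, algebraMap_smul]
  lift (Algebra.lsmul K K M)
    { toFun := fun x => { toFun := nab x, map_add' := map_add _, map_smul' := fun k m => hK k x m }
      map_add' := fun x y => LinearMap.ext fun m => hadd x y m
      map_smul' := fun k x => LinearMap.ext fun m => by
        have := hsmul (algebraMap K R k) x m
        rwa [algebraMap_smul, algebraMap_smul] at this }
    (fun r x => LinearMap.ext fun m => (hsmul r x m).symm)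
    (fun x y => LinearMap.ext fun m => hflat x y m)
    (fun x r => LinearMap.ext fun m => hleib x r m)

variable (nab : L → M →+ M) (hadd : ∀ x y m, nab (x + y) m = nab x m + nab y m)
    (hsmul : ∀ (r : R) x m, nab (r • x) m = r • nab x m)
    (hleib : ∀ x (r : R) m, nab x (r • m) = r • nab x m + ⁅x, r⁆ • m)
    (hflat : ∀ x y m, nab x (nab y m) = nab y (nab x m) + nab ⁅x, y⁆ m)

lemma act_smul (r : R) (D : UEnv K R L) (m : M) :
    act nab hadd hsmul hleib hflat (r • D) m = r • act nab hadd hsmul hleib hflat D m := by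
  rw [smul_def, map_mul, act, lift_iR]; rfl

lemma act_iL_mul (x : L) (D : UEnv K R L) (m : M) :
    act nab hadd hsmul hleib hflat (iL K R L x * D) m =
      nab x (act nab hadd hsmul hleib hflat D m) := by
  rw [map_mul, act, lift_iL]; rfl

end action

/-- The counit `ε(D) = D(1)`. -/
def counit : UEnv K R L →ₗ[R] R where
  toFun D := act (K := K) (fun x : L => (LieModule.toEnd K L R x).toAddMonoidHom)
    (fun x y m => by simp) (fun r x m => by simp) (fun x r m => by simp)
    (fun x y m => by simp) D (1 : R)
  map_add' D E := by simp
  map_smul' r D := act_smul _ _ _ _ _ r D 1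

lemma counit_one : counit (1 : UEnv K R L) = 1 := by simp [counit]

lemma counit_iL_mul (x : L) (D : UEnv K R L) : counit (iL K R L x * D) = ⁅x, counit D⁆ :=
  act_iL_mul _ _ _ _ _ x D 1

/-- Left multiplication by `i_L x`. -/
def lmul (x : L) : UEnv K R L →+ UEnv K R L := AddMonoidHom.mulLeft (iL K R L x)

lemma lmul_smul (x : L) (r : R) (D : UEnv K R L) :
    lmul x (r • D) = r • lmul x D + ⁅x, r⁆ • D := iL_mul_smul x r D

/-- The action `D₁ ⊗ D₂ ↦ x D₁ ⊗ D₂ + D₁ ⊗ x D₂` of `x : L` on `𝓤 ⊗[R] 𝓤`. -/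
def lmul₂ (x : L) : UEnv K R L ⊗[R] UEnv K R L →+ UEnv K R L ⊗[R] UEnv K R L :=
  tensorDer (fun r => ⁅x, r⁆) (lmul x) (lmul x) (lmul_smul x) (lmul_smul x)

@[simp] lemma lmul₂_tmul (x : L) (D E : UEnv K R L) :
    lmul₂ x (D ⊗ₜ[R] E) = (iL K R L x * D) ⊗ₜ E + D ⊗ₜ (iL K R L x * E) := rfl

/-- The coproduct: `Δ(D) = D • (1 ⊗ 1)`, so that `Δ(r) = r ⊗ 1` and `Δ(x) = x ⊗ 1 + 1 ⊗ x`. -/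
def comul : UEnv K R L →ₗ[R] UEnv K R L ⊗[R] UEnv K R L where
  toFun D := act (K := K) (M := UEnv K R L ⊗[R] UEnv K R L) (fun x : L => lmul₂ x)
    (fun x y m => by
      induction m with
      | zero => simp
      | tmul a b =>
        simp only [lmul₂_tmul, map_add, add_mul, TensorProduct.add_tmul, TensorProduct.tmul_add]
        abel
      | add a b ha hb => simp only [map_add, ha, hb]; abel)
    (fun r x m => by
      induction m with
      | zero => simp
      | tmul a b =>
        simp only [lmul₂_tmul, ← iR_mul_iL, ← smul_def, smul_mul_assoc, smul_add,
          TensorProduct.tmul_smul, ← TensorProduct.smul_tmul']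
      | add a b ha hb => simp only [map_add, ha, hb, smul_add])
    (fun x r m => tensorDer_leibniz _ _ _ _ _ r m)
    (fun x y m => by
      induction m with
      | zero => simp
      | tmul a b =>
        simp only [lmul₂_tmul, map_add, ← mul_assoc]
        rw [iL_mul_iL K x y]
        simp only [add_mul, TensorProduct.add_tmul, TensorProduct.tmul_add]
        abel
      | add a b ha hb => simp only [map_add, ha, hb]; abel) D (1 ⊗ₜ 1)
  map_add' D E := by simp
  map_smul' r D := act_smul _ _ _ _ _ r D _

lemma comul_one : comul (1 : UEnv K R L) = 1 ⊗ₜ 1 := by simp [comul]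

lemma comul_iL_mul (x : L) (D : UEnv K R L) : comul (iL K R L x * D) = lmul₂ x (comul D) :=
  act_iL_mul _ _ _ _ _ x D _

instance : Coalgebra R (UEnv K R L) where
  comul := comul
  counit := counit
  coassoc := by
    let d₃ : L → UEnv K R L ⊗[R] (UEnv K R L ⊗[R] UEnv K R L) →+
        UEnv K R L ⊗[R] (UEnv K R L ⊗[R] UEnv K R L) := fun x =>
      tensorDer (fun r => ⁅x, r⁆) (lmul x) (lmul₂ x) (lmul_smul x) (tensorDer_leibniz _ _ _ _ _)
    have hd : ∀ x D t, d₃ x (D ⊗ₜ t) = (iL K R L x * D) ⊗ₜ t + D ⊗ₜ lmul₂ x t := fun _ _ _ => rfl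
    have h₁ : ∀ x t, TensorProduct.assoc R _ _ _ (comul.rTensor (UEnv K R L) (lmul₂ x t)) =
        d₃ x (TensorProduct.assoc R _ _ _ (comul.rTensor (UEnv K R L) t)) := by
      intro x t
      induction t with
      | zero => simp
      | add a b ha hb => simp only [map_add, ha, hb]
      | tmul a b =>
        simp only [lmul₂_tmul, map_add, LinearMap.rTensor_tmul, comul_iL_mul]
        generalize comul a = s
        induction s with
        | zero => simp
        | add c d hc hd =>
          simp only [map_add, TensorProduct.add_tmul] at hc hd ⊢
          rw [← hc, ← hd]; abel
        | tmul c d =>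
          simp only [lmul₂_tmul, TensorProduct.add_tmul, map_add, TensorProduct.assoc_tmul, hd,
            TensorProduct.tmul_add]
          abel
    have h₂ : ∀ x t, comul.lTensor (UEnv K R L) (lmul₂ x t) =
        d₃ x (comul.lTensor (UEnv K R L) t) := by
      intro x t
      induction t with
      | zero => simp
      | add a b ha hb => simp only [map_add, ha, hb]
      | tmul a b => simp only [lmul₂_tmul, map_add, LinearMap.lTensor_tmul, comul_iL_mul, hd]
    ext D
    simp only [LinearMap.comp_apply, LinearEquiv.coe_coe]
    induction D using UEnv.induction with
    | one => simp [comul_one]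
    | add a b ha hb => simp only [map_add, ha, hb]
    | smul r a ha => simp only [map_smul, ha]
    | mul x a ha => rw [comul_iL_mul, h₁, h₂, ha]
  rTensor_counit_comp_comul := by
    ext D
    simp only [LinearMap.comp_apply, TensorProduct.mk_apply]
    induction D using UEnv.induction with
    | one => simp [comul_one, counit_one]
    | add a b ha hb => simp only [map_add, ha, hb, TensorProduct.tmul_add]
    | smul r a ha => simp only [map_smul, ha, TensorProduct.tmul_smul]
    | mul x a ha =>
      have h : ∀ t, counit.rTensor (UEnv K R L) (lmul₂ x t) =
          tensorDer (fun r => ⁅x, r⁆) (LieModule.toEnd K L R x).toAddMonoidHom (lmul x)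
            (fun r m => by simp) (lmul_smul x)
            (counit.rTensor (UEnv K R L) t) := by
        intro t
        induction t with
        | zero => simp
        | add a b ha hb => simp only [map_add, ha, hb]
        | tmul a b =>
          simp only [lmul₂_tmul, map_add, LinearMap.rTensor_tmul, counit_iL_mul, tensorDer_tmul]
          rfl
      rw [comul_iL_mul, h, ha, tensorDer_tmul]
      have h1 : (LieModule.toEnd K L R x).toAddMonoidHom 1 = 0 := by
        have := LieRinehartRing.leibniz_mul_right x (1 : R) 1
        simp at this
        simpa using this
      rw [h1, TensorProduct.zero_tmul, zero_add]; rfl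
  lTensor_counit_comp_comul := by
    ext D
    simp only [LinearMap.comp_apply, LinearMap.flip_apply, TensorProduct.mk_apply]
    induction D using UEnv.induction with
    | one => simp [comul_one, counit_one]
    | add a b ha hb => simp only [map_add, ha, hb, TensorProduct.add_tmul]
    | smul r a ha => simp only [map_smul, ha, TensorProduct.smul_tmul']
    | mul x a ha =>
      have h : ∀ t, counit.lTensor (UEnv K R L) (lmul₂ x t) =
          tensorDer (fun r => ⁅x, r⁆) (lmul x) (LieModule.toEnd K L R x).toAddMonoidHom
            (lmul_smul x) (fun r m => by simp)
            (counit.lTensor (UEnv K R L) t) := by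
        intro t
        induction t with
        | zero => simp
        | add a b ha hb => simp only [map_add, ha, hb]
        | tmul a b =>
          simp only [lmul₂_tmul, map_add, LinearMap.lTensor_tmul, counit_iL_mul, tensorDer_tmul]
          rfl
      rw [comul_iL_mul, h, ha, tensorDer_tmul]
      have h1 : (LieModule.toEnd K L R x).toAddMonoidHom 1 = 0 := by
        have := LieRinehartRing.leibniz_mul_right x (1 : R) 1
        simp at this
        simpa using this
      rw [h1, TensorProduct.tmul_zero, add_zero]; rfl

instance : Coalgebra.IsCocomm R (UEnv K R L) where
  comm_comp_comul := by
    have h : ∀ x t, TensorProduct.comm R (UEnv K R L) (UEnv K R L) (lmul₂ x t) =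
        lmul₂ x (TensorProduct.comm R _ _ t) := by
      intro x t
      induction t with
      | zero => simp
      | add a b ha hb => simp only [map_add, ha, hb]
      | tmul a b => simp only [lmul₂_tmul, map_add, TensorProduct.comm_tmul]; abel
    ext D
    change TensorProduct.comm R (UEnv K R L) (UEnv K R L) (comul D) = comul D
    induction D using UEnv.induction with
    | one => simp [comul_one]
    | add a b ha hb => simp only [map_add, ha, hb]
    | smul r a ha => simp only [map_smul, ha]
    | mul x a ha => rw [comul_iL_mul, h, ha]

section map
variable {R' L' : Type*} [CommRing R'] [Algebra K R'] [LieRing L'] [Module R' L']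
  [LieRingModule L' R'] [LieAlgebra K L'] [LieRinehartRing R' L'] [LieRinehartAlgebra K R' L']

/-- Functoriality of the universal enveloping algebra for morphisms of Lie--Rinehart algebras. -/
def map {σ : R →ₐ[K] R'} (F : LieRinehartAlgebra.Hom σ L L') : UEnv K R L →ₐ[K] UEnv K R' L' :=
  lift ((iR K R' L').comp σ) (iL K R' L' ∘ₗ F.toLieHom.toLinearMap)
    (fun r x => by
      change iR K R' L' (σ r) * iL K R' L' (F x) = iL K R' L' (F (r • x))
      rw [iR_mul_iL, F.map_smul_apply])
    (fun x y => by
      change iL K R' L' (F x) * iL K R' L' (F y) = iL K R' L' (F y) * iL K R' L' (F x) +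
        iL K R' L' (F ⁅x, y⁆)
      rw [iL_mul_iL K (F x)]
      exact congrArg (fun z => _ + iL K R' L' z) (LieHom.map_lie F.toLieHom x y).symm)
    (fun x r => by
      change iL K R' L' (F x) * iR K R' L' (σ r) = iR K R' L' (σ r) * iL K R' L' (F x) +
        iR K R' L' (σ ⁅x, r⁆)
      rw [iL_mul_iR, F.apply_lie])

variable {σ : R →ₐ[K] R'} (F : LieRinehartAlgebra.Hom σ L L')

@[simp] lemma map_iR (r : R) : map F (iR K R L r) = iR K R' L' (σ r) := by
  rw [map, lift_iR]; rfl

@[simp] lemma map_iL (x : L) : map F (iL K R L x) = iL K R' L' (F x) := by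
  rw [map, lift_iL]; rfl

lemma map_smul' (r : R) (D : UEnv K R L) : map F (r • D) = σ r • map F D := by
  rw [smul_def, map_mul, map_iR, smul_def]

/-- `UEnv.map` as a semilinear map. -/
def mapₛₗ : UEnv K R L →ₛₗ[(σ : R →+* R')] UEnv K R' L' where
  toFun := map F
  map_add' := map_add _
  map_smul' := map_smul' F

lemma mapₛₗ_apply (D : UEnv K R L) : mapₛₗ F D = map F D := rfl

lemma counit_map (D : UEnv K R L) : counit (map F D) = σ (counit D) := by
  induction D using UEnv.induction with
  | one => simp [counit_one]
  | add a b ha hb => simp only [map_add, ha, hb]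
  | smul r a ha => rw [map_smul', map_smul, map_smul, ha, smul_eq_mul, smul_eq_mul, map_mul]
  | mul x a ha => rw [map_mul, map_iL, counit_iL_mul, counit_iL_mul, ha, F.apply_lie]

lemma comul_map (D : UEnv K R L) :
    comul (map F D) = TensorProduct.map (mapₛₗ F) (mapₛₗ F) (comul D) := by
  have h : ∀ x t, TensorProduct.map (mapₛₗ F) (mapₛₗ F) (lmul₂ x t) =
      lmul₂ (F x) (TensorProduct.map (mapₛₗ F) (mapₛₗ F) t) := by
    intro x t
    induction t with
    | zero => simp
    | add a b ha hb => simp only [map_add, ha, hb]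
    | tmul a b =>
      simp only [lmul₂_tmul, map_add, TensorProduct.map_tmul, mapₛₗ_apply, map_mul, map_iL]
  induction D using UEnv.induction with
  | one => simp [comul_one, mapₛₗ_apply]
  | add a b ha hb => simp only [map_add, ha, hb]
  | smul r a ha =>
    rw [map_smul', comul.map_smul, ha, comul.map_smul, LinearMap.map_smulₛₗ]; rfl
  | mul x a ha => rw [map_mul, map_iL, comul_iL_mul, comul_iL_mul, ha, h]

end map

lemma map_eq_self {σ : R →ₐ[K] R} (F : LieRinehartAlgebra.Hom σ L L) (hσ : ∀ r, σ r = r)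
    (hF : ∀ x, F x = x) (D : UEnv K R L) : map F D = D := by
  induction D using UEnv.induction with
  | one => simp
  | add a b ha hb => simp only [map_add, ha, hb]
  | smul r a ha => rw [map_smul', ha, hσ]
  | mul x a ha => rw [map_mul, map_iL, ha, hF]

lemma map_map {R' L' : Type*} [CommRing R'] [Algebra K R'] [LieRing L'] [Module R' L']
    [LieRingModule L' R'] [LieAlgebra K L'] [LieRinehartRing R' L'] [LieRinehartAlgebra K R' L']
    {R'' L'' : Type*} [CommRing R''] [Algebra K R''] [LieRing L''] [Module R'' L'']
    [LieRingModule L'' R''] [LieAlgebra K L''] [LieRinehartRing R'' L'']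
    [LieRinehartAlgebra K R'' L''] {σ : R →ₐ[K] R'} {σ' : R' →ₐ[K] R''} {τ : R →ₐ[K] R''}
    (F : LieRinehartAlgebra.Hom σ L L') (F' : LieRinehartAlgebra.Hom σ' L' L'')
    (G : LieRinehartAlgebra.Hom τ L L'') (hσ : ∀ r, σ' (σ r) = τ r) (hF : ∀ x, F' (F x) = G x)
    (D : UEnv K R L) : map F' (map F D) = map G D := by
  induction D using UEnv.induction with
  | one => simp
  | add a b ha hb => simp only [map_add, ha, hb]
  | smul r a ha => rw [map_smul', map_smul', map_smul', ha, hσ]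
  | mul x a ha => rw [map_mul, map_iL, map_mul, map_iL, map_mul, map_iL, ha, hF]

variable (K R L)

/-- The canonical filtration: `F_p 𝓤` is spanned over `R` by products of at most `p` elements
of `L`. -/
def filtration (p : ℕ) : Submodule R (UEnv K R L) :=
  Submodule.span R {D | ∃ l : List L, l.length ≤ p ∧ D = (l.map (iL K R L)).prod}

end UEnv
end UEnv

section Sheaf

variable {X : TopCat.{u}}

/-- The ring of sections of a sheaf of commutative rings over an open set. -/
def Sec (R : X.Sheaf CommRingCat.{u}) (U : Opens X) : Type u := R.obj.obj (op U)

instance (R : X.Sheaf CommRingCat.{u}) (U : Opens X) : CommRing (Sec R U) :=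
  inferInstanceAs (CommRing (R.obj.obj (op U)))

/-- Restriction of sections. -/
def res (R : X.Sheaf CommRingCat.{u}) {U V : Opens X} (h : V ≤ U) : Sec R U →+* Sec R V :=
  (R.obj.map (homOfLE h).op).hom

lemma res_self (R : X.Sheaf CommRingCat.{u}) {U : Opens X} (h : U ≤ U) (s : Sec R U) :
    res R h s = s := by
  have : (homOfLE h).op = 𝟙 (op U) := rfl
  simp only [res, this, R.obj.map_id]
  rfl

lemma res_res (R : X.Sheaf CommRingCat.{u}) {U V W : Opens X} (h : V ≤ U) (h' : W ≤ V)
    (s : Sec R U) : res R h' (res R h s) = res R (h'.trans h) s := by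
  have : (homOfLE (h'.trans h)).op = (homOfLE h).op ≫ (homOfLE h').op := rfl
  simp only [res, this, R.obj.map_comp]
  rfl

/-- The underlying sheaf of rings of a sheaf of commutative rings. -/
abbrev ringSheaf (R : X.Sheaf CommRingCat.{u}) : X.Sheaf RingCat.{u} :=
  (sheafCompose _ (forget₂ CommRingCat.{u} RingCat.{u})).obj R

/-- A presheaf of `R`-modules in elementary terms: modules of sections over each open set and
semilinear restriction maps. -/
structure ModPresheaf (R : X.Sheaf CommRingCat.{u}) where
  obj : Opens X → Type u
  [addCommGroup : ∀ U, AddCommGroup (obj U)]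
  [module : ∀ U, Module (Sec R U) (obj U)]
  res : ∀ {U V : Opens X} (h : V ≤ U), obj U →ₛₗ[res R h] obj V
  res_self : ∀ {U : Opens X} (h : U ≤ U) (m : obj U), res h m = m
  res_res : ∀ {U V W : Opens X} (h : V ≤ U) (h' : W ≤ V) (m : obj U),
    res h' (res h m) = res (h'.trans h) m

namespace ModPresheaf

attribute [instance] ModPresheaf.addCommGroup ModPresheaf.module

variable {R : X.Sheaf CommRingCat.{u}}

/-- The underlying presheaf of abelian groups. -/
def ab (P : ModPresheaf R) : (Opens X)ᵒᵖ ⥤ Ab.{u} where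
  obj U := AddCommGrpCat.of (P.obj U.unop)
  map f := AddCommGrpCat.ofHom (P.res (leOfHom f.unop)).toAddMonoidHom
  map_id U := by
    ext m
    exact P.res_self _ m
  map_comp f g := by
    ext m
    exact (P.res_res _ _ m).symm

instance (P : ModPresheaf R) (U : (Opens X)ᵒᵖ) :
    Module ((ringSheaf R).obj.obj U) (P.ab.obj U) :=
  inferInstanceAs (Module (Sec R U.unop) (P.obj U.unop))

/-- The associated object of the category of presheaves of modules. -/
def toPresheafOfModules (P : ModPresheaf R) : PresheafOfModules.{u} (ringSheaf R).obj :=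
  PresheafOfModules.ofPresheaf P.ab (fun _ _ f r m => (P.res (leOfHom f.unop)).map_smulₛₗ r m)

/-- The sections of a presheaf of modules over an open set. -/
def MSec (M : PresheafOfModules.{u} (ringSheaf R).obj) (U : Opens X) : Type u := M.obj (op U)

instance (M : PresheafOfModules.{u} (ringSheaf R).obj) (U : Opens X) : AddCommGroup (MSec M U) :=
  inferInstanceAs (AddCommGroup (M.obj (op U)))

instance (M : PresheafOfModules.{u} (ringSheaf R).obj) (U : Opens X) :
    Module (Sec R U) (MSec M U) := (M.obj (op U)).isModule

/-- The elementary form of a presheaf of modules. -/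
def ofPresheafOfModules (M : PresheafOfModules.{u} (ringSheaf R).obj) : ModPresheaf R where
  obj U := MSec M U
  res {U V} h :=
    { toFun := fun m => M.map (homOfLE h).op m
      map_add' := fun a b => map_add (M.map (homOfLE h).op).hom a b
      map_smul' := fun r m => M.map_smul (homOfLE h).op r m }
  res_self {U} h m := by
    change M.map (𝟙 (op U)) m = m
    rw [M.map_id]; rfl
  res_res {U V W} h h' m := by
    exact (M.map_comp_apply (homOfLE h).op (homOfLE h').op m).symm

/-- The elementary form of a sheaf of modules. -/
def ofSheaf (M : SheafOfModules.{u} (ringSheaf R)) : ModPresheaf R := ofPresheafOfModules M.val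

/-- The sheaf condition. -/
def IsSheaf (P : ModPresheaf R) : Prop := TopCat.Presheaf.IsSheaf P.ab

lemma isSheaf_ofSheaf (M : SheafOfModules.{u} (ringSheaf R)) : (ofSheaf M).IsSheaf := M.isSheaf

/-- The sheaf of modules associated to a presheaf of modules. -/
def sheafification (P : ModPresheaf R) : SheafOfModules.{u} (ringSheaf R) :=
  (PresheafOfModules.sheafification (𝟙 (ringSheaf R).obj)).obj P.toPresheafOfModules

/-- The sheaf associated to a presheaf of modules, in elementary form. -/
def sheafify (P : ModPresheaf R) : ModPresheaf R := ofSheaf P.sheafification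

lemma isSheaf_sheafify (P : ModPresheaf R) : P.sheafify.IsSheaf := isSheaf_ofSheaf _

/-- The canonical map from a presheaf to the associated sheaf, on sections. -/
def toSheafify (P : ModPresheaf R) (U : Opens X) : P.obj U →+ P.sheafify.obj U :=
  ((CategoryTheory.toSheafify (Opens.grothendieckTopology X) P.ab).app (op U)).hom

lemma toSheafify_smul (P : ModPresheaf R) (U : Opens X) (r : Sec R U) (m : P.obj U) :
    P.toSheafify U (r • m) = r • P.toSheafify U m :=
  ((((PresheafOfModules.sheafificationAdjunction (𝟙 (ringSheaf R).obj)).unit.app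
    P.toPresheafOfModules).app (op U)).hom.map_smul r m)

lemma toSheafify_res (P : ModPresheaf R) {U V : Opens X} (h : V ≤ U) (m : P.obj U) :
    P.toSheafify V (P.res h m) = P.sheafify.res h (P.toSheafify U m) :=
  ConcreteCategory.congr_hom
    ((CategoryTheory.toSheafify (Opens.grothendieckTopology X) P.ab).naturality (homOfLE h).op) m

/-- An additive map (on sections, compatible with restrictions) from `P` to a sheaf `Q`, possibly
of modules over another sheaf of rings, extends to the sheaf associated to `P`. -/
def sheafifyLift (P : ModPresheaf R) {S : X.Sheaf CommRingCat.{u}} (Q : ModPresheaf S)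
    (hQ : Q.IsSheaf) (f : ∀ U, P.obj U →+ Q.obj U)
    (hf : ∀ {U V : Opens X} (h : V ≤ U) (m : P.obj U), f V (P.res h m) = Q.res h (f U m))
    (U : Opens X) : P.sheafify.obj U →+ Q.obj U :=
  ((CategoryTheory.sheafifyLift (Opens.grothendieckTopology X)
    ({ app := fun U => AddCommGrpCat.ofHom (f U.unop)
       naturality := fun U V g => by
        ext m
        exact hf (leOfHom g.unop) m } : P.ab ⟶ Q.ab) hQ).app (op U)).hom

lemma sheafifyLift_toSheafify (P : ModPresheaf R) {S : X.Sheaf CommRingCat.{u}}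
    (Q : ModPresheaf S) (hQ : Q.IsSheaf) (f : ∀ U, P.obj U →+ Q.obj U)
    (hf : ∀ {U V : Opens X} (h : V ≤ U) (m : P.obj U), f V (P.res h m) = Q.res h (f U m))
    (U : Opens X) (m : P.obj U) :
    P.sheafifyLift Q hQ f hf U (P.toSheafify U m) = f U m :=
  ConcreteCategory.congr_hom (congr_app (CategoryTheory.toSheafify_sheafifyLift
    (Opens.grothendieckTopology X)
    ({ app := fun U => AddCommGrpCat.ofHom (f U.unop)
       naturality := fun U V g => by
        ext m
        exact hf (leOfHom g.unop) m } : P.ab ⟶ Q.ab) hQ) (op U)) m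

lemma isSheaf_iff (P : ModPresheaf R) : P.IsSheaf ↔
    ∀ ⦃ι : Type u⦄ (U : ι → Opens X) (V : Opens X) (hle : ∀ i, U i ≤ V) (_ : V ≤ iSup U)
      (s : ∀ i, P.obj (U i)),
      (∀ i j, P.res (inf_le_left : U i ⊓ U j ≤ U i) (s i) =
        P.res (inf_le_right : U i ⊓ U j ≤ U j) (s j)) →
      ∃! t : P.obj V, ∀ i, P.res (hle i) t = s i := by
  constructor
  · intro hP ι U V hle hcov s hs
    let s' : ∀ i, ToType (P.ab.obj (op (U i))) := s
    exact TopCat.Sheaf.existsUnique_gluing' (⟨P.ab, hP⟩ : X.Sheaf Ab.{u}) U V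
      (fun i => homOfLE (hle i)) hcov s' hs
  · intro H
    rw [IsSheaf, TopCat.Presheaf.isSheaf_iff_isSheafUniqueGluing]
    intro ι U s hs
    exact H U (iSup U) (fun i => le_iSup U i) le_rfl s hs

end ModPresheaf
end Sheaf

section Hom

variable {X : TopCat.{u}} {R : X.Sheaf CommRingCat.{u}}

namespace ModPresheaf

/-- The sections over `U` of the internal Hom `𝓗om_R(P, Q)`: compatible families of linear maps
`P(V) → Q(V)`, for `V ⊆ U`. -/
def homSub (P Q : ModPresheaf R) (U : Opens X) :
    AddSubgroup (∀ V : {V : Opens X // V ≤ U}, P.obj V.1 →ₗ[Sec R V.1] Q.obj V.1) where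
  carrier := {φ | ∀ (V W : {V : Opens X // V ≤ U}) (h : W.1 ≤ V.1) (m : P.obj V.1),
    φ W (P.res h m) = Q.res h (φ V m)}
  zero_mem' := fun V W h m => by simp
  add_mem' := fun {φ ψ} hφ hψ V W h m => by
    simp only [Pi.add_apply, LinearMap.add_apply, map_add, hφ V W h m, hψ V W h m]
  neg_mem' := fun {φ} hφ V W h m => by
    simp only [Pi.neg_apply, LinearMap.neg_apply, map_neg, hφ V W h m]

/-- The sections over `U` of the internal Hom `𝓗om_R(P, Q)`. -/
def HomSec (P Q : ModPresheaf R) (U : Opens X) : Type u := homSub P Q U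

instance (P Q : ModPresheaf R) (U : Opens X) : AddCommGroup (HomSec P Q U) :=
  inferInstanceAs (AddCommGroup (homSub P Q U))

variable {P Q : ModPresheaf R}

/-- The component over `V ⊆ U` of a section over `U` of `𝓗om_R(P, Q)`. -/
def HomSec.app {U : Opens X} (φ : HomSec P Q U) {V : Opens X} (h : V ≤ U) :
    P.obj V →ₗ[Sec R V] Q.obj V := φ.1 ⟨V, h⟩

lemma HomSec.app_res {U : Opens X} (φ : HomSec P Q U) {V W : Opens X} (h : V ≤ U) (h' : W ≤ V)
    (m : P.obj V) : φ.app (h'.trans h) (P.res h' m) = Q.res h' (φ.app h m) :=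
  φ.2 ⟨V, h⟩ ⟨W, h'.trans h⟩ h' m

lemma HomSec.ext {U : Opens X} {φ ψ : HomSec P Q U}
    (H : ∀ (V : Opens X) (h : V ≤ U) m, φ.app h m = ψ.app h m) : φ = ψ :=
  Subtype.ext (funext fun V => LinearMap.ext fun m => H V.1 V.2 m)

instance (U : Opens X) : SMul (Sec R U) (HomSec P Q U) where
  smul r φ := ⟨fun V => LieAlgd.res R V.2 r • φ.1 V, fun V W h m => by
    rw [LinearMap.smul_apply, LinearMap.smul_apply, φ.2 V W h m, LinearMap.map_smulₛₗ,
      LieAlgd.res_res]⟩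

lemma HomSec.smul_app {U : Opens X} (r : Sec R U) (φ : HomSec P Q U) {V : Opens X} (h : V ≤ U)
    (m : P.obj V) : (r • φ).app h m = LieAlgd.res R h r • φ.app h m := rfl

lemma HomSec.add_app {U : Opens X} (φ ψ : HomSec P Q U) {V : Opens X} (h : V ≤ U)
    (m : P.obj V) : (φ + ψ).app h m = φ.app h m + ψ.app h m := rfl

instance (U : Opens X) : Module (Sec R U) (HomSec P Q U) where
  one_smul φ := HomSec.ext fun V h m => by rw [HomSec.smul_app, map_one, one_smul]
  mul_smul r s φ := HomSec.ext fun V h m => by simp only [HomSec.smul_app, map_mul, mul_smul]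
  smul_zero r := HomSec.ext fun V h m => smul_zero _
  smul_add r φ ψ := HomSec.ext fun V h m => smul_add _ _ _
  add_smul r s φ := HomSec.ext fun V h m => by
    simp only [HomSec.smul_app, HomSec.add_app, map_add, add_smul]
  zero_smul φ := HomSec.ext fun V h m => by
    rw [HomSec.smul_app, map_zero, zero_smul]; rfl

/-- Restriction of sections of the internal Hom. -/
def HomSec.res {U V : Opens X} (h : V ≤ U) (φ : HomSec P Q U) : HomSec P Q V :=
  ⟨fun W => φ.1 ⟨W.1, W.2.trans h⟩,
    fun W W' h' m => φ.2 ⟨W.1, W.2.trans h⟩ ⟨W'.1, W'.2.trans h⟩ h' m⟩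

lemma HomSec.res_app {U V W : Opens X} (φ : HomSec P Q U) (h : V ≤ U) (h' : W ≤ V)
    (m : P.obj W) : (φ.res h).app h' m = φ.app (h'.trans h) m := rfl

variable (P Q) in
/-- The internal Hom `𝓗om_R(P, Q)`. -/
def ihom : ModPresheaf R where
  obj U := HomSec P Q U
  res {U V} h :=
    { toFun := HomSec.res h
      map_add' := fun φ ψ => rfl
      map_smul' := fun r φ => HomSec.ext fun W h' m => by
        rw [HomSec.smul_app, HomSec.res_app, HomSec.res_app, HomSec.smul_app, LieAlgd.res_res] }
  res_self h φ := rfl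
  res_res h h' φ := rfl

lemma IsSheaf.ext (hQ : Q.IsSheaf) {ι : Type u} (U : ι → Opens X) {V : Opens X}
    (hle : ∀ i, U i ≤ V) (hcov : V ≤ iSup U) {s t : Q.obj V}
    (H : ∀ i, Q.res (hle i) s = Q.res (hle i) t) : s = t := by
  obtain ⟨_, _, hu⟩ := Q.isSheaf_iff.1 hQ U V hle hcov (fun i => Q.res (hle i) t)
    (fun i j => by simp only [Q.res_res])
  exact (hu s H).trans (hu t fun _ => rfl).symm

lemma HomSec.glue (hQ : Q.IsSheaf) {ι : Type u} (U : ι → Opens X) (V : Opens X)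
    (hle : ∀ i, U i ≤ V) (hcov : V ≤ iSup U) (φ : ∀ i, HomSec P Q (U i))
    (hφ : ∀ i j, (φ i).res (inf_le_left : U i ⊓ U j ≤ U i) =
      (φ j).res (inf_le_right : U i ⊓ U j ≤ U j)) :
    ∃! ψ : HomSec P Q V, ∀ i, ψ.res (hle i) = φ i := by
  have hφ' : ∀ i j (W : Opens X) (hi : W ≤ U i) (hj : W ≤ U j) (m : P.obj W),
      (φ i).app hi m = (φ j).app hj m := fun i j W hi hj m =>
    congrArg (fun ψ : HomSec P Q (U i ⊓ U j) => ψ.app (le_inf hi hj) m) (hφ i j)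
  have hcovW : ∀ W : Opens X, W ≤ V → W ≤ ⨆ i, W ⊓ U i := fun W hW => by
    rw [← inf_iSup_eq]; exact le_inf le_rfl (hW.trans hcov)
  have key : ∀ (W : Opens X) (hW : W ≤ V) (m : P.obj W), ∃! t : Q.obj W, ∀ i,
      Q.res (inf_le_left : W ⊓ U i ≤ W) t =
        (φ i).app (inf_le_right : W ⊓ U i ≤ U i) (P.res inf_le_left m) := fun W hW m =>
    Q.isSheaf_iff.1 hQ (fun i => W ⊓ U i) W (fun i => inf_le_left) (hcovW W hW)
      (fun i => (φ i).app inf_le_right (P.res inf_le_left m)) (fun i j => by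
        rw [← HomSec.app_res, ← HomSec.app_res, P.res_res, P.res_res]
        exact hφ' _ _ _ _ _ _)
  choose t ht' hu using key
  have ht : ∀ (W : Opens X) (hW : W ≤ V) (m : P.obj W) i,
      Q.res (inf_le_left : W ⊓ U i ≤ W) (t W hW m) =
        (φ i).app (inf_le_right : W ⊓ U i ≤ U i) (P.res inf_le_left m) := ht'
  refine ⟨⟨fun W =>
    { toFun := fun m => t W.1 W.2 m
      map_add' := fun a b => ?_
      map_smul' := fun r a => ?_ }, fun W W' h m => ?_⟩, fun i => ?_, fun ψ hψ => ?_⟩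
  · refine (hu W.1 W.2 (a + b) _ fun i => ?_).symm
    simp only [map_add, ht]
  · refine (hu W.1 W.2 (r • a) _ fun i => ?_).symm
    simp only [RingHom.id_apply, LinearMap.map_smulₛₗ, ht]
  · refine (hu W'.1 W'.2 _ _ fun i => ?_).symm
    have h1 : W'.1 ⊓ U i ≤ W.1 ⊓ U i := inf_le_inf_right _ h
    change Q.res _ (Q.res h (t W.1 W.2 m)) = _
    rw [Q.res_res, ← Q.res_res (inf_le_left : W.1 ⊓ U i ≤ W.1) h1, ht, ← HomSec.app_res,
      P.res_res, P.res_res]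
  · refine HomSec.ext fun W h m => ?_
    change t W _ m = _
    refine (hu W (h.trans (hle i)) m _ fun j => ?_).symm
    rw [← HomSec.app_res _ h (inf_le_left : W ⊓ U j ≤ W)]
    exact hφ' _ _ _ _ _ _
  · refine HomSec.ext fun W h m => ?_
    refine hu W h m _ fun i => ?_
    rw [← HomSec.app_res _ h (inf_le_left : W ⊓ U i ≤ W)]
    exact congrArg (fun χ : HomSec P Q (U i) => χ.app inf_le_right (P.res inf_le_left m)) (hψ i)

lemma isSheaf_ihom (hQ : Q.IsSheaf) : (ihom P Q).IsSheaf :=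
  (isSheaf_iff _).2 fun _ U V hle hcov φ hφ => HomSec.glue hQ U V hle hcov φ hφ

variable (R) in
/-- The sheaf of rings `R` as a module over itself. -/
def self : ModPresheaf R where
  obj U := Sec R U
  res h := { toFun := LieAlgd.res R h, map_add' := map_add _, map_smul' := map_mul _ }
  res_self h m := LieAlgd.res_self R h m
  res_res h h' m := LieAlgd.res_res R h h' m

lemma isSheaf_self : (self R).IsSheaf := by
  rw [isSheaf_iff]
  intro ι U V hle hcov s hs
  let s' : ∀ i, ToType (R.obj.obj (op (U i))) := s
  exact TopCat.Sheaf.existsUnique_gluing' R U V (fun i => homOfLE (hle i)) hcov s' hs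

end ModPresheaf

/-- A presheaf of cocommutative `R`-coalgebras. -/
structure CoalgPresheaf (R : X.Sheaf CommRingCat.{u}) extends ModPresheaf R where
  [coalgebra : ∀ U, Coalgebra (Sec R U) (obj U)]
  [isCocomm : ∀ U, Coalgebra.IsCocomm (Sec R U) (obj U)]
  counit_res : ∀ {U V : Opens X} (h : V ≤ U) (m : obj U),
    Coalgebra.counit (R := Sec R V) (res h m) = LieAlgd.res R h (Coalgebra.counit m)
  comul_res : ∀ {U V : Opens X} (h : V ≤ U) (m : obj U),
    Coalgebra.comul (R := Sec R V) (res h m) =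
      TensorProduct.map (res h) (res h) (Coalgebra.comul m)

namespace CoalgPresheaf

attribute [instance] CoalgPresheaf.coalgebra CoalgPresheaf.isCocomm

/-- The ring of sections over `U` of the dual `𝓗om_R(C, R)` of a presheaf of cocommutative
coalgebras: compatible families of linear functionals `C(V) → R(V)`, for `V ⊆ U`, with the
convolution product `(φ ψ)(D) = φ(D₍₁₎) ψ(D₍₂₎)`, whose unit is the counit of `C`. -/
def dualSub (C : CoalgPresheaf R) (U : Opens X) :
    Subring (∀ V : {V : Opens X // V ≤ U}, WithConv (C.obj V.1 →ₗ[Sec R V.1] Sec R V.1)) where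
  carrier := {φ | ∀ (V W : {V : Opens X // V ≤ U}) (h : W.1 ≤ V.1) (m : C.obj V.1),
    (φ W).ofConv (C.res h m) = LieAlgd.res R h ((φ V).ofConv m)}
  zero_mem' := fun V W h m => by simp
  one_mem' := fun V W h m => C.counit_res h m
  add_mem' := fun {φ ψ} hφ hψ V W h m => by
    have h1 := hφ V W h m
    have h2 := hψ V W h m
    simp only [Pi.add_apply, WithConv.ofConv_add, LinearMap.add_apply, map_add, h1, h2]
  neg_mem' := fun {φ} hφ V W h m => by
    have h1 := hφ V W h m
    simp only [Pi.neg_apply, WithConv.ofConv_neg, LinearMap.neg_apply, map_neg, h1]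
  mul_mem' := fun {φ ψ} hφ hψ V W h m => by
    simp only [Pi.mul_apply]
    change LinearMap.mul' (Sec R W.1) (Sec R W.1) (TensorProduct.map (φ W).ofConv (ψ W).ofConv
      (Coalgebra.comul (C.res h m))) = LieAlgd.res R h (LinearMap.mul' (Sec R V.1) (Sec R V.1)
        (TensorProduct.map (φ V).ofConv (ψ V).ofConv (Coalgebra.comul m)))
    rw [C.comul_res]
    generalize (Coalgebra.comul (R := Sec R V.1) m : C.obj V.1 ⊗[Sec R V.1] C.obj V.1) = t
    induction t with
    | zero => simp
    | add a b ha hb => simp only [map_add, ha, hb]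
    | tmul a b =>
      have h1 := hφ V W h a
      have h2 := hψ V W h b
      simp only [TensorProduct.map_tmul, LinearMap.mul'_apply, map_mul, h1, h2]

/-- The ring of sections over `U` of the dual of a presheaf of cocommutative coalgebras. -/
def DualSec (C : CoalgPresheaf R) (U : Opens X) : Type u := dualSub C U

instance (C : CoalgPresheaf R) (U : Opens X) : CommRing (DualSec C U) :=
  inferInstanceAs (CommRing (dualSub C U))

variable {C : CoalgPresheaf R}

/-- The component over `V ⊆ U` of a section over `U` of the dual. -/
def DualSec.app {U : Opens X} (φ : DualSec C U) {V : Opens X} (h : V ≤ U) :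
    C.obj V →ₗ[Sec R V] Sec R V := (φ.1 ⟨V, h⟩).ofConv

lemma DualSec.app_res {U : Opens X} (φ : DualSec C U) {V W : Opens X} (h : V ≤ U) (h' : W ≤ V)
    (m : C.obj V) : φ.app (h'.trans h) (C.res h' m) = LieAlgd.res R h' (φ.app h m) :=
  φ.2 ⟨V, h⟩ ⟨W, h'.trans h⟩ h' m

lemma DualSec.ext {U : Opens X} {φ ψ : DualSec C U}
    (H : ∀ (V : Opens X) (h : V ≤ U) m, φ.app h m = ψ.app h m) : φ = ψ :=
  Subtype.ext (funext fun V => WithConv.ext (LinearMap.ext fun m => H V.1 V.2 m))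

variable (C) in
/-- Restriction of sections of the dual. -/
def dualRes {U V : Opens X} (h : V ≤ U) : DualSec C U →+* DualSec C V where
  toFun φ := ⟨fun W => φ.1 ⟨W.1, W.2.trans h⟩,
    fun W W' h' m => φ.2 ⟨W.1, W.2.trans h⟩ ⟨W'.1, W'.2.trans h⟩ h' m⟩
  map_one' := rfl
  map_mul' _ _ := rfl
  map_zero' := rfl
  map_add' _ _ := rfl

variable (C) in
/-- The dual `𝓗om_R(C, R)` of a presheaf of cocommutative coalgebras, as a sheaf of commutative
rings under the convolution product. -/
def dual : X.Sheaf CommRingCat.{u} where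
  obj :=
    { obj := fun U => CommRingCat.of (DualSec C U.unop)
      map := fun f => CommRingCat.ofHom (C.dualRes (leOfHom f.unop)) }
  property := by
    change TopCat.Presheaf.IsSheaf _
    rw [TopCat.Presheaf.isSheaf_iff_isSheafUniqueGluing]
    intro ι U s hs
    let toHom : ∀ {V : Opens X}, DualSec C V →
        (ModPresheaf.ihom C.toModPresheaf (ModPresheaf.self R)).obj V :=
      fun φ => ⟨fun V => (φ.1 V).ofConv, φ.2⟩
    let ofHom : ∀ {V : Opens X},
        (ModPresheaf.ihom C.toModPresheaf (ModPresheaf.self R)).obj V → DualSec C V :=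
      fun φ => ⟨fun V => WithConv.toConv (φ.1 V), φ.2⟩
    obtain ⟨t, ht, hu⟩ := (ModPresheaf.isSheaf_iff _).1
      (ModPresheaf.isSheaf_ihom (P := C.toModPresheaf) (ModPresheaf.isSheaf_self (R := R)))
      U (iSup U) (fun i => le_iSup U i) le_rfl (fun i => toHom (s i))
      (fun i j => congrArg toHom (hs i j))
    exact ⟨ofHom t, fun i => congrArg ofHom (ht i),
      fun t' ht' => congrArg ofHom (hu (toHom t') fun i => congrArg toHom (ht' i))⟩

end CoalgPresheaf
end Hom

section Change

variable {X : TopCat.{u}} {R S : X.Sheaf CommRingCat.{u}}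

/-- The map on sections of a morphism of sheaves of commutative rings. -/
def homApp (α : R ⟶ S) (U : Opens X) : Sec R U →+* Sec S U := (α.hom.app (op U)).hom

lemma homApp_res (α : R ⟶ S) {U V : Opens X} (h : V ≤ U) (r : Sec R U) :
    homApp α V (res R h r) = res S h (homApp α U r) :=
  ConcreteCategory.congr_hom (α.hom.naturality (homOfLE h).op) r

/-- The morphism of sheaves of rings given by compatible ring homomorphisms on sections. -/
def mkHom (f : ∀ U, Sec R U →+* Sec S U)
    (hf : ∀ {U V : Opens X} (h : V ≤ U) (r : Sec R U), f V (res R h r) = res S h (f U r)) :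
    R ⟶ S :=
  ⟨{ app := fun U => CommRingCat.ofHom (f U.unop)
     naturality := fun U V g => by
      ext r
      exact hf (leOfHom g.unop) r }⟩

/-- `S(U)`, regarded as an algebra over `R(U)` through a morphism `α : R ⟶ S`. -/
def AlgVia (_ : R ⟶ S) (U : Opens X) : Type u := Sec S U

instance (α : R ⟶ S) (U : Opens X) : CommRing (AlgVia α U) := inferInstanceAs (CommRing (Sec S U))

/-- The identity `S(U) → S(U)`. -/
def AlgVia.of (α : R ⟶ S) (U : Opens X) : Sec S U ≃+* AlgVia α U := RingEquiv.refl _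

instance (α : R ⟶ S) (U : Opens X) : Algebra (Sec R U) (AlgVia α U) :=
  ((AlgVia.of α U).toRingHom.comp (homApp α U)).toAlgebra

lemma AlgVia.smul_def (α : R ⟶ S) {U : Opens X} (r : Sec R U) (s : AlgVia α U) :
    r • s = AlgVia.of α U (homApp α U r) * s := rfl

/-- Restriction of sections of `S`, as a semilinear map. -/
def AlgVia.res (α : R ⟶ S) {U V : Opens X} (h : V ≤ U) :
    AlgVia α U →ₛₗ[LieAlgd.res R h] AlgVia α V where
  toFun := LieAlgd.res S h
  map_add' := map_add _
  map_smul' r s := by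
    refine (map_mul (LieAlgd.res S h) (homApp α U r) s).trans ?_
    rw [← homApp_res]; rfl

namespace ModPresheaf

/-- Restriction of scalars along `α : R ⟶ S`. -/
def restrictScalars (α : R ⟶ S) (P : ModPresheaf S) : ModPresheaf R where
  obj U := P.obj U
  module U := Module.compHom _ (homApp α U)
  res {U V} h :=
    letI := Module.compHom (P.obj U) (homApp α U)
    letI := Module.compHom (P.obj V) (homApp α V)
    { toFun := P.res h
      map_add' := map_add _
      map_smul' := fun r m => by
        refine ((P.res h).map_smulₛₗ (homApp α U r) m).trans ?_
        rw [← homApp_res]; rfl }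
  res_self h m := P.res_self h m
  res_res h h' m := P.res_res h h' m

/-- The identity map to the restriction of scalars. -/
def ofScalars (α : R ⟶ S) (P : ModPresheaf S) (U : Opens X) :
    P.obj U ≃+ (P.restrictScalars α).obj U := AddEquiv.refl _

/-- The presheaf tensor product `U ↦ P(U) ⊗ Q(U)` over `R(U)`. -/
def tensor (P Q : ModPresheaf R) : ModPresheaf R where
  obj U := P.obj U ⊗[Sec R U] Q.obj U
  res h := TensorProduct.map (P.res h) (Q.res h)
  res_self h m := by
    induction m with
    | zero => simp
    | add a b ha hb => rw [map_add, ha, hb]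
    | tmul a b => rw [TensorProduct.map_tmul, P.res_self, Q.res_self]
  res_res h h' m := by
    induction m with
    | zero => simp
    | add a b ha hb => simp only [map_add, ha, hb]
    | tmul a b => simp only [TensorProduct.map_tmul, P.res_res, Q.res_res]

/-- The `S(U)`-module structure of `S(U) ⊗ P(U)`. -/
@[reducible] def baseChangeModule (α : R ⟶ S) (P : ModPresheaf R) (U : Opens X) :
    Module (Sec S U) (AlgVia α U ⊗[Sec R U] P.obj U) :=
  Module.compHom _ (AlgVia.of α U).toRingHom

/-- The presheaf of `S`-modules `U ↦ S(U) ⊗ P(U)`, the tensor product being taken over `R(U)`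
through `α : R ⟶ S`. -/
def baseChange (α : R ⟶ S) (P : ModPresheaf R) : ModPresheaf S where
  obj U := AlgVia α U ⊗[Sec R U] P.obj U
  module U := baseChangeModule α P U
  res {U V} h :=
    letI := baseChangeModule α P U
    letI := baseChangeModule α P V
    { toFun := TensorProduct.map (AlgVia.res α h) (P.res h)
      map_add' := map_add _
      map_smul' := fun s m => by
        induction m with
        | zero => rw [smul_zero, map_zero, smul_zero]
        | add a b ha hb => rw [smul_add, map_add, ha, hb, map_add, smul_add]
        | tmul a b =>
          have h1 : s • (a ⊗ₜ[Sec R U] b) = (AlgVia.of α U s * a) ⊗ₜ[Sec R U] b := rfl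
          have h2 : AlgVia.res α h (AlgVia.of α U s * a) =
            AlgVia.of α V (LieAlgd.res S h s) * AlgVia.res α h a := map_mul (LieAlgd.res S h) _ _
          rw [h1, TensorProduct.map_tmul, h2]
          rfl }
  res_self {U} h m := by
    change TensorProduct.map (AlgVia.res α h) (P.res h) m = m
    induction m with
    | zero => simp
    | add a b ha hb => rw [map_add, ha, hb]
    | tmul a b =>
      rw [TensorProduct.map_tmul, P.res_self]
      exact congrArg (fun z : AlgVia α U => z ⊗ₜ[Sec R U] b) (LieAlgd.res_self S h a)
  res_res {U V W} h h' m := by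
    change TensorProduct.map (AlgVia.res α h') (P.res h')
      (TensorProduct.map (AlgVia.res α h) (P.res h) m) =
      TensorProduct.map (AlgVia.res α (h'.trans h)) (P.res (h'.trans h)) m
    induction m with
    | zero => simp
    | add a b ha hb => simp only [map_add, ha, hb]
    | tmul a b =>
      simp only [TensorProduct.map_tmul, P.res_res]
      exact congrArg (fun z : AlgVia α W => z ⊗ₜ[Sec R W] P.res (h'.trans h) b)
        (LieAlgd.res_res S h h' a)

/-- An isomorphism of presheaves (in particular, of sheaves) of modules from `P` to `Q` over the
morphism of sheaves of rings `α : R ⟶ S`, i.e. an isomorphism of `R`-modules, where `R` acts on `Q`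
through `α`. -/
structure IsoOver (α : R ⟶ S) (P : ModPresheaf R) (Q : ModPresheaf S) where
  toEquiv : ∀ U, P.obj U ≃+ Q.obj U
  map_smul : ∀ {U : Opens X} (r : Sec R U) (m : P.obj U),
    toEquiv U (r • m) = homApp α U r • toEquiv U m
  naturality : ∀ {U V : Opens X} (h : V ≤ U) (m : P.obj U),
    toEquiv V (P.res h m) = Q.res h (toEquiv U m)

/-- An isomorphism of presheaves (in particular, of sheaves) of `R`-modules. -/
structure Iso (P Q : ModPresheaf R) where
  toEquiv : ∀ U, P.obj U ≃ₗ[Sec R U] Q.obj U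
  naturality : ∀ {U V : Opens X} (h : V ≤ U) (m : P.obj U),
    toEquiv V (P.res h m) = Q.res h (toEquiv U m)

end ModPresheaf

/-- The `R`-algebra structure `r ↦ r ε` of the dual of a presheaf of coalgebras. -/
def CoalgPresheaf.unitHom (C : CoalgPresheaf R) : R ⟶ C.dual :=
  mkHom (S := C.dual) (fun U =>
    ({ toFun := fun r => ⟨fun V => algebraMap (Sec R V.1) _ (res R V.2 r), fun V W h m => by
        change res R W.2 r * Coalgebra.counit (C.res h m) =
          res R h (res R V.2 r * Coalgebra.counit m)
        rw [C.counit_res, map_mul, res_res]⟩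
       map_one' := Subtype.ext (funext fun V => by simp; rfl)
       map_mul' := fun r s => Subtype.ext (funext fun V => by
        change algebraMap (Sec R V.1) (WithConv (C.obj V.1 →ₗ[Sec R V.1] Sec R V.1)) _ =
          algebraMap (Sec R V.1) _ _ * algebraMap (Sec R V.1) _ _
        rw [map_mul, map_mul])
       map_zero' := Subtype.ext (funext fun V => by simp; rfl)
       map_add' := fun r s => Subtype.ext (funext fun V => by
        change algebraMap (Sec R V.1) (WithConv (C.obj V.1 →ₗ[Sec R V.1] Sec R V.1)) _ =
          algebraMap (Sec R V.1) _ _ + algebraMap (Sec R V.1) _ _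
        rw [map_add, map_add]) } : Sec R U →+* CoalgPresheaf.DualSec C U))
    (fun {U V} h r => CoalgPresheaf.DualSec.ext fun W h' m => by
      change res R h' (res R h r) * Coalgebra.counit m = res R (h'.trans h) r * Coalgebra.counit m
      rw [res_res])

lemma CoalgPresheaf.app_unitHom_mul {C : CoalgPresheaf R} {U V : Opens X} (r : Sec R U)
    (β : Sec C.dual U) (h : V ≤ U) (a : C.obj V) :
    CoalgPresheaf.DualSec.app (C := C) (homApp C.unitHom U r * β) h a =
      res R h r * CoalgPresheaf.DualSec.app (C := C) β h a := by
  change (algebraMap (Sec R V) (WithConv (C.obj V →ₗ[Sec R V] Sec R V)) (res R h r) *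
    (β : CoalgPresheaf.DualSec C U).1 ⟨V, h⟩).ofConv a = _
  rw [← Algebra.smul_def]
  rfl

section Sym

variable {A A' M M' : Type*} [CommRing A] [CommRing A'] [AddCommGroup M] [Module A M]
  [AddCommGroup M'] [Module A' M']

/-- The map of symmetric algebras induced by a semilinear map. -/
def symMap {σ : A →+* A'} (f : M →ₛₗ[σ] M') : SymmetricAlgebra A M →+* SymmetricAlgebra A' M' :=
  letI : Algebra A (SymmetricAlgebra A' M') := ((algebraMap A' _).comp σ).toAlgebra
  (SymmetricAlgebra.lift (R := A) (M := M) (A := SymmetricAlgebra A' M')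
    { toFun := fun x => SymmetricAlgebra.ι A' M' (f x)
      map_add' := fun x y => by rw [map_add, map_add]
      map_smul' := fun r x => by
        rw [LinearMap.map_smulₛₗ, map_smul, Algebra.smul_def]; rfl }).toRingHom

variable {σ : A →+* A'} (f : M →ₛₗ[σ] M')

@[simp] lemma symMap_ι (x : M) :
    symMap f (SymmetricAlgebra.ι A M x) = SymmetricAlgebra.ι A' M' (f x) :=
  letI : Algebra A (SymmetricAlgebra A' M') := ((algebraMap A' _).comp σ).toAlgebra
  SymmetricAlgebra.lift_ι_apply _ x

@[simp] lemma symMap_algebraMap (r : A) :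
    symMap f (algebraMap A _ r) = algebraMap A' _ (σ r) :=
  letI : Algebra A (SymmetricAlgebra A' M') := ((algebraMap A' _).comp σ).toAlgebra
  AlgHom.commutes (SymmetricAlgebra.lift (R := A) (M := M) (A := SymmetricAlgebra A' M') _) r

lemma symMap_smul (r : A) (a : SymmetricAlgebra A M) : symMap f (r • a) = σ r • symMap f a := by
  rw [Algebra.smul_def, map_mul, symMap_algebraMap, Algebra.smul_def]

/-- `symMap` as a semilinear map. -/
def symMapₛₗ : SymmetricAlgebra A M →ₛₗ[σ] SymmetricAlgebra A' M' where
  toFun := symMap f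
  map_add' := map_add _
  map_smul' := symMap_smul f

lemma symMapₛₗ_apply (a : SymmetricAlgebra A M) : symMapₛₗ f a = symMap f a := rfl

lemma counit_symMap (a : SymmetricAlgebra A M) :
    Coalgebra.counit (R := A') (symMap f a) = σ (Coalgebra.counit (R := A) a) := by
  change Bialgebra.counitAlgHom A' (SymmetricAlgebra A' M') _ =
    σ (Bialgebra.counitAlgHom A (SymmetricAlgebra A M) _)
  induction a using SymmetricAlgebra.induction with
  | algebraMap r => rw [symMap_algebraMap, AlgHom.commutes, AlgHom.commutes]; rfl
  | ι x => rw [symMap_ι]; simp [SymmetricAlgebra.algebraMapInv_ι]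
  | mul a b ha hb => rw [map_mul, map_mul, map_mul, map_mul, ha, hb]
  | add a b ha hb => rw [map_add, map_add, map_add, map_add, ha, hb]

lemma comul_symMap (a : SymmetricAlgebra A M) :
    Coalgebra.comul (R := A') (symMap f a) =
      TensorProduct.map (symMapₛₗ f) (symMapₛₗ f) (Coalgebra.comul (R := A) a) := by
  have hmul : ∀ s t : SymmetricAlgebra A M ⊗[A] SymmetricAlgebra A M,
      TensorProduct.map (symMapₛₗ f) (symMapₛₗ f) (s * t) =
        TensorProduct.map (symMapₛₗ f) (symMapₛₗ f) s *
          TensorProduct.map (symMapₛₗ f) (symMapₛₗ f) t := by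
    intro s t
    induction s with
    | zero => simp
    | add a b ha hb => simp only [add_mul, map_add, ha, hb]
    | tmul a b =>
      induction t with
      | zero => simp
      | add c d hc hd => simp only [mul_add, map_add, hc, hd]
      | tmul c d =>
        simp only [Algebra.TensorProduct.tmul_mul_tmul, TensorProduct.map_tmul, symMapₛₗ_apply,
          map_mul]
  induction a using SymmetricAlgebra.induction with
  | algebraMap r =>
    rw [symMap_algebraMap, Bialgebra.comul_algebraMap, Bialgebra.comul_algebraMap,
      Algebra.TensorProduct.algebraMap_apply, Algebra.TensorProduct.algebraMap_apply,
      TensorProduct.map_tmul, symMapₛₗ_apply, symMapₛₗ_apply, symMap_algebraMap, map_one]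
  | ι x =>
    rw [symMap_ι, SymmetricAlgebra.comul_ι, SymmetricAlgebra.comul_ι, map_add,
      TensorProduct.map_tmul, TensorProduct.map_tmul]
    simp only [symMapₛₗ_apply, symMap_ι, map_one]
  | mul a b ha hb => rw [map_mul, Bialgebra.comul_mul, Bialgebra.comul_mul, hmul, ha, hb]
  | add a b ha hb => rw [map_add, map_add, map_add, map_add, ha, hb]

end Sym

/-- The presheaf of coalgebras `U ↦ Sym_{R(U)} M(U)`. -/
def symCoalg (M : ModPresheaf R) : CoalgPresheaf R where
  obj U := SymmetricAlgebra (Sec R U) (M.obj U)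
  res h := symMapₛₗ (M.res h)
  res_self h a := by
    rw [symMapₛₗ_apply]
    induction a using SymmetricAlgebra.induction with
    | algebraMap r => rw [symMap_algebraMap, res_self]
    | ι x => rw [symMap_ι, M.res_self]
    | mul a b ha hb => rw [map_mul, ha, hb]
    | add a b ha hb => rw [map_add, ha, hb]
  res_res h h' a := by
    rw [symMapₛₗ_apply, symMapₛₗ_apply, symMapₛₗ_apply]
    induction a using SymmetricAlgebra.induction with
    | algebraMap r => simp only [symMap_algebraMap, res_res]
    | ι x => simp only [symMap_ι, M.res_res]
    | mul a b ha hb => simp only [map_mul, ha, hb]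
    | add a b ha hb => simp only [map_add, ha, hb]
  counit_res h a := counit_symMap _ a
  comul_res h a := comul_symMap _ a

end Change

section UEnvRight

variable {K R L : Type*} [CommRing K] [CommRing R] [Algebra K R] [LieRing L] [Module R L]
  [LieRingModule L R] [LieAlgebra K L] [LieRinehartRing R L] [LieRinehartAlgebra K R L]

/-- Right multiplication on `𝓤(L, R)`, which is linear over `R` acting on the left. -/
def UEnv.rmul (E : UEnv K R L) : UEnv K R L →ₗ[R] UEnv K R L where
  toFun D := D * E
  map_add' a b := add_mul a b E
  map_smul' r D := by simp only [UEnv.smul_def, mul_assoc, RingHom.id_apply]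

/-- The identity `D r = D₍₁₎(r) D₍₂₎` in `𝓤(L, R)`. -/
lemma UEnv.lid_comul (r : R) (D : UEnv K R L) :
    TensorProduct.lid R (UEnv K R L) (TensorProduct.map (UEnv.counit ∘ₗ UEnv.rmul (UEnv.iR K R L r))
      LinearMap.id (UEnv.comul D)) = D * UEnv.iR K R L r := by
  induction D using UEnv.induction with
  | one =>
    have h : UEnv.counit (UEnv.iR K R L r) = r := by
      have := (UEnv.counit (K := K) (R := R) (L := L)).map_smul r 1
      rwa [UEnv.smul_def, mul_one, UEnv.counit_one, smul_eq_mul, mul_one] at this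
    simp [UEnv.comul_one, UEnv.rmul, h, UEnv.smul_def]
  | add a b ha hb => simp only [map_add, ha, hb, add_mul]
  | smul s a ha =>
    rw [UEnv.comul.map_smul, LinearMap.map_smul, map_smul, ha, UEnv.smul_def, UEnv.smul_def,
      mul_assoc]
  | mul x a ha =>
    rw [UEnv.comul_iL_mul, mul_assoc, ← ha]
    generalize UEnv.comul a = t
    induction t with
    | zero => simp
    | add a b ha hb => simp only [map_add, ha, hb, mul_add]
    | tmul a b =>
      simp only [UEnv.lmul₂_tmul, map_add, TensorProduct.map_tmul, LinearMap.comp_apply, UEnv.rmul,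
        LinearMap.coe_mk, AddHom.coe_mk, LinearMap.id_apply, TensorProduct.lid_tmul, mul_assoc,
        UEnv.counit_iL_mul, UEnv.iL_mul_smul]
      abel

end UEnvRight

/-- A ringed space over the field `K`: a ringed space whose structure sheaf is a sheaf of
commutative `K`-algebras. -/
structure RingedSpaceOver (K : Type u) [Field K] where
  toRingedSpace : AlgebraicGeometry.RingedSpace.{u}
  structureMap : K →+* toRingedSpace.presheaf.obj (op ⊤)

variable {K : Type u} [Field K]

namespace RingedSpaceOver

variable (S : RingedSpaceOver K)

/-- The underlying topological space. -/
abbrev X : TopCat.{u} := S.toRingedSpace.carrier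

/-- The structure sheaf. -/
def O : S.X.Sheaf CommRingCat.{u} := S.toRingedSpace.sheaf

/-- The category of sheaves of `O`-modules. -/
abbrev Modules := SheafOfModules.{u} (ringSheaf S.O)

instance (U : Opens S.X) : Algebra K (Sec S.O U) :=
  ((res S.O (le_top : U ≤ ⊤)).comp (S.structureMap : K →+* Sec S.O ⊤)).toAlgebra

/-- Restriction of functions, as a morphism of `K`-algebras. -/
def resAlg {U V : Opens S.X} (h : V ≤ U) : Sec S.O U →ₐ[K] Sec S.O V where
  toRingHom := res S.O h
  commutes' _ := res_res S.O le_top h _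

instance (P : ModPresheaf S.O) (U : Opens S.X) : Module K (P.obj U) :=
  Module.compHom _ (algebraMap K (Sec S.O U))

instance (P : ModPresheaf S.O) (U : Opens S.X) : IsScalarTower K (Sec S.O U) (P.obj U) where
  smul_assoc _ r m := by rw [Algebra.smul_def, mul_smul]; rfl

end RingedSpaceOver

variable {S : RingedSpaceOver K}

/-- `M` is locally free of constant rank `r`: locally there are `r` sections which restrict to a
basis of `M(V)` over `O(V)` for all smaller open sets `V`. -/
def IsLocallyFreeOfRank (M : S.Modules) (r : ℕ) : Prop :=
  ∀ x : S.X, ∃ (U : Opens S.X) (_ : x ∈ U) (b : Fin r → (ModPresheaf.ofSheaf M).obj U),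
    ∀ (V : Opens S.X) (h : V ≤ U), Function.Bijective
      (fun c : Fin r → Sec S.O V => ∑ i, c i • (ModPresheaf.ofSheaf M).res h (b i))

variable (S) in
/-- A Lie algebroid over the ringed space `S`: a sheaf of `O`-modules, such that the sections over
each open set form a Lie--Rinehart algebra, and the restriction maps are morphisms of
Lie--Rinehart algebras. -/
structure LieAlgebroid where
  sheaf : S.Modules
  bracket : ∀ U : Opens S.X, (ModPresheaf.ofSheaf sheaf).obj U →ₗ[K]
    (ModPresheaf.ofSheaf sheaf).obj U →ₗ[K] (ModPresheaf.ofSheaf sheaf).obj U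
  anchor : ∀ U : Opens S.X, (ModPresheaf.ofSheaf sheaf).obj U →ₗ[Sec S.O U]
    Derivation K (Sec S.O U) (Sec S.O U)
  bracket_self : ∀ {U : Opens S.X} (x : (ModPresheaf.ofSheaf sheaf).obj U), bracket U x x = 0
  jacobi : ∀ {U : Opens S.X} (x y z : (ModPresheaf.ofSheaf sheaf).obj U),
    bracket U x (bracket U y z) = bracket U (bracket U x y) z + bracket U y (bracket U x z)
  anchor_bracket : ∀ {U : Opens S.X} (x y : (ModPresheaf.ofSheaf sheaf).obj U),
    anchor U (bracket U x y) = ⁅anchor U x, anchor U y⁆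
  leibniz : ∀ {U : Opens S.X} (x y : (ModPresheaf.ofSheaf sheaf).obj U) (r : Sec S.O U),
    bracket U x (r • y) = r • bracket U x y + anchor U x r • y
  res_bracket : ∀ {U V : Opens S.X} (h : V ≤ U) (x y : (ModPresheaf.ofSheaf sheaf).obj U),
    (ModPresheaf.ofSheaf sheaf).res h (bracket U x y) =
      bracket V ((ModPresheaf.ofSheaf sheaf).res h x) ((ModPresheaf.ofSheaf sheaf).res h y)
  res_anchor : ∀ {U V : Opens S.X} (h : V ≤ U) (x : (ModPresheaf.ofSheaf sheaf).obj U)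
    (r : Sec S.O U),
    res S.O h (anchor U x r) = anchor V ((ModPresheaf.ofSheaf sheaf).res h x) (res S.O h r)

namespace LieAlgebroid

variable (L : LieAlgebroid S)

/-- The underlying presheaf of modules in elementary form. -/
abbrev mod : ModPresheaf S.O := ModPresheaf.ofSheaf L.sheaf

/-- The Lie--Rinehart algebra of sections of `L` over `U`. -/
def Sec (U : Opens S.X) : Type u := L.mod.obj U

instance (U : Opens S.X) : AddCommGroup (L.Sec U) :=
  inferInstanceAs (AddCommGroup (L.mod.obj U))

instance (U : Opens S.X) : LieRing (L.Sec U) where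
  bracket x y := L.bracket U x y
  add_lie x y z := LinearMap.map_add₂ (L.bracket U) x y z
  lie_add x y z := map_add (L.bracket U x) y z
  lie_self x := L.bracket_self x
  leibniz_lie x y z := L.jacobi x y z

instance (U : Opens S.X) : Module (LieAlgd.Sec S.O U) (L.Sec U) :=
  inferInstanceAs (Module (LieAlgd.Sec S.O U) (L.mod.obj U))

instance (U : Opens S.X) : LieAlgebra K (L.Sec U) where
  toModule := inferInstanceAs (Module K (L.mod.obj U))
  lie_smul k x y := (L.bracket U x).map_smul k y

instance (U : Opens S.X) : LieRingModule (L.Sec U) (LieAlgd.Sec S.O U) where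
  bracket x r := L.anchor U x r
  add_lie x y r := congrArg (fun d => d r) ((L.anchor U).map_add x y)
  lie_add x r s := map_add (L.anchor U x) r s
  leibniz_lie x y r := by
    have := congrArg (fun d => d r) (L.anchor_bracket x y)
    simp only [Derivation.commutator_apply] at this
    exact (sub_eq_iff_eq_add.1 this.symm)

instance (U : Opens S.X) : LieRinehartRing (LieAlgd.Sec S.O U) (L.Sec U) where
  lie_smul_eq_mul' r s x := congrArg (fun d => d s) ((L.anchor U).map_smul r x)
  leibniz_mul_right' x r s := by
    refine ((L.anchor U x).leibniz r s).trans ?_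
    exact congrArg (fun z => r • L.anchor U x s + z) (mul_comm _ _)
  leibniz_smul_right' x y r := L.leibniz x y r

instance (U : Opens S.X) : IsScalarTower K (LieAlgd.Sec S.O U) (L.Sec U) :=
  inferInstanceAs (IsScalarTower K (LieAlgd.Sec S.O U) (L.mod.obj U))

instance (U : Opens S.X) : LieRinehartAlgebra K (LieAlgd.Sec S.O U) (L.Sec U) where
  smul_lie k x r := by
    have := congrArg (fun d => d r) ((L.anchor U).map_smul (algebraMap K _ k) x)
    refine this.trans ?_
    exact (Algebra.smul_def k _).symm
  lie_smul k x r := (L.anchor U x).map_smul k r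

/-- Restriction of sections of a Lie algebroid, as a morphism of Lie--Rinehart algebras. -/
def resHom {U V : Opens S.X} (h : V ≤ U) :
    LieRinehartAlgebra.Hom (S.resAlg h) (L.Sec U) (L.Sec V) where
  toFun := L.mod.res h
  map_add' := map_add _
  map_smul' k x := by
    refine ((L.mod.res h).map_smulₛₗ (algebraMap K _ k) x).trans ?_
    exact congrArg (fun r => r • L.mod.res h x) ((S.resAlg h).commutes k)
  map_lie' {x y} := L.res_bracket h x y
  map_smul_apply' r x := (L.mod.res h).map_smulₛₗ r x
  apply_lie' r x := L.res_anchor h x r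

/-- Restriction of sections of a Lie algebroid. -/
def res {U V : Opens S.X} (h : V ≤ U) (x : L.Sec U) : L.Sec V := L.resHom h x

/-- The presheaf of universal enveloping algebras `U ↦ 𝓤(L(U), O(U))`, as a presheaf of
cocommutative coalgebras. -/
def univ : CoalgPresheaf S.O where
  obj U := UEnv K (LieAlgd.Sec S.O U) (L.Sec U)
  res h :=
    { toFun := UEnv.map (L.resHom h)
      map_add' := map_add _
      map_smul' := UEnv.map_smul' (L.resHom h) }
  res_self h D := UEnv.map_eq_self (L.resHom h) (LieAlgd.res_self S.O h) (L.mod.res_self h) D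
  res_res h h' D := UEnv.map_map (L.resHom h) (L.resHom h') (L.resHom (h'.trans h))
    (LieAlgd.res_res S.O h h') (L.mod.res_res h h') D
  counit_res h D := UEnv.counit_map (L.resHom h) D
  comul_res h D := UEnv.comul_map (L.resHom h) D

/-- The sheaf of jets `𝓙(L) = 𝓗om_O(𝓤(L), O)`, with the product dual to the coproduct of `𝓤(L)`.
(As `O` is a sheaf, it does not matter here that `U ↦ 𝓤(L(U), O(U))` is only a presheaf.) -/
def jets : S.X.Sheaf CommRingCat.{u} := L.univ.dual

/-- The value of a jet on an element of the universal enveloping algebra. -/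
def jetApp {U V : Opens S.X} (φ : LieAlgd.Sec L.jets U) (h : V ≤ U) :
    UEnv K (LieAlgd.Sec S.O V) (L.Sec V) →ₗ[LieAlgd.Sec S.O V] LieAlgd.Sec S.O V :=
  CoalgPresheaf.DualSec.app (C := L.univ) φ h

lemma jet_ext {U : Opens S.X} {φ ψ : LieAlgd.Sec L.jets U}
    (H : ∀ (V : Opens S.X) (h : V ≤ U) D, L.jetApp φ h D = L.jetApp ψ h D) : φ = ψ :=
  CoalgPresheaf.DualSec.ext (C := L.univ) H

lemma jetApp_mul {U V : Opens S.X} (φ ψ : LieAlgd.Sec L.jets U) (h : V ≤ U)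
    (D : UEnv K (LieAlgd.Sec S.O V) (L.Sec V)) :
    L.jetApp (φ * ψ) h D = LinearMap.mul' (LieAlgd.Sec S.O V) (LieAlgd.Sec S.O V)
      (TensorProduct.map (L.jetApp φ h) (L.jetApp ψ h) (UEnv.comul D)) := rfl

/-- Precomposition of a jet with right multiplications in the universal enveloping algebra. -/
def jetRmul {U : Opens S.X} (E : ∀ V : Opens S.X, V ≤ U → UEnv K (LieAlgd.Sec S.O V) (L.Sec V))
    (hE : ∀ {V W : Opens S.X} (h : V ≤ U) (h' : W ≤ V),
      UEnv.map (L.resHom h') (E V h) = E W (h'.trans h)) :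
    LieAlgd.Sec L.jets U →+ LieAlgd.Sec L.jets U where
  toFun φ := (⟨fun V => WithConv.toConv (L.jetApp φ V.2 ∘ₗ UEnv.rmul (E V.1 V.2)),
    fun V W h (D : UEnv K (LieAlgd.Sec S.O V.1) (L.Sec V.1)) => by
      change L.jetApp φ W.2 (UEnv.map (L.resHom h) D * E W.1 W.2) =
        LieAlgd.res S.O h (L.jetApp φ V.2 (D * E V.1 V.2))
      rw [← hE V.2 h, ← map_mul]
      exact CoalgPresheaf.DualSec.app_res (C := L.univ) φ V.2 h _⟩ :
      CoalgPresheaf.DualSec L.univ U)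
  map_zero' := rfl
  map_add' _ _ := rfl

/-- The first `O`-algebra structure of the sheaf of jets: `α₁(r)(D) = r ε(D)`. -/
def α₁ : S.O ⟶ L.jets := L.univ.unitHom

/-- The jet `α₂(r)(D) = ε(D r)`. -/
def α₂Fun (U : Opens S.X) (r : LieAlgd.Sec S.O U) : LieAlgd.Sec L.jets U :=
  L.jetRmul (fun V h => UEnv.iR K (LieAlgd.Sec S.O V) (L.Sec V) (LieAlgd.res S.O h r))
    (fun h h' => (UEnv.map_iR _ _).trans
      (congrArg _ (LieAlgd.res_res S.O h h' r))) 1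

lemma jetApp_α₂Fun {U V : Opens S.X} (r : LieAlgd.Sec S.O U) (h : V ≤ U)
    (D : UEnv K (LieAlgd.Sec S.O V) (L.Sec V)) : L.jetApp (L.α₂Fun U r) h D =
      UEnv.counit (D * UEnv.iR K _ (L.Sec V) (LieAlgd.res S.O h r)) := rfl

lemma jetApp_α₂Fun_mul {U V : Opens S.X} (r : LieAlgd.Sec S.O U) (φ : LieAlgd.Sec L.jets U)
    (h : V ≤ U) (D : UEnv K (LieAlgd.Sec S.O V) (L.Sec V)) :
    L.jetApp (L.α₂Fun U r * φ) h D =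
      L.jetApp φ h (D * UEnv.iR K _ (L.Sec V) (LieAlgd.res S.O h r)) := by
  rw [jetApp_mul, ← UEnv.lid_comul]
  generalize UEnv.comul D = t
  induction t with
  | zero => simp
  | add a b ha hb => simp only [map_add, ha, hb]
  | tmul a b =>
    simp only [TensorProduct.map_tmul, LinearMap.mul'_apply, TensorProduct.lid_tmul, map_smul,
      smul_eq_mul, LinearMap.id_apply]
    rfl

/-- The second `O`-algebra structure of the sheaf of jets: `α₂(r)(D) = ε(D r) = D(r)`. -/
def α₂ : S.O ⟶ L.jets :=
  mkHom (fun U =>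
    { toFun := L.α₂Fun U
      map_one' := L.jet_ext fun V h D => by
        rw [jetApp_α₂Fun, map_one, map_one, mul_one]
        exact (one_mul (UEnv.counit D)).symm ▸ rfl
      map_mul' := fun r s => L.jet_ext fun V h D => by
        rw [jetApp_α₂Fun_mul, jetApp_α₂Fun, jetApp_α₂Fun, map_mul (LieAlgd.res S.O h),
          map_mul (UEnv.iR K _ _), mul_assoc]
      map_zero' := L.jet_ext fun V h D => by
        rw [jetApp_α₂Fun, map_zero, map_zero, mul_zero, map_zero]; rfl
      map_add' := fun r s => L.jet_ext fun V h D => by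
        rw [jetApp_α₂Fun, map_add, map_add, mul_add, map_add]; rfl })
    (fun {U V} h r => L.jet_ext fun W h' D => by
      change L.jetApp (L.α₂Fun V (LieAlgd.res S.O h r)) h' D = L.jetApp (L.α₂Fun U r) (h'.trans h) D
      rw [jetApp_α₂Fun, jetApp_α₂Fun, LieAlgd.res_res])

/-- The flat connection `∇⁽²⁾` on jets: `(∇⁽²⁾_x φ)(D) = φ(D x)`. -/
def nabla₂ {U : Opens S.X} (x : L.Sec U) : LieAlgd.Sec L.jets U →+ LieAlgd.Sec L.jets U :=
  L.jetRmul (fun V h => UEnv.iL K (LieAlgd.Sec S.O V) (L.Sec V) (L.res h x))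
    (fun h h' => (UEnv.map_iL _ _).trans (congrArg _ (L.mod.res_res h h' x)))

lemma nabla₂_leibniz {U : Opens S.X} (x : L.Sec U) (r : LieAlgd.Sec S.O U)
    (φ : LieAlgd.Sec L.jets U) :
    L.nabla₂ x (L.α₂Fun U r * φ) = L.α₂Fun U r * L.nabla₂ x φ + L.α₂Fun U ⁅x, r⁆ * φ :=
  L.jet_ext fun V h D => by
    have h1 : ∀ (φ : LieAlgd.Sec L.jets U) D, L.jetApp (L.nabla₂ x φ) h D =
      L.jetApp φ h (D * UEnv.iL K _ (L.Sec V) (L.res h x)) := fun _ _ => rfl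
    have h2 : ∀ (φ ψ : LieAlgd.Sec L.jets U), L.jetApp (φ + ψ) h D =
      L.jetApp φ h D + L.jetApp ψ h D := fun _ _ => rfl
    have h3 : LieAlgd.res S.O h ⁅x, r⁆ = ⁅L.res h x, LieAlgd.res S.O h r⁆ := L.res_anchor h x r
    rw [h2, h1, jetApp_α₂Fun_mul, jetApp_α₂Fun_mul, jetApp_α₂Fun_mul, h1, h3, mul_assoc,
      UEnv.iL_mul_iR, mul_add, map_add, mul_assoc]

/-- The degree-completed symmetric algebra `Sym^(L^∨)` of the dual of `L`, that is, the algebra of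
jets of `L` with zero bracket and zero anchor: the sheaf of rings `𝓗om_O(Sym_O L, O)`, with the
product dual to the coproduct of `Sym_O L`. -/
def symHat : S.X.Sheaf CommRingCat.{u} := (symCoalg L.mod).dual

/-- The value of a section of `Sym^(L^∨)` on an element of `Sym L`. -/
def symHatApp {U V : Opens S.X} (φ : LieAlgd.Sec L.symHat U) (h : V ≤ U) :
    SymmetricAlgebra (LieAlgd.Sec S.O V) (L.mod.obj V) →ₗ[LieAlgd.Sec S.O V] LieAlgd.Sec S.O V :=
  CoalgPresheaf.DualSec.app (C := symCoalg L.mod) φ h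

/-- The `O`-algebra structure of `Sym^(L^∨)`. -/
def symHatUnit : S.O ⟶ L.symHat := (symCoalg L.mod).unitHom

end LieAlgebroid

section SymOp

variable {X M : Type*} [AddCommGroup M]

/-- The symmetrized covariant derivative of a form `α` on `X` with values in `M`:
`(Dα)(x₀, …, xₙ) = ∑ᵢ (∇_{xᵢ} α)(x₀, …, x̂ᵢ, …, xₙ)`, where
`(∇_x α)(y₁, …, yₙ) = ∇_x (α(y₁, …, yₙ)) - ∑ₖ α(y₁, …, ∇_x yₖ, …, yₙ)`. -/
def symD (nabX : X → X → X) (nabM : X → M → M) {n : ℕ} (α : (Fin n → X) → M) :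
    (Fin (n + 1) → X) → M := fun x =>
  ∑ i, (nabM (x i) (α (i.removeNth x)) -
    ∑ k, α (Function.update (i.removeNth x) k (nabX (x i) (i.removeNth x k))))

/-- The `n`-fold symmetrized covariant derivative of an element of `M`. -/
def symDpow (nabX : X → X → X) (nabM : X → M → M) : ∀ n : ℕ, M → (Fin n → X) → M
  | 0, m => fun _ => m
  | n + 1, m => symD nabX nabM (symDpow nabX nabM n m)

end SymOp

/-- An `L`-connection on a sheaf of `O`-modules: on sections, `∇_x m` is `O`-linear in `x`,
`K`-linear in `m`, and satisfies the Leibniz rule `∇_x (r m) = r ∇_x m + ρ(x)(r) m`. -/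
structure Connection (L : LieAlgebroid S) (M : ModPresheaf S.O) where
  nab : ∀ U : Opens S.X, L.Sec U →ₗ[Sec S.O U] Module.End K (M.obj U)
  leibniz : ∀ {U : Opens S.X} (x : L.Sec U) (r : Sec S.O U) (m : M.obj U),
    nab U x (r • m) = r • nab U x m + ⁅x, r⁆ • m
  res_nab : ∀ {U V : Opens S.X} (h : V ≤ U) (x : L.Sec U) (m : M.obj U),
    M.res h (nab U x m) = nab V (L.res h x) (M.res h m)

namespace LieAlgebroid

variable (L : LieAlgebroid S)

/-- The operator `∇_x y` on the sections of `L`, for a connection on `L`. -/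
def nabL (dL : Connection L L.mod) (U : Opens S.X) (x y : L.Sec U) : L.Sec U := dL.nab U x y

variable (E : S.Modules)

/-- The presheaf `U ↦ 𝓙(L)(U) ⊗ E(U)`, the tensor product being taken over `O(U)` through `α₂`. -/
def preJetsE : ModPresheaf L.jets := (ModPresheaf.ofSheaf E).baseChange L.α₂

/-- The sheaf of `𝓙(L)`-modules `𝓙(L; E) = 𝓙(L) ⊗ E` of jets of `E`, the tensor product being
taken over `O` through `α₂`. -/
def jetsE : ModPresheaf L.jets := (L.preJetsE E).sheafify

/-- The connection `∇⁽²⁾ ⊗ 1 + 1 ⊗ ∇` on jets of `E`, for a connection `∇` on `E`. -/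
def nablaJetsE (dE : Connection L (ModPresheaf.ofSheaf E)) {U : Opens S.X} (x : L.Sec U) :
    (L.preJetsE E).obj U →+ (L.preJetsE E).obj U :=
  tensorDer (M := AlgVia L.α₂ U) (N := (ModPresheaf.ofSheaf E).obj U)
    (fun r => ⁅x, r⁆) (L.nabla₂ x) (dE.nab U x).toAddMonoidHom
    (fun r φ => L.nabla₂_leibniz x r φ) (fun r e => dE.leibniz x r e)

/-- The evaluation `ev₁(φ ⊗ e) = φ(1) e`. -/
def ev₁ (U : Opens S.X) : (L.preJetsE E).obj U →+ (ModPresheaf.ofSheaf E).obj U :=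
  TensorProduct.liftAddHom (R := LieAlgd.Sec S.O U) (M := AlgVia L.α₂ U)
    (N := (ModPresheaf.ofSheaf E).obj U)
    { toFun := fun φ =>
        (LinearMap.lsmul (LieAlgd.Sec S.O U) ((ModPresheaf.ofSheaf E).obj U)
          (L.jetApp φ le_rfl 1)).toAddMonoidHom
      map_zero' := by
        ext e
        exact zero_smul _ _
      map_add' := fun φ ψ => by
        ext e
        exact add_smul (L.jetApp φ le_rfl 1) (L.jetApp ψ le_rfl 1) e }
    (fun r (φ : LieAlgd.Sec L.jets U) e => by
      have h : L.jetApp (L.α₂Fun U r * φ) le_rfl 1 = r * L.jetApp φ le_rfl 1 := by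
        rw [jetApp_α₂Fun_mul, one_mul, LieAlgd.res_self, ← smul_eq_mul, ← map_smul,
          UEnv.smul_def, mul_one]
      change L.jetApp (L.α₂Fun U r * φ) le_rfl 1 • e = L.jetApp φ le_rfl 1 • r • e
      rw [h, smul_smul, mul_comm])

/-- The presheaf `U ↦ Sym^(L^∨)(U) ⊗ E(U)`. -/
def preSymHatE : ModPresheaf L.symHat := (ModPresheaf.ofSheaf E).baseChange L.symHatUnit

/-- The sheaf of `Sym^(L^∨)`-modules `Sym^(L^∨) ⊗ E`. -/
def symHatE : ModPresheaf L.symHat := (L.preSymHatE E).sheafify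

/-- The pairing `(β ⊗ e)(a) = β(a) e`, for `a` in `Sym L`. -/
def preSymHatEApp (U : Opens S.X) : (L.preSymHatE E).obj U →+
    ModPresheaf.HomSec (symCoalg L.mod).toModPresheaf (ModPresheaf.ofSheaf E) U :=
  TensorProduct.liftAddHom (R := LieAlgd.Sec S.O U) (M := AlgVia L.symHatUnit U)
    (N := (ModPresheaf.ofSheaf E).obj U)
    { toFun := fun β =>
        { toFun := fun e =>
            ⟨fun V => (L.symHatApp β V.2).smulRight ((ModPresheaf.ofSheaf E).res V.2 e),
              fun V W h a => by
                change L.symHatApp β W.2 ((symCoalg L.mod).res h a) •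
                  (ModPresheaf.ofSheaf E).res W.2 e = (ModPresheaf.ofSheaf E).res h
                    (L.symHatApp β V.2 a • (ModPresheaf.ofSheaf E).res V.2 e)
                rw [LinearMap.map_smulₛₗ, ModPresheaf.res_res]
                exact congrArg (· • (ModPresheaf.ofSheaf E).res W.2 e)
                  (CoalgPresheaf.DualSec.app_res (C := symCoalg L.mod) β V.2 h a)⟩
          map_zero' := ModPresheaf.HomSec.ext fun V h a => by
            change L.symHatApp β h a • (ModPresheaf.ofSheaf E).res h 0 = 0
            rw [map_zero, smul_zero]
          map_add' := fun e f => ModPresheaf.HomSec.ext fun V h a => by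
            change L.symHatApp β h a • (ModPresheaf.ofSheaf E).res h (e + f) =
              L.symHatApp β h a • (ModPresheaf.ofSheaf E).res h e +
                L.symHatApp β h a • (ModPresheaf.ofSheaf E).res h f
            rw [map_add, smul_add] }
      map_zero' := by
        ext e
        exact ModPresheaf.HomSec.ext fun V h a => zero_smul _ _
      map_add' := fun β γ => by
        ext e
        exact ModPresheaf.HomSec.ext fun V h a =>
          add_smul (L.symHatApp β h a) (L.symHatApp γ h a) ((ModPresheaf.ofSheaf E).res h e) }
    (fun r (β : LieAlgd.Sec L.symHat U) e => ModPresheaf.HomSec.ext fun V h a => by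
      have h0 : L.symHatApp (homApp L.symHatUnit U r * β) h a =
          LieAlgd.res S.O h r * L.symHatApp β h a :=
        CoalgPresheaf.app_unitHom_mul (C := symCoalg L.mod) r β h a
      change L.symHatApp (homApp L.symHatUnit U r * β) h a • (ModPresheaf.ofSheaf E).res h e =
        L.symHatApp β h a • (ModPresheaf.ofSheaf E).res h (r • e)
      rw [h0, LinearMap.map_smulₛₗ, smul_smul, mul_comm])

lemma preSymHatEApp_res {U V : Opens S.X} (h : V ≤ U) (t : (L.preSymHatE E).obj U) :
    L.preSymHatEApp E V ((L.preSymHatE E).res h t) =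
      (ModPresheaf.ihom (symCoalg L.mod).toModPresheaf (ModPresheaf.ofSheaf E)).res h
        (L.preSymHatEApp E U t) := by
  let F : AlgVia L.symHatUnit U ⊗[LieAlgd.Sec S.O U] (ModPresheaf.ofSheaf E).obj U →+
      ModPresheaf.HomSec (symCoalg L.mod).toModPresheaf (ModPresheaf.ofSheaf E) V :=
    (L.preSymHatEApp E V).comp ((L.preSymHatE E).res h).toAddMonoidHom
  let G : AlgVia L.symHatUnit U ⊗[LieAlgd.Sec S.O U] (ModPresheaf.ofSheaf E).obj U →+
      ModPresheaf.HomSec (symCoalg L.mod).toModPresheaf (ModPresheaf.ofSheaf E) V :=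
    ((ModPresheaf.ihom (symCoalg L.mod).toModPresheaf
      (ModPresheaf.ofSheaf E)).res h).toAddMonoidHom.comp (L.preSymHatEApp E U)
  have hFG : F = G := by
    ext t
    induction t with
    | zero => rw [map_zero, map_zero]
    | add a b ha hb => rw [map_add, map_add, ha, hb]
    | tmul β e =>
      refine ModPresheaf.HomSec.ext fun V h' a => ?_
      exact congrArg (L.symHatApp β (h'.trans h) a • ·) ((ModPresheaf.ofSheaf E).res_res h h' e)
  exact DFunLike.congr_fun hFG t

/-- The sections of `Sym^(L^∨) ⊗ E` as maps `Sym L → E`: the extension of the pairing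
`(β ⊗ e)(a) = β(a) e` to the sheaf associated to `U ↦ Sym^(L^∨)(U) ⊗ E(U)`. -/
def symHatEApp (U : Opens S.X) : (L.symHatE E).obj U →+
    ModPresheaf.HomSec (symCoalg L.mod).toModPresheaf (ModPresheaf.ofSheaf E) U :=
  (L.preSymHatE E).sheafifyLift
    (ModPresheaf.ihom (symCoalg L.mod).toModPresheaf (ModPresheaf.ofSheaf E))
    (ModPresheaf.isSheaf_ihom (ModPresheaf.isSheaf_ofSheaf E)) (L.preSymHatEApp E)
    (L.preSymHatEApp_res E) U

/-- The jet `φ` vanishes to order `k`, i.e. its image in the jets of order `k` is zero: it vanishes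
on the differential operators of order at most `k`. -/
def JetVanishes (k : ℕ) {U : Opens S.X} (φ : LieAlgd.Sec L.jets U) : Prop :=
  ∀ (V : Opens S.X) (h : V ≤ U), ∀ D ∈ UEnv.filtration K (LieAlgd.Sec S.O V) (L.Sec V) k,
    L.jetApp φ h D = 0

lemma JetVanishes.mono {L : LieAlgebroid S} {k l : ℕ} (hkl : k ≤ l) {U : Opens S.X}
    {φ : LieAlgd.Sec L.jets U} (hφ : L.JetVanishes l φ) : L.JetVanishes k φ := by
  intro V h D hD
  refine hφ V h D (Submodule.span_mono ?_ hD)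
  rintro _ ⟨w, hw, rfl⟩
  exact ⟨w, hw.trans hkl, rfl⟩

/-- The sections over `U` of `𝓤(L; E) = 𝓗om^cont(𝓙(L; E), E)`: the morphisms of `O`-modules
`𝓙(L; E) → E` over `U`, with `O` acting on `𝓙(L; E)` through `α₁`, which are continuous, i.e.
factor locally through the jets of some finite order `k`. -/
def contSub (U : Opens S.X) : Submodule (LieAlgd.Sec S.O U)
    (ModPresheaf.HomSec ((L.jetsE E).restrictScalars L.α₁) (ModPresheaf.ofSheaf E) U) where
  carrier := {f | ∀ x ∈ U, ∃ (V : Opens S.X) (h : V ≤ U), x ∈ V ∧ ∃ k : ℕ,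
    ∀ (W : Opens S.X) (h' : W ≤ V) (φ : LieAlgd.Sec L.jets W) (s : (L.jetsE E).obj W),
      L.JetVanishes k φ →
        f.app (h'.trans h) (ModPresheaf.ofScalars L.α₁ (L.jetsE E) W (φ • s)) = 0}
  zero_mem' := fun x hx => ⟨U, le_rfl, hx, 0, fun W h' φ s _ => rfl⟩
  add_mem' := by
    intro f g hf hg x hx
    obtain ⟨V, h, hxV, k, H⟩ := hf x hx
    obtain ⟨V', h', hxV', k', H'⟩ := hg x hx
    refine ⟨V ⊓ V', inf_le_left.trans h, ⟨hxV, hxV'⟩, max k k', fun W hW φ s hφ => ?_⟩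
    rw [ModPresheaf.HomSec.add_app,
      H W (hW.trans inf_le_left) φ s (JetVanishes.mono (le_max_left k k') hφ),
      H' W (hW.trans inf_le_right) φ s (JetVanishes.mono (le_max_right k k') hφ), add_zero]
  smul_mem' := by
    intro r f hf x hx
    obtain ⟨V, h, hxV, k, H⟩ := hf x hx
    refine ⟨V, h, hxV, k, fun W h' φ s hφ => ?_⟩
    rw [ModPresheaf.HomSec.smul_app, H W h' φ s hφ, smul_zero]

/-- The twisted universal enveloping algebra `𝓤(L; E) = 𝓗om^cont(𝓙(L; E), E)`, as a sheaf of
`O`-modules. -/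
def univE : ModPresheaf S.O where
  obj U := L.contSub E U
  res {U V} h :=
    { toFun := fun f => ⟨f.1.res h, by
        intro x hx
        obtain ⟨V', h', hxV, k, H⟩ := f.2 x (h hx)
        exact ⟨V' ⊓ V, inf_le_right, ⟨hxV, hx⟩, k,
          fun W hW φ s hφ => H W (hW.trans inf_le_left) φ s hφ⟩⟩
      map_add' := fun f g => rfl
      map_smul' := fun r f => Subtype.ext
        ((ModPresheaf.ihom ((L.jetsE E).restrictScalars L.α₁)
          (ModPresheaf.ofSheaf E)).res h |>.map_smulₛₗ r f.1) }
  res_self h f := rfl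
  res_res h h' f := rfl

/-- The presheaf `U ↦ Sym(L(U)) ⊗ End(E)(U)`. -/
def preSymEnd : ModPresheaf S.O :=
  (symCoalg L.mod).toModPresheaf.tensor
    (ModPresheaf.ihom (ModPresheaf.ofSheaf E) (ModPresheaf.ofSheaf E))

/-- The sheaf of `O`-modules `Sym(L) ⊗ End(E)`. -/
def symEnd : ModPresheaf S.O := (L.preSymEnd E).sheafify

end LieAlgebroid

end LieAlgd

end

set_option linter.unusedSimpArgs false
set_option linter.unusedSectionVars false

/-! The core is a Poincaré–Birkhoff–Witt theorem attached to the connection on `L`. A pair of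
connections, on `L` and on a module `M`, has a symmetrized exponential `exp : Sym L → End M`,
determined by exp(1) = id and exp(yⁿ⁺¹) = ∇_y exp(yⁿ) - exp(∇_y yⁿ), because in characteristic 0 the
powers span `Sym L`. Polarizing this recursion gives n! exp(x₁⋯xₙ) = Dⁿ evaluated at (x₁, …, xₙ)
(`symDpow_eq`). Left multiplication on 𝓤(L), applied to the element 1, yields `pbw : Sym L → 𝓤(L)`.
Naturality of `exp` under morphisms of connections and its compatibility with tensor products
(`exp_tensor`) show that `pbw` is a morphism of coalgebras and that exp(a)φ = φ(- pbw(a)) for a jet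
φ. Hence j_L is the dual of `pbw`.

The inverse of `pbw` comes from a flat connection on `Sym L` with y ⋆ yⁿ = yⁿ⁺¹ + ∇_y yⁿ. It is
built degree by degree: a correction taken from the curvature Ω kills the terms Ω(y,x)yⁿ, and the
Bianchi identity with polarization kills all others (`curv_flatApprox`). So `Sym L` becomes a
𝓤(L)-module. The map `symb`, D ↦ D ⋆ 1, is a left inverse of `pbw` since both obey the same
recursion, and a right inverse since `pbw` is 𝓤(L)-linear (`pbw_flat`).

For `E`, both 𝓙(L;E) and Sym^(L^∨) ⊗ E are identified with Hom(Sym L, E), a module over Sym^(L^∨) by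
convolution. There j(φ ⊗ e) = j_L(φ) exp(-)e (`ev₁_exp_tmul`). Given a frame e_p of `E`, the maps a
↦ ε(a)e_p form a basis of this module. The maps a ↦ exp(a)e_p are obtained from it by a matrix whose
value at 1 is the identity; its determinant is a unit by the geometric series, so they form a basis
too (`preJ_bijective`), and the local bijections pass to the associated sheaves.

For j*, `pbw` and `symb` respect filtrations, so jets vanishing to order k correspond to functionals
vanishing in degrees at most k. Therefore the pairing takes values in continuous maps. Over frames
of `L` and `E`, a map that kills such jets is determined by its coefficients along the finitely many
dual monomials of degree at most k, which also provide the preimage (`preS_injective`,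
`preS_surjective_of_frame`). -/

noncomputable section

namespace LieAlgd

/-! ### Symmetric algebras over a ℚ-algebra: contraction, grading, polarization. -/

namespace Sym

variable {R M V : Type*} [CommRing R] [AddCommGroup M] [Module R M] [AddCommGroup V] [Module R V]

local notation "𝒮" => SymmetricAlgebra R M

variable (R) in
/-- The canonical inclusion of a module into its symmetric algebra. -/
abbrev ι : M →ₗ[R] SymmetricAlgebra R M := SymmetricAlgebra.ι R M

/-- The algebra map underlying the universal derivation of the symmetric algebra. -/
def derivHom : 𝒮 →ₐ[R] TrivSqZeroExt 𝒮 (𝒮 ⊗[R] M) :=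
  SymmetricAlgebra.lift
    ((TrivSqZeroExt.inlAlgHom R 𝒮 (𝒮 ⊗[R] M)).toLinearMap ∘ₗ ι R +
      (TrivSqZeroExt.inrHom 𝒮 (𝒮 ⊗[R] M)).restrictScalars R ∘ₗ TensorProduct.mk R 𝒮 M 1)

lemma derivHom_ι (x : M) : derivHom (ι R x) =
    TrivSqZeroExt.inl (ι R x) + TrivSqZeroExt.inr ((1 : 𝒮) ⊗ₜ[R] x) := by
  simp [derivHom]

lemma fst_derivHom (a : 𝒮) : (derivHom a).fst = a := by
  have : (TrivSqZeroExt.fstHom R 𝒮 (𝒮 ⊗[R] M)).comp derivHom = AlgHom.id R 𝒮 := by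
    ext x
    simp [derivHom_ι]
  exact DFunLike.congr_fun this a

/-- The universal derivation of the symmetric algebra. -/
def deriv : 𝒮 →ₗ[R] 𝒮 ⊗[R] M :=
  (TrivSqZeroExt.sndHom 𝒮 (𝒮 ⊗[R] M)).restrictScalars R ∘ₗ derivHom.toLinearMap

lemma deriv_mul (a b : 𝒮) : deriv (a * b) = a • deriv b + b • deriv a := by
  change (derivHom (a * b)).snd = a • (derivHom b).snd + b • (derivHom a).snd
  rw [map_mul, TrivSqZeroExt.snd_mul, fst_derivHom, fst_derivHom, op_smul_eq_smul]

lemma deriv_ι (x : M) : deriv (ι R x) = 1 ⊗ₜ[R] x := by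
  change (derivHom (ι R x)).snd = _
  simp [derivHom_ι]

lemma deriv_one : deriv (1 : 𝒮) = 0 := by
  change (derivHom (1 : 𝒮)).snd = _
  simp

/-- The contraction `a ↦ ∑ᵢ G(xᵢ, a / xᵢ)` of a bilinear map. -/
def contr (G : M →ₗ[R] 𝒮 →ₗ[R] V) : 𝒮 →ₗ[R] V := TensorProduct.lift G.flip ∘ₗ deriv

lemma contr_one (G : M →ₗ[R] 𝒮 →ₗ[R] V) : contr G 1 = 0 := by simp [contr, deriv_one]

/-- The Leibniz rule of `deriv`: either x is the contracted factor, or it stays and is absorbed into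
the second slot of `G`. This is the inductive step for evaluating `contr` on products. -/
lemma contr_ι_mul (G : M →ₗ[R] 𝒮 →ₗ[R] V) (x : M) (a : 𝒮) : contr G (ι R x * a) =
    G x a + contr ((LinearMap.mulLeft R (ι R x)).lcomp R V ∘ₗ G) a := by
  simp only [contr, LinearMap.comp_apply, deriv_mul, deriv_ι, map_add, TensorProduct.smul_tmul']
  rw [add_comm]
  congr 1
  · simp
  · generalize (deriv a : 𝒮 ⊗[R] M) = t
    induction t with
    | zero => simp
    | add a b ha hb => simp only [smul_add, map_add, ha, hb]
    | tmul a b => simp [TensorProduct.smul_tmul']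

lemma contr_prod {n : ℕ} (G : M →ₗ[R] 𝒮 →ₗ[R] V) (x : Fin (n + 1) → M) :
    contr G (∏ i, ι R (x i)) = ∑ i, G (x i) (∏ j, ι R (i.removeNth x j)) := by
  -- `G` has to vary, since the factor split off is absorbed into it.
  induction n generalizing G with
  | zero =>
    simp only [Fin.prod_univ_succ, Finset.univ_eq_empty, Finset.prod_empty, contr_ι_mul,
      contr_one, Finset.sum_empty, Fin.sum_univ_succ]
  | succ n ih =>
    rw [Fin.prod_univ_succ, contr_ι_mul, Fin.sum_univ_succ, ih]
    congr 1
    refine Finset.sum_congr rfl fun i _ => ?_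
    rw [Fin.prod_univ_succ]
    simp [Fin.removeNth]

lemma contr_pow (G : M →ₗ[R] 𝒮 →ₗ[R] V) (y : M) (n : ℕ) :
    contr G (ι R y ^ (n + 1)) = (n + 1) • G y (ι R y ^ n) := by
  have := contr_prod G (fun _ : Fin (n + 1) => y)
  simpa [Fin.removeNth] using this

lemma contr_ι_mul_pow (G : M →ₗ[R] 𝒮 →ₗ[R] V) (z y : M) (n : ℕ) :
    contr G (ι R z * ι R y ^ (n + 1)) =
      G z (ι R y ^ (n + 1)) + (n + 1) • G y (ι R z * ι R y ^ n) := by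
  rw [contr_ι_mul, contr_pow]
  simp

variable (R M) in
/-- The algebra map that multiplies elements of degree `n` by `Xⁿ`. -/
def gradHom : 𝒮 →ₐ[R] Polynomial 𝒮 :=
  SymmetricAlgebra.lift ((Polynomial.monomial 1).restrictScalars R ∘ₗ ι R)

lemma gradHom_pow (y : M) (n : ℕ) :
    gradHom R M (ι R y ^ n) = Polynomial.monomial n (ι R y ^ n) := by
  rw [map_pow, gradHom, SymmetricAlgebra.lift_ι_apply]
  simp [Polynomial.monomial_pow]

variable (R M) in
/-- The elements of degree `n`, as the span of the powers of elements of degree one. -/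
def homog (n : ℕ) : Submodule R 𝒮 := Submodule.span R (Set.range fun y : M => ι R y ^ n)

lemma pow_mem (y : M) (n : ℕ) : ι R y ^ n ∈ homog R M n := Submodule.subset_span ⟨y, rfl⟩

lemma one_mem : (1 : 𝒮) ∈ homog R M 0 := by simpa using pow_mem (0 : M) 0

/-- With `homog` defined as a span of powers, testing on powers is enough by construction. The
substance lies in `prod_mem`: this span contains all products of n elements, once ℚ acts. -/
lemma eqOn_homog {W F : Type*} [AddCommGroup W] [Module R W] [FunLike F 𝒮 W]
    [LinearMapClass F R 𝒮 W] {n : ℕ} {f g : F}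
    (h : ∀ y, f (ι R y ^ n) = g (ι R y ^ n)) {a : 𝒮} (ha : a ∈ homog R M n) : f a = g a := by
  induction ha using Submodule.span_induction with
  | mem a ha => obtain ⟨y, rfl⟩ := ha; exact h y
  | zero => simp
  | add a b _ _ ha hb => rw [map_add, map_add, ha, hb]
  | smul r a _ ha => rw [map_smul, map_smul, ha]

lemma map_mem_of_pow_mem {W : Type*} [AddCommGroup W] [Module R W] {n : ℕ} (f : 𝒮 →ₗ[R] W)
    (P : Submodule R W) (h : ∀ y, f (ι R y ^ n) ∈ P) {a : 𝒮} (ha : a ∈ homog R M n) : f a ∈ P := by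
  have : homog R M n ≤ P.comap f := Submodule.span_le.2 (by rintro _ ⟨y, rfl⟩; exact h y)
  exact this ha

lemma gradHom_of_mem {n : ℕ} {a : 𝒮} (ha : a ∈ homog R M n) :
    gradHom R M a = Polynomial.monomial n a :=
  eqOn_homog (f := (gradHom R M).toLinearMap) (g := (Polynomial.monomial n).restrictScalars R)
    (fun y => gradHom_pow y n) ha

variable (R M) in
/-- The projection to degree `n`. -/
def proj (n : ℕ) : 𝒮 →ₗ[R] 𝒮 :=
  (Polynomial.lcoeff 𝒮 n).restrictScalars R ∘ₗ (gradHom R M).toLinearMap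

lemma proj_of_mem {n : ℕ} {a : 𝒮} (ha : a ∈ homog R M n) : proj R M n a = a := by
  simp [proj, gradHom_of_mem ha]

lemma proj_of_mem_ne {m n : ℕ} (hmn : m ≠ n) {a : 𝒮} (ha : a ∈ homog R M m) :
    proj R M n a = 0 := by
  simp [proj, gradHom_of_mem ha, Polynomial.coeff_monomial, hmn]

/-- The linear map which is `f n` in degree `n`. -/
def glue (f : ℕ → 𝒮 →ₗ[R] V) : 𝒮 →ₗ[R] V := Polynomial.lsum f ∘ₗ (gradHom R M).toLinearMap

lemma glue_of_mem (f : ℕ → 𝒮 →ₗ[R] V) {n : ℕ} {a : 𝒮} (ha : a ∈ homog R M n) :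
    glue f a = f n a := by
  simp [glue, gradHom_of_mem ha, Polynomial.lsum_apply, Polynomial.sum_monomial_index]

variable (R M) in
/-- The elements of degree at most `n`. -/
def filt (n : ℕ) : Submodule R 𝒮 := ⨆ k : {k : ℕ // k ≤ n}, homog R M k

lemma homog_le_filt {k n : ℕ} (h : k ≤ n) : homog R M k ≤ filt R M n :=
  le_iSup (fun k : {k : ℕ // k ≤ n} => homog R M k) ⟨k, h⟩

lemma filt_mono {m n : ℕ} (h : m ≤ n) : filt R M m ≤ filt R M n :=
  iSup_le fun k => homog_le_filt (k.2.trans h)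

lemma filt_induction {n : ℕ} {P : 𝒮 → Prop} (hom : ∀ k ≤ n, ∀ a ∈ homog R M k, P a)
    (add : ∀ a b, P a → P b → P (a + b)) {a : 𝒮} (ha : a ∈ filt R M n) : P a := by
  induction ha using Submodule.iSup_induction' with
  | mem i b hb => exact hom i i.2 b hb
  | zero => exact hom 0 n.zero_le 0 (Submodule.zero_mem _)
  | add b c _ _ hb hc => exact add b c hb hc

section Rat

variable [Algebra ℚ R]

variable (R) in
/-- The inverse of the natural number `n` in a `ℚ`-algebra. -/
def ninv (n : ℕ) : R := algebraMap ℚ R (n : ℚ)⁻¹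

lemma ninv_smul (n : ℕ) (v : V) : ninv R (n + 1) • (n + 1) • v = v := by
  rw [← Nat.cast_smul_eq_nsmul R, smul_smul, ninv, ← map_natCast (algebraMap ℚ R), ← map_mul,
    inv_mul_cancel₀ (by positivity), map_one, one_smul]

lemma eq_zero_of_nsmul (R : Type*) [CommRing R] [Algebra ℚ R] [Module R V] {n : ℕ} {v : V} (h : (n + 1) • v = 0) : v = 0 := by
  rw [← ninv_smul (R := R) n v, h, smul_zero]

/-- A polynomial in t with values in P at t = 0, …, N - 1 has its coefficients in P, because the
Vandermonde matrix of these nodes is invertible over ℚ. -/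
lemma mem_of_sum_pow_smul_mem {N : ℕ} (c : Fin N → V) (P : Submodule R V)
    (h : ∀ t : ℕ, ∑ k : Fin N, (t : R) ^ (k : ℕ) • c k ∈ P) (j : Fin N) : c j ∈ P := by
  let A : Matrix (Fin N) (Fin N) ℚ := Matrix.vandermonde fun i => ((i : ℕ) : ℚ)
  have hA : IsUnit A.det := isUnit_iff_ne_zero.2 (Matrix.det_vandermonde_ne_zero_iff.2
    fun i j hij => Fin.ext (Nat.cast_injective hij))
  have key : c j = ∑ i : Fin N, algebraMap ℚ R (A⁻¹ j i) • ∑ k : Fin N, ((i : ℕ) : R) ^ (k : ℕ) • c k := by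
    have h1 : ∀ i k, algebraMap ℚ R (A i k) = ((i : ℕ) : R) ^ (k : ℕ) := fun i k => by
      simp [A, Matrix.vandermonde_apply]
    simp only [← h1, Finset.smul_sum, smul_smul, ← map_mul]
    rw [Finset.sum_comm]
    simp only [← Finset.sum_smul, ← map_sum, ← Matrix.mul_apply, Matrix.nonsing_inv_mul A hA,
      Matrix.one_apply]
    simp [Finset.sum_ite_eq, apply_ite (algebraMap ℚ R)]
  rw [key]
  exact P.sum_mem fun i _ => P.smul_mem _ (h i)

/-- The coefficient of t in (t x + y)ⁿ⁺¹ is (n + 1) x yⁿ. Coefficients are extracted by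
`mem_of_sum_pow_smul_mem`, and n + 1 is invertible. -/
lemma ι_mul_pow_mem (x y : M) (n : ℕ) : ι R x * ι R y ^ n ∈ homog R M (n + 1) := by
  have h : ∀ t : ℕ, ∑ k : Fin (n + 2), (t : R) ^ (k : ℕ) •
      (((n + 1).choose k) • (ι R x ^ (k : ℕ) * ι R y ^ (n + 1 - k))) ∈ homog R M (n + 1) := by
    intro t
    have := pow_mem (R := R) ((t : R) • x + y) (n + 1)
    rw [map_add, map_smul, add_pow, ← Fin.sum_univ_eq_sum_range
      (fun k => ((t : R) • ι R x) ^ k * ι R y ^ (n + 1 - k) * ((n + 1).choose k : 𝒮))] at this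
    convert this using 2 with k
    rw [smul_pow, smul_mul_assoc, smul_mul_assoc, nsmul_eq_mul]
    congr 1
    ring
  have h1 := mem_of_sum_pow_smul_mem _ _ h 1
  simp only [Fin.val_one, Nat.choose_one_right, pow_one, Nat.add_sub_cancel] at h1
  rw [← ninv_smul (R := R) n (ι R x * ι R y ^ n)]
  exact Submodule.smul_mem _ _ h1

lemma ι_mul_mem (x : M) {n : ℕ} {a : 𝒮} (ha : a ∈ homog R M n) :
    ι R x * a ∈ homog R M (n + 1) :=
  map_mem_of_pow_mem (LinearMap.mulLeft R (ι R x)) _ (fun y => ι_mul_pow_mem x y n) ha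

lemma prod_mem {n : ℕ} (x : Fin n → M) : ∏ i, ι R (x i) ∈ homog R M n := by
  induction n with
  | zero => simpa using one_mem
  | succ n ih => rw [Fin.prod_univ_succ]; exact ι_mul_mem _ (ih _)

-- The sum of the homogeneous parts contains 1 and is stable under left multiplication by
-- generators, so it is everything.
@[elab_as_elim]
lemma homog_induction {P : 𝒮 → Prop} (hom : ∀ n, ∀ a ∈ homog R M n, P a)
    (add : ∀ a b, P a → P b → P (a + b)) (a : 𝒮) : P a := by
  have key : a ∈ ⨆ n, homog R M n := by
    -- The stronger statement that multiplication by `a` preserves the sum is what passes to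
    -- products.
    have : ∀ b ∈ ⨆ n, homog R M n, a * b ∈ ⨆ n, homog R M n := by
      induction a using SymmetricAlgebra.induction with
      | algebraMap r =>
        intro b hb
        rw [← Algebra.smul_def]
        exact Submodule.smul_mem _ _ hb
      | ι x =>
        intro b hb
        induction hb using Submodule.iSup_induction' with
        | mem i b hb => exact Submodule.mem_iSup_of_mem _ (ι_mul_mem x hb)
        | zero => simp
        | add b c _ _ hb hc => rw [mul_add]; exact Submodule.add_mem _ hb hc
      | mul c d hc hd => intro b hb; rw [mul_assoc]; exact hc _ (hd _ hb)
      | add c d hc hd => intro b hb; rw [add_mul]; exact Submodule.add_mem _ (hc _ hb) (hd _ hb)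
    simpa using this 1 (Submodule.mem_iSup_of_mem 0 one_mem)
  induction key using Submodule.iSup_induction' with
  | mem i b hb => exact hom i b hb
  | zero => exact hom 0 0 (Submodule.zero_mem _)
  | add b c _ _ hb hc => exact add b c hb hc

lemma linearMap_ext {f g : 𝒮 →ₗ[R] V} (h : ∀ n y, f (ι R y ^ n) = g (ι R y ^ n)) : f = g := by
  ext a
  induction a using homog_induction with
  | hom n a ha => exact eqOn_homog (h n) ha
  | add a b ha hb => rw [map_add, map_add, ha, hb]

/-- Polarization of the identity `G(y, yⁿ) = 0`. -/
lemma polarize (G : M →ₗ[R] 𝒮 →ₗ[R] V) (n : ℕ) (h : ∀ y, G y (ι R y ^ (n + 1)) = 0) (z y : M) :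
    G z (ι R y ^ (n + 1)) + (n + 1) • G y (ι R z * ι R y ^ n) = 0 := by
  -- The contraction vanishes on all powers of degree n + 2, hence on z yⁿ⁺¹, where its value is the
  -- left-hand side.
  rw [← contr_ι_mul_pow]
  exact eqOn_homog (f := contr G) (g := 0) (fun y => by rw [contr_pow, h, smul_zero]; rfl)
    (ι_mul_pow_mem z y (n + 1))

lemma ι_mul_mem_filt (x : M) {n : ℕ} {a : 𝒮} (ha : a ∈ filt R M n) :
    ι R x * a ∈ filt R M (n + 1) :=
  filt_induction (P := fun a => ι R x * a ∈ filt R M (n + 1))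
    (fun _ hk _ ha => homog_le_filt (Nat.succ_le_succ hk) (ι_mul_mem x ha))
    (fun a b ha hb => by rw [mul_add]; exact Submodule.add_mem _ ha hb) ha

lemma exists_mem_filt (a : 𝒮) : ∃ n, a ∈ filt R M n := by
  induction a using homog_induction with
  | hom n a ha => exact ⟨n, homog_le_filt le_rfl ha⟩
  | add a b ha hb =>
    obtain ⟨m, hm⟩ := ha
    obtain ⟨n, hn⟩ := hb
    exact ⟨max m n, Submodule.add_mem _ (filt_mono (le_max_left _ _) hm)
      (filt_mono (le_max_right _ _) hn)⟩

end Rat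

end Sym

end LieAlgd

end

/-! ### Connections over a Lie–Rinehart algebra and their symmetrized exponential. -/

noncomputable section

namespace LieAlgd

namespace Sym

variable {R M : Type*} [CommRing R] [AddCommGroup M] [Module R M]

/-- The ring homomorphism from the symmetric algebra to a commutative ring `A` given by a ring
homomorphism `R → A` and a compatible additive map `M → A`. -/
def liftRingHom {A : Type*} [CommRing A] (g : R →+* A) (f : M →+ A)
    (hf : ∀ r m, f (r • m) = g r * f m) : SymmetricAlgebra R M →+* A :=
  letI := g.toAlgebra
  (SymmetricAlgebra.lift (R := R) (M := M) (A := A) { f with map_smul' := hf }).toRingHom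

variable {A : Type*} [CommRing A] (g : R →+* A) (f : M →+ A) (hf : ∀ r m, f (r • m) = g r * f m)

lemma liftRingHom_ι (x : M) : liftRingHom g f hf (ι R x) = f x :=
  letI := g.toAlgebra
  SymmetricAlgebra.lift_ι_apply _ x

lemma liftRingHom_algebraMap (r : R) : liftRingHom g f hf (algebraMap R _ r) = g r :=
  letI := g.toAlgebra
  AlgHom.commutes (SymmetricAlgebra.lift (R := R) (M := M) (A := A) _) r

/-- Adapted to the recursion of `exp`: yⁿ⁺¹ is reached from everything of degree n and not only from
yⁿ, because ∇_y yⁿ also occurs and is not a power. -/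
lemma rec_induction [Algebra ℚ R] {P : SymmetricAlgebra R M → Prop}
    (add : ∀ a b, P a → P b → P (a + b)) (smul : ∀ (r : R) a, P a → P (r • a)) (one : P 1)
    (succ : ∀ n y, (∀ a ∈ homog R M n, P a) → P (ι R y ^ (n + 1))) (a : SymmetricAlgebra R M) :
    P a := by
  have key : ∀ n, ∀ a ∈ homog R M n, P a := by
    intro n
    induction n with
    | zero =>
      intro a ha
      induction ha using Submodule.span_induction with
      | mem a ha => obtain ⟨y, rfl⟩ := ha; simpa using one
      | zero => simpa using smul 0 _ one
      | add a b _ _ ha hb => exact add a b ha hb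
      | smul r a _ ha => exact smul r a ha
    | succ n ih =>
      intro a ha
      induction ha using Submodule.span_induction with
      | mem a ha => obtain ⟨y, rfl⟩ := ha; exact succ n y ih
      | zero => simpa using smul 0 _ one
      | add a b _ _ ha hb => exact add a b ha hb
      | smul r a _ ha => exact smul r a ha
  induction a using homog_induction with
  | hom n a ha => exact key n a ha
  | add a b ha hb => exact add a b ha hb

end Sym

/-- An `L`-connection on an `R`-module `M`, for a Lie--Rinehart algebra `(R, L)`. -/
structure LRConn (R L M : Type*) [CommRing R] [LieRing L] [Module R L] [LieRingModule L R]
    [AddCommGroup M] [Module R M] where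
  nab : L →ₗ[R] M →+ M
  leibniz : ∀ x (r : R) m, nab x (r • m) = r • nab x m + ⁅x, r⁆ • m

section Conn

variable {R L : Type*} [CommRing R] [LieRing L] [Module R L] [LieRingModule L R]
  [LieRinehartRing R L]

local notation "𝒮" => SymmetricAlgebra R L

lemma lie_one_eq_zero (x : L) : ⁅x, (1 : R)⁆ = 0 := by
  have := LieRinehartRing.leibniz_mul_right x (1 : R) 1
  simpa using this

namespace LRConn

open LieAlgd.Sym

section Deriv

variable (c : LRConn R L L)

/-- The ring homomorphism `a ↦ a + ε ∇_x a` on the symmetric algebra. -/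
def dualHom (x : L) : 𝒮 →+* TrivSqZeroExt 𝒮 𝒮 :=
  liftRingHom
    { toFun := fun r => TrivSqZeroExt.inl (algebraMap R 𝒮 r) +
        TrivSqZeroExt.inr (algebraMap R 𝒮 ⁅x, r⁆)
      map_one' := by simp [lie_one_eq_zero]
      map_mul' := fun r s => by
        ext <;> simp only [TrivSqZeroExt.fst_add, TrivSqZeroExt.snd_add, TrivSqZeroExt.fst_inl,
          TrivSqZeroExt.snd_inl, TrivSqZeroExt.fst_inr, TrivSqZeroExt.snd_inr, TrivSqZeroExt.fst_mul,
          TrivSqZeroExt.snd_mul, op_smul_eq_smul, smul_eq_mul, LieRinehartRing.leibniz_mul_right,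
          map_mul, map_add] <;> ring
      map_zero' := by simp
      map_add' := fun r s => by
        ext <;> simp only [TrivSqZeroExt.fst_add, TrivSqZeroExt.snd_add, TrivSqZeroExt.fst_inl,
          TrivSqZeroExt.snd_inl, TrivSqZeroExt.fst_inr, TrivSqZeroExt.snd_inr, TrivSqZeroExt.fst_mul,
          TrivSqZeroExt.snd_mul, op_smul_eq_smul, smul_eq_mul, lie_add, map_add] <;> ring }
    { toFun := fun y => TrivSqZeroExt.inl (ι R y) + TrivSqZeroExt.inr (ι R (c.nab x y))
      map_zero' := by simp
      map_add' := fun y z => by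
        ext <;> simp only [TrivSqZeroExt.fst_add, TrivSqZeroExt.snd_add, TrivSqZeroExt.fst_inl,
          TrivSqZeroExt.snd_inl, TrivSqZeroExt.fst_inr, TrivSqZeroExt.snd_inr, TrivSqZeroExt.fst_mul,
          TrivSqZeroExt.snd_mul, op_smul_eq_smul, smul_eq_mul, map_add] <;> ring }
    (fun r y => by
      ext <;> simp only [TrivSqZeroExt.fst_add, TrivSqZeroExt.snd_add, TrivSqZeroExt.fst_inl,
          TrivSqZeroExt.snd_inl, TrivSqZeroExt.fst_inr, TrivSqZeroExt.snd_inr, TrivSqZeroExt.fst_mul,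
          TrivSqZeroExt.snd_mul, op_smul_eq_smul, smul_eq_mul, ZeroHom.coe_mk,
          AddMonoidHom.coe_mk, RingHom.coe_mk, MonoidHom.coe_mk, OneHom.coe_mk, c.leibniz,
          map_smul, map_add, Algebra.smul_def] <;> ring)

lemma dualHom_ι (x y : L) : c.dualHom x (ι R y) =
    TrivSqZeroExt.inl (ι R y) + TrivSqZeroExt.inr (ι R (c.nab x y)) := liftRingHom_ι _ _ _ y

lemma dualHom_algebraMap (x : L) (r : R) : c.dualHom x (algebraMap R 𝒮 r) =
    TrivSqZeroExt.inl (algebraMap R 𝒮 r) + TrivSqZeroExt.inr (algebraMap R 𝒮 ⁅x, r⁆) :=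
  liftRingHom_algebraMap _ _ _ r

/-- This makes the second component of `dualHom` a derivation. Dual numbers are used because ∇_x
acts on R through the anchor, so the homomorphism is not R-linear for the obvious structure. -/
lemma fst_dualHom (x : L) (a : 𝒮) : (c.dualHom x a).fst = a := by
  induction a using SymmetricAlgebra.induction with
  | algebraMap r => simp [dualHom_algebraMap]
  | ι y => simp [dualHom_ι]
  | mul a b ha hb => rw [map_mul, TrivSqZeroExt.fst_mul, ha, hb]
  | add a b ha hb => rw [map_add, TrivSqZeroExt.fst_add, ha, hb]

/-- The derivation of the symmetric algebra induced by a connection. -/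
def symNab (x : L) : 𝒮 →+ 𝒮 where
  toFun a := (c.dualHom x a).snd
  map_zero' := by simp
  map_add' a b := by simp

lemma symNab_mul (x : L) (a b : 𝒮) :
    c.symNab x (a * b) = a * c.symNab x b + b * c.symNab x a := by
  change (c.dualHom x (a * b)).snd = a * (c.dualHom x b).snd + b * (c.dualHom x a).snd
  rw [map_mul, TrivSqZeroExt.snd_mul, fst_dualHom, fst_dualHom, op_smul_eq_smul, smul_eq_mul,
    smul_eq_mul]

lemma symNab_ι (x y : L) : c.symNab x (ι R y) = ι R (c.nab x y) := by
  change (c.dualHom x (ι R y)).snd = _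
  simp [dualHom_ι]

lemma symNab_algebraMap (x : L) (r : R) :
    c.symNab x (algebraMap R 𝒮 r) = algebraMap R 𝒮 ⁅x, r⁆ := by
  change (c.dualHom x (algebraMap R 𝒮 r)).snd = _
  rw [dualHom_algebraMap, TrivSqZeroExt.snd_add, TrivSqZeroExt.snd_inl, TrivSqZeroExt.snd_inr,
    zero_add]

lemma symNab_one (x : L) : c.symNab x 1 = 0 := by
  rw [← map_one (algebraMap R 𝒮), symNab_algebraMap, lie_one_eq_zero, map_zero]

/-- The connection on the symmetric algebra of `L` induced by a connection on `L`. -/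
def sym : LRConn R L 𝒮 where
  nab :=
    { toFun := c.symNab
      map_add' := fun x y => by
        ext a
        induction a using SymmetricAlgebra.induction with
        | algebraMap r => simp [symNab_algebraMap]
        | ι z => simp [symNab_ι]
        | mul a b ha hb =>
          simp only [AddMonoidHom.add_apply] at ha hb
          simp only [AddMonoidHom.add_apply, symNab_mul, ha, hb]
          ring
        | add a b ha hb => rw [map_add, map_add, ha, hb]
      map_smul' := fun s x => by
        ext a
        induction a using SymmetricAlgebra.induction with
        | algebraMap r => simp [symNab_algebraMap, Algebra.smul_def]
        | ι z => simp [symNab_ι]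
        | mul a b ha hb =>
          simp only [RingHom.id_apply, AddMonoidHom.smul_apply] at ha hb
          simp only [RingHom.id_apply, AddMonoidHom.smul_apply, symNab_mul, ha, hb, smul_add,
            mul_smul_comm]
        | add a b ha hb => rw [map_add, map_add, ha, hb] }
  leibniz x r a := by
    change c.symNab x (r • a) = r • c.symNab x a + ⁅x, r⁆ • a
    rw [Algebra.smul_def, symNab_mul, symNab_algebraMap, Algebra.smul_def, Algebra.smul_def,
      mul_comm a]

lemma sym_ι_mul (x y : L) (a : 𝒮) :
    c.sym.nab x (ι R y * a) = ι R (c.nab x y) * a + ι R y * c.sym.nab x a := by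
  refine (c.symNab_mul x _ _).trans ?_
  rw [symNab_ι, add_comm, mul_comm a]
  rfl

lemma sym_one (x : L) : c.sym.nab x 1 = 0 := c.symNab_one x

lemma sym_pow (x y : L) (n : ℕ) : c.sym.nab x (ι R y ^ (n + 1)) =
    (n + 1) • (ι R (c.nab x y) * ι R y ^ n) := by
  induction n with
  | zero => simp [pow_one, c.symNab_ι, sym]
  | succ n ih =>
    rw [pow_succ', sym_ι_mul, ih, mul_smul_comm, add_comm, succ_nsmul (n := n + 1)]
    congr 2
    ring

lemma sym_prod (x : L) {n : ℕ} (y : Fin n → L) : c.sym.nab x (∏ i, ι R (y i)) =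
    ∑ k, ∏ i, ι R (Function.update y k (c.nab x (y k)) i) := by
  induction n with
  | zero => simp [sym_one]
  | succ n ih =>
    rw [Fin.prod_univ_succ, sym_ι_mul, ih, Fin.sum_univ_succ, Finset.mul_sum]
    congr 1
    · rw [Fin.prod_univ_succ]
      simp
    · refine Finset.sum_congr rfl fun k _ => ?_
      rw [Fin.prod_univ_succ, Function.update_of_ne (Fin.succ_ne_zero k).symm]
      congr 1
      refine Finset.prod_congr rfl fun i _ => ?_
      by_cases h : i = k
      · subst h; simp
      · rw [Function.update_of_ne h, Function.update_of_ne (by simpa using h)]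

variable [Algebra ℚ R]

/-- On powers this is `sym_pow`. Scalars cost an extra Leibniz term ρ(x)(r) a, which has the same
degree. -/
lemma sym_mem (x : L) {n : ℕ} {a : 𝒮} (ha : a ∈ homog R L n) : c.sym.nab x a ∈ homog R L n := by
  induction ha using Submodule.span_induction with
  | mem a ha =>
    obtain ⟨y, rfl⟩ := ha
    cases n with
    | zero => simp [sym_one]
    | succ n =>
      change c.sym.nab x (ι R y ^ (n + 1)) ∈ _
      rw [sym_pow]
      exact nsmul_mem (ι_mul_pow_mem _ _ _) _
  | zero => simp
  | add a b _ _ ha hb => rw [map_add]; exact add_mem ha hb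
  | smul r a h ha =>
    rw [c.sym.leibniz]
    exact add_mem (Submodule.smul_mem _ _ ha) (Submodule.smul_mem _ _ h)

end Deriv

section Exp

variable (c : LRConn R L L) {M : Type*} [AddCommGroup M] [Module R M] (d : LRConn R L M)

/-- The covariant derivative of a form on the symmetric algebra with values in operators. -/
def covDer (f : 𝒮 →ₗ[R] M →+ M) : L →ₗ[R] 𝒮 →ₗ[R] M →+ M :=
  LinearMap.mk₂ R (fun x a => (d.nab x).comp (f a) - f (c.sym.nab x a))
    (fun x y a => by
      ext m
      simp only [map_add, AddMonoidHom.add_apply, AddMonoidHom.sub_apply, AddMonoidHom.comp_apply]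
      abel)
    (fun r x a => by
      ext m
      simp only [map_smul, AddMonoidHom.smul_apply, AddMonoidHom.sub_apply,
        AddMonoidHom.comp_apply, smul_sub])
    (fun x a b => by
      ext m
      simp only [map_add, AddMonoidHom.add_apply, AddMonoidHom.sub_apply, AddMonoidHom.comp_apply]
      abel)
    -- Linearity in a: the term ρ(x)(r) f(a) coming from the connection on M cancels the one coming
    -- from the connection on the symmetric algebra.
    (fun r x a => by
      ext m
      simp only [map_smul, AddMonoidHom.smul_apply, AddMonoidHom.sub_apply, c.sym.leibniz,
        AddMonoidHom.comp_apply, smul_sub, d.leibniz, map_add, AddMonoidHom.add_apply]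
      abel)

lemma covDer_apply (f : 𝒮 →ₗ[R] M →+ M) (x : L) (a : 𝒮) (m : M) :
    covDer c d f x a m = d.nab x (f a m) - f (c.sym.nab x a) m := rfl

variable [Algebra ℚ R]

/-- The degree `n` part of the symmetrized exponential. -/
def expPart : ℕ → 𝒮 →ₗ[R] M →+ M
  | 0 => (SymmetricAlgebra.algebraMapInv (R := R) (M := L)).toLinearMap.smulRight (AddMonoidHom.id M)
  | n + 1 => ninv R (n + 1) • contr (covDer c d (expPart n))

/-- The symmetrized exponential `Sym L → End M` of a pair of connections on `L` and on `M`: the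
product `x₁ ⋯ xₙ` acts by the `n`-th symmetrized covariant derivative, divided by `n!`. -/
def exp : 𝒮 →ₗ[R] M →+ M := glue (expPart c d)

lemma exp_one (m : M) : exp c d 1 m = m := by
  rw [exp, glue_of_mem _ one_mem]
  simp [expPart]

/-- Contracting yⁿ⁺¹ produces the factor n + 1 that `ninv` removes. Together with `exp_one` this
recursion determines `exp`, and all later identities are proved from it. -/
lemma exp_pow_succ (y : L) (n : ℕ) (m : M) : exp c d (ι R y ^ (n + 1)) m =
    d.nab y (exp c d (ι R y ^ n) m) - exp c d (c.sym.nab y (ι R y ^ n)) m := by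
  rw [exp, glue_of_mem _ (pow_mem y (n + 1)), glue_of_mem _ (pow_mem y n),
    glue_of_mem _ (c.sym_mem y (pow_mem y n)), expPart, LinearMap.smul_apply, contr_pow, ninv_smul,
    covDer_apply]

/-- The polarized form of `exp_pow_succ`: both sides are linear and agree on powers. -/
lemma nsmul_exp {n : ℕ} {a : 𝒮} (ha : a ∈ homog R L (n + 1)) :
    (n + 1) • exp c d a = contr (covDer c d (exp c d)) a := by
  refine eqOn_homog (f := (n + 1) • exp c d) (g := contr (covDer c d (exp c d))) (fun y => ?_) ha
  rw [contr_pow, LinearMap.smul_apply]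
  congr 1
  ext m
  rw [exp_pow_succ, covDer_apply]

/-- The contraction of a product sums over the omitted factor, as `symD` does, and `sym_prod` turns
the derivative of the remaining product into the sum over updated arguments. -/
lemma symDpow_eq (n : ℕ) (m : M) (x : Fin n → L) :
    symDpow (fun x y => c.nab x y) (fun x m => d.nab x m) n m x =
      n.factorial • exp c d (∏ i, ι R (x i)) m := by
  induction n with
  | zero => simp [symDpow, exp_one]
  | succ n ih =>
    rw [Nat.factorial_succ, mul_comm, mul_smul, ← AddMonoidHom.nsmul_apply,
      nsmul_exp c d (prod_mem x), contr_prod, symDpow, symD, AddMonoidHom.finsetSum_apply,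
      Finset.smul_sum]
    refine Finset.sum_congr rfl fun i _ => ?_
    simp only [ih, covDer_apply, sym_prod, map_sum, AddMonoidHom.finsetSum_apply, smul_sub, map_nsmul,
      Finset.smul_sum]

/-- The symmetrized exponential applied to an element, as a linear map. -/
def expApp (m : M) : 𝒮 →ₗ[R] M where
  toFun a := exp c d a m
  map_add' a b := by rw [map_add]; rfl
  map_smul' r a := by rw [map_smul]; rfl

lemma expApp_apply (m : M) (a : 𝒮) : expApp c d m a = exp c d a m := rfl

end Exp

section Map

variable {R' L' : Type*} [CommRing R'] [LieRing L'] [Module R' L'] [LieRingModule L' R']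
  [LieRinehartRing R' L'] {σ : R →+* R'} (F : L →ₛₗ[σ] L')
  (hF : ∀ x r, σ ⁅x, r⁆ = ⁅F x, σ r⁆) (c : LRConn R L L) (c' : LRConn R' L' L')
  (hc : ∀ x y, F (c.nab x y) = c'.nab (F x) (F y))

include hF hc in
lemma symMap_sym (x : L) (a : 𝒮) :
    symMap F (c.sym.nab x a) = c'.sym.nab (F x) (symMap F a) := by
  change symMap F (c.symNab x a) = c'.symNab (F x) (symMap F a)
  induction a using SymmetricAlgebra.induction with
  | algebraMap r => simp only [symNab_algebraMap, symMap_algebraMap, hF]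
  | ι y => simp only [symNab_ι, symMap_ι, hc]
  | mul a b ha hb => simp only [symNab_mul, map_add, map_mul, ha, hb]
  | add a b ha hb => simp only [map_add, ha, hb]

variable [Algebra ℚ R] [Algebra ℚ R'] {M M' : Type*} [AddCommGroup M] [Module R M]
  [AddCommGroup M'] [Module R' M'] (d : LRConn R L M) (d' : LRConn R' L' M') (f : M →ₛₗ[σ] M')
  (hf : ∀ x m, f (d.nab x m) = d'.nab (F x) (f m))

include hF hc hf in
-- Naturality along a change of Lie–Rinehart algebra; it supplies the compatibility with restriction
-- to smaller open sets.
lemma exp_map (a : 𝒮) (m : M) : exp c' d' (symMap F a) (f m) = f (exp c d a m) := by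
  induction a using rec_induction generalizing m with
  | add a b ha hb => simp only [map_add, AddMonoidHom.add_apply, ha, hb]
  | smul r a ha =>
    simp only [symMap_smul, map_smul, AddMonoidHom.smul_apply, LinearMap.map_smulₛₗ, ha]
  | one => simp only [map_one, exp_one]
  | succ n y ih =>
    have h : ∀ n, symMap F (ι R y ^ n) = ι R' (F y) ^ n := fun n => by
      rw [map_pow (symMap F), symMap_ι]
    rw [h, exp_pow_succ, exp_pow_succ, map_sub, hf, ← ih _ (pow_mem y n),
      ← ih _ (c.sym_mem y (pow_mem y n)), symMap_sym F hF c c' hc, h]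

end Map

section Linear

variable [Algebra ℚ R] {M M' : Type*} [AddCommGroup M] [Module R M] (c : LRConn R L L)
  [AddCommGroup M'] [Module R M'] (d : LRConn R L M) (d' : LRConn R L M') (f : M →ₗ[R] M')
  (hf : ∀ x m, f (d.nab x m) = d'.nab x (f m))

include hf in
-- Naturality in the module. It is applied to the coproduct, to the counit and to D ↦ φ(- D), each
-- of which is a morphism of connections.
lemma exp_apply_linearMap (a : 𝒮) (m : M) : exp c d' a (f m) = f (exp c d a m) := by
  induction a using rec_induction generalizing m with
  | add a b ha hb => simp only [map_add, AddMonoidHom.add_apply, ha, hb]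
  | smul r a ha => simp only [map_smul, AddMonoidHom.smul_apply, ha]
  | one => simp only [exp_one]
  | succ n y ih =>
    rw [exp_pow_succ, exp_pow_succ, map_sub, hf, ih _ (pow_mem y n),
      ih _ (c.sym_mem y (pow_mem y n))]

end Linear

section Tensor

variable {M N : Type*} [AddCommGroup M] [Module R M] [AddCommGroup N] [Module R N]
  (d : LRConn R L M) (e : LRConn R L N)

/-- The tensor product of two connections. -/
def tensor : LRConn R L (M ⊗[R] N) where
  nab :=
    { toFun := fun x => tensorDer (fun r => ⁅x, r⁆) (d.nab x) (e.nab x) (d.leibniz x) (e.leibniz x)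
      map_add' := fun x y => by
        ext t
        induction t with
        | zero => simp
        | add a b ha hb => exact (map_add _ _ _).trans (ha ▸ hb ▸ (map_add _ _ _).symm)
        | tmul a b =>
          simp only [AddMonoidHom.add_apply, tensorDer_tmul, map_add, TensorProduct.add_tmul,
            TensorProduct.tmul_add]
          abel
      map_smul' := fun r x => by
        ext t
        induction t with
        | zero => simp
        | add a b ha hb => exact (map_add _ _ _).trans (ha ▸ hb ▸ (map_add _ _ _).symm)
        | tmul a b =>
          simp only [AddMonoidHom.smul_apply, tensorDer_tmul, map_smul, smul_add,
            TensorProduct.tmul_smul, RingHom.id_apply, TensorProduct.smul_tmul'] }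
  leibniz x r t := tensorDer_leibniz _ _ _ (d.leibniz x) (e.leibniz x) r t

lemma tensor_tmul (x : L) (m : M) (n : N) :
    (tensor d e).nab x (m ⊗ₜ[R] n) = d.nab x m ⊗ₜ[R] n + m ⊗ₜ[R] e.nab x n := rfl

variable (c : LRConn R L L)

/-- The coproduct is an algebra map and both connections act by derivations, so it is enough to
compare them on scalars and on elements of L. -/
lemma comul_sym (x : L) (a : 𝒮) : Coalgebra.comul (R := R) (c.sym.nab x a) =
    (tensor c.sym c.sym).nab x (Coalgebra.comul (R := R) a) := by
  have hmul : ∀ s t : 𝒮 ⊗[R] 𝒮, (tensor c.sym c.sym).nab x (s * t) =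
      s * (tensor c.sym c.sym).nab x t + t * (tensor c.sym c.sym).nab x s := by
    intro s t
    induction s with
    | zero => simp
    | add a b ha hb => simp only [map_add, add_mul, mul_add, ha, hb]; abel
    | tmul a b =>
      induction t with
      | zero => simp
      | add a b ha hb => simp only [map_add, add_mul, mul_add, ha, hb]; abel
      | tmul c' d' =>
        have h : ∀ a b : 𝒮, c.sym.nab x (a * b) = a * c.sym.nab x b + b * c.sym.nab x a :=
          c.symNab_mul x
        simp only [Algebra.TensorProduct.tmul_mul_tmul, tensor_tmul, h, mul_add,
          TensorProduct.add_tmul, TensorProduct.tmul_add]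
        simp only [mul_comm]
        abel
  induction a using SymmetricAlgebra.induction with
  | algebraMap r =>
    have h : c.sym.nab x (algebraMap R 𝒮 r) = algebraMap R 𝒮 ⁅x, r⁆ := c.symNab_algebraMap x r
    rw [h, Bialgebra.comul_algebraMap, Bialgebra.comul_algebraMap,
      Algebra.TensorProduct.algebraMap_apply, Algebra.TensorProduct.algebraMap_apply, tensor_tmul,
      sym_one, h, TensorProduct.tmul_zero, add_zero]
  | ι y =>
    have h : ∀ y, c.sym.nab x (ι R y) = ι R (c.nab x y) := c.symNab_ι x
    rw [h, SymmetricAlgebra.comul_ι, SymmetricAlgebra.comul_ι, map_add, tensor_tmul, tensor_tmul,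
      sym_one, h, TensorProduct.tmul_zero, TensorProduct.zero_tmul, add_zero, zero_add]
  | mul a b ha hb =>
    have h : c.sym.nab x (a * b) = a * c.sym.nab x b + b * c.sym.nab x a := c.symNab_mul x a b
    rw [h, Bialgebra.comul_mul, hmul, map_add, Bialgebra.comul_mul, Bialgebra.comul_mul, ha, hb]
  | add a b ha hb => rw [map_add, map_add, map_add, map_add, ha, hb]

variable [Algebra ℚ R]

/-- Elements of L are primitive for the coproduct and act on a tensor product by the Leibniz rule,
so the recursions of the two factors add up to that of the tensor product. -/
lemma exp_tensor (a : 𝒮) (m : M) (n : N) : exp c (tensor d e) a (m ⊗ₜ[R] n) =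
    TensorProduct.map (expApp c d m) (expApp c e n) (Coalgebra.comul (R := R) a) := by
  induction a using rec_induction with
  | add a b ha hb => simp only [map_add, AddMonoidHom.add_apply, ha, hb]
  | smul r a ha => simp only [map_smul, AddMonoidHom.smul_apply, ha]
  | one =>
    rw [exp_one, Bialgebra.comul_one, Algebra.TensorProduct.one_def, TensorProduct.map_tmul,
      expApp_apply, expApp_apply, exp_one, exp_one]
  | succ k y ih =>
    rw [exp_pow_succ, ih _ (pow_mem y k), ih _ (c.sym_mem y (pow_mem y k)), comul_sym, pow_succ',
      Bialgebra.comul_mul, Bialgebra.comul_pow, SymmetricAlgebra.comul_ι]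
    -- The identity is checked on yⁱ ⊗ yʲ, where it is the sum of the recursions in the two slots.
    have key : ∀ i j : ℕ, (tensor d e).nab y (TensorProduct.map (expApp c d m) (expApp c e n)
        ((ι R y ^ i) ⊗ₜ[R] (ι R y ^ j))) - TensorProduct.map (expApp c d m) (expApp c e n)
          ((tensor c.sym c.sym).nab y ((ι R y ^ i) ⊗ₜ[R] (ι R y ^ j))) =
        TensorProduct.map (expApp c d m) (expApp c e n)
          ((ι R y ⊗ₜ 1 + 1 ⊗ₜ ι R y) * ((ι R y ^ i) ⊗ₜ[R] (ι R y ^ j))) := by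
      intro i j
      simp only [add_mul, Algebra.TensorProduct.tmul_mul_tmul, one_mul, ← pow_succ', map_add,
        TensorProduct.map_tmul, tensor_tmul, expApp_apply, exp_pow_succ, TensorProduct.sub_tmul,
        TensorProduct.tmul_sub]
      abel
    -- By the binomial formula Δ(y)ᵏ is a sum of such tensors with natural coefficients; additivity
    -- then suffices, which matters because the connection is not R-linear.
    have hmem : (ι R y ⊗ₜ[R] (1 : 𝒮) + (1 : 𝒮) ⊗ₜ[R] ι R y) ^ k ∈
        AddSubmonoid.closure (Set.range fun p : ℕ × ℕ =>
          ((ι R y ^ p.1) ⊗ₜ[R] (ι R y ^ p.2) : 𝒮 ⊗[R] 𝒮)) := by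
      rw [add_pow]
      refine AddSubmonoid.sum_mem _ fun i _ => ?_
      rw [← nsmul_eq_mul']
      refine nsmul_mem (AddSubmonoid.subset_closure ?_) _
      refine ⟨(i, k - i), ?_⟩
      simp [Algebra.TensorProduct.tmul_pow, Algebra.TensorProduct.tmul_mul_tmul]
    generalize (ι R y ⊗ₜ[R] (1 : 𝒮) + (1 : 𝒮) ⊗ₜ[R] ι R y) ^ k = t at hmem ⊢
    induction hmem using AddSubmonoid.closure_induction with
    | mem t ht => obtain ⟨p, rfl⟩ := ht; exact key p.1 p.2
    | zero => simp
    | add s t _ _ hs ht =>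
      simp only [map_add, mul_add, ← hs, ← ht]
      abel

end Tensor

end LRConn

end Conn

end LieAlgd

end

/-! ### Curvature, and a flat connection on the symmetric algebra. -/

noncomputable section

namespace LieAlgd

section Curv

variable {R L : Type*} [CommRing R] [LieRing L] [Module R L] [LieRingModule L R]
  [LieRinehartRing R L]

local notation "𝒮" => SymmetricAlgebra R L

namespace LRConn

open LieAlgd.Sym

section

variable {M : Type*} [AddCommGroup M] [Module R M] (d : LRConn R L M)

lemma smul_lie' (r : R) (x y : L) : ⁅r • x, y⁆ = r • ⁅x, y⁆ - ⁅y, r⁆ • x := by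
  rw [← lie_skew, LieRinehartRing.leibniz_smul_right, ← lie_skew x y, smul_neg]
  abel

/-- The curvature of a connection. -/
def curv : L →ₗ[R] L →ₗ[R] M →ₗ[R] M :=
  LinearMap.mk₂ R (fun x y =>
      { toFun := fun m => d.nab x (d.nab y m) - d.nab y (d.nab x m) - d.nab ⁅x, y⁆ m
        map_add' := fun a b => by simp only [map_add]; abel
        map_smul' := fun r a => by
          have h : (⁅⁅x, y⁆, r⁆ : R) = ⁅x, ⁅y, r⁆⁆ - ⁅y, ⁅x, r⁆⁆ := by
            rw [leibniz_lie x y r]; abel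
          simp only [d.leibniz, map_add, h, sub_smul, RingHom.id_apply, smul_sub]
          abel })
    (fun x y z => LinearMap.ext fun m => by
      simp only [LinearMap.coe_mk, AddHom.coe_mk, LinearMap.add_apply, map_add, add_lie,
        AddMonoidHom.add_apply]
      abel)
    (fun r x y => LinearMap.ext fun m => by
      simp only [LinearMap.coe_mk, AddHom.coe_mk, LinearMap.smul_apply, map_smul, smul_lie',
        AddMonoidHom.smul_apply, d.leibniz, map_sub, AddMonoidHom.sub_apply, smul_sub]
      abel)
    (fun x y z => LinearMap.ext fun m => by
      simp only [LinearMap.coe_mk, AddHom.coe_mk, LinearMap.add_apply, map_add, lie_add,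
        AddMonoidHom.add_apply]
      abel)
    (fun r x y => LinearMap.ext fun m => by
      simp only [LinearMap.coe_mk, AddHom.coe_mk, LinearMap.smul_apply, map_smul,
        LieRinehartRing.leibniz_smul_right, map_add, AddMonoidHom.add_apply,
        AddMonoidHom.smul_apply, d.leibniz, smul_sub]
      abel)

lemma curv_apply (x y : L) (m : M) :
    d.curv x y m = d.nab x (d.nab y m) - d.nab y (d.nab x m) - d.nab ⁅x, y⁆ m := rfl

lemma curv_self (x : L) (m : M) : d.curv x x m = 0 := by simp [curv_apply]

lemma curv_swap (x y : L) (m : M) : d.curv x y m = -d.curv y x m := by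
  rw [curv_apply, curv_apply, ← lie_skew x y, map_neg, AddMonoidHom.neg_apply]
  abel

/-- The Jacobi identity for the operators ∇_x: in the cyclic sum the threefold compositions cancel,
and what remains vanishes by the Jacobi identity in L. -/
lemma bianchi (x y z : L) (m : M) :
    d.nab x (d.curv y z m) - d.curv y z (d.nab x m) - d.curv ⁅x, y⁆ z m +
      (d.nab y (d.curv z x m) - d.curv z x (d.nab y m) - d.curv ⁅y, z⁆ x m) +
      (d.nab z (d.curv x y m) - d.curv x y (d.nab z m) - d.curv ⁅z, x⁆ y m) = 0 := by
  have h : d.nab ⁅⁅x, y⁆, z⁆ m + d.nab ⁅⁅y, z⁆, x⁆ m + d.nab ⁅⁅z, x⁆, y⁆ m = 0 := by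
    rw [← AddMonoidHom.add_apply, ← AddMonoidHom.add_apply, ← map_add, ← map_add]
    have h1 := lie_jacobi x y z
    rw [← lie_skew ⁅x, y⁆ z, ← lie_skew ⁅y, z⁆ x, ← lie_skew ⁅z, x⁆ y, ← neg_add, ← neg_add]
    have h2 : ⁅z, ⁅x, y⁆⁆ + ⁅x, ⁅y, z⁆⁆ + ⁅y, ⁅z, x⁆⁆ = 0 := by rw [← h1]; abel
    rw [h2, neg_zero, map_zero, AddMonoidHom.zero_apply]
  have e : d.nab ⁅⁅x, y⁆, z⁆ m = - d.nab ⁅⁅y, z⁆, x⁆ m - d.nab ⁅⁅z, x⁆, y⁆ m := by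
    rw [eq_sub_iff_add_eq, eq_neg_iff_add_eq_zero, ← h]; abel
  simp only [curv_apply, map_sub, e]
  abel

end

section Star

variable (c : LRConn R L L)

/-- The connection `x ⋆ a = x a + ∇_x a + A(a)(x)` on the symmetric algebra. -/
def star (A : 𝒮 →ₗ[R] L →ₗ[R] 𝒮) : LRConn R L 𝒮 where
  nab :=
    { toFun := fun x => AddMonoidHom.mulLeft (ι R x) + c.sym.nab x + (A.flip x).toAddMonoidHom
      map_add' := fun x y => by
        ext a
        simp only [map_add, AddMonoidHom.add_apply, AddMonoidHom.coe_mulLeft, add_mul,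
          LinearMap.toAddMonoidHom_coe, LinearMap.add_apply]
        abel
      map_smul' := fun r x => by
        ext a
        simp only [map_smul, AddMonoidHom.add_apply, AddMonoidHom.coe_mulLeft, smul_mul_assoc,
          LinearMap.toAddMonoidHom_coe, LinearMap.smul_apply, AddMonoidHom.smul_apply, smul_add,
          RingHom.id_apply] }
  leibniz x r a := by
    simp only [LinearMap.coe_mk, AddHom.coe_mk, AddMonoidHom.add_apply, AddMonoidHom.coe_mulLeft,
      mul_smul_comm, LinearMap.toAddMonoidHom_coe, map_smul, c.sym.leibniz, smul_add]
    abel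

lemma star_apply (A : 𝒮 →ₗ[R] L →ₗ[R] 𝒮) (x : L) (a : 𝒮) :
    (c.star A).nab x a = ι R x * a + c.sym.nab x a + A a x := rfl

/-- The contraction of the curvature of `x ⋆ a`. -/
def contrCurv (A : 𝒮 →ₗ[R] L →ₗ[R] 𝒮) : 𝒮 →ₗ[R] L →ₗ[R] 𝒮 :=
  contr (LinearMap.lflip.toLinearMap ∘ₗ (c.star A).curv)

lemma contrCurv_pow (A : 𝒮 →ₗ[R] L →ₗ[R] 𝒮) (y : L) (n : ℕ) (x : L) :
    c.contrCurv A (ι R y ^ (n + 1)) x = (n + 1) • (c.star A).curv y x (ι R y ^ n) := by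
  rw [contrCurv, contr_pow]
  rfl

variable [Algebra ℚ R]

/-- To leading order x ⋆ a is the product x a; the other two terms do not raise the degree. -/
lemma star_sub_mem {A : 𝒮 →ₗ[R] L →ₗ[R] 𝒮} (hA : ∀ m, ∀ a ∈ homog R L m, ∀ x, A a x ∈ filt R L m)
    (x : L) {m : ℕ} {a : 𝒮} (ha : a ∈ filt R L m) :
    (c.star A).nab x a - ι R x * a ∈ filt R L m := by
  refine filt_induction (P := fun a => (c.star A).nab x a - ι R x * a ∈ filt R L m)
    (fun k hk a ha => ?_) (fun a b ha hb => ?_) ha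
  · rw [star_apply, add_assoc, add_sub_cancel_left]
    exact add_mem (homog_le_filt hk (c.sym_mem x ha)) (filt_mono hk (hA k a ha x))
  · rw [map_add, mul_add, add_sub_add_comm]
    exact add_mem ha hb

lemma star_mem {A : 𝒮 →ₗ[R] L →ₗ[R] 𝒮} (hA : ∀ m, ∀ a ∈ homog R L m, ∀ x, A a x ∈ filt R L m)
    (x : L) {m : ℕ} {a : 𝒮} (ha : a ∈ filt R L m) : (c.star A).nab x a ∈ filt R L (m + 1) := by
  have := add_mem (filt_mono m.le_succ (c.star_sub_mem hA x ha)) (ι_mul_mem_filt x ha)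
  rwa [sub_add_cancel] at this

/-- A priori the degree could rise by 2, but the leading terms x y a and y x a cancel by
commutativity. -/
lemma curv_star_mem {A : 𝒮 →ₗ[R] L →ₗ[R] 𝒮}
    (hA : ∀ m, ∀ a ∈ homog R L m, ∀ x, A a x ∈ filt R L m)
    (x y : L) {m : ℕ} {a : 𝒮} (ha : a ∈ filt R L m) :
    (c.star A).curv x y a ∈ filt R L (m + 1) := by
  have key : ∀ x y, (c.star A).nab x ((c.star A).nab y a) - ι R x * (ι R y * a) ∈
      filt R L (m + 1) := fun x y => by
    have h1 := c.star_sub_mem hA x (ι_mul_mem_filt y ha)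
    have h2 := c.star_mem hA x (c.star_sub_mem hA y ha)
    have := add_mem h1 h2
    rw [map_sub] at this
    convert this using 1
    abel
  have := sub_mem (sub_mem (key x y) (key y x)) (c.star_mem hA ⁅x, y⁆ ha)
  rw [mul_left_comm] at this
  convert this using 1
  rw [curv_apply]
  abel

/-- The successive approximations of a flat connection of the form `x a + ∇_x a + A(a)(x)`. -/
def flatApprox : ℕ → 𝒮 →ₗ[R] L →ₗ[R] 𝒮
  | 0 => 0
  | n + 1 => flatApprox n + (ninv R (n + 2) • c.contrCurv (flatApprox n)) ∘ₗ proj R L (n + 1)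

lemma flatApprox_succ (n : ℕ) {a : 𝒮} (ha : a ∈ homog R L (n + 1)) (x : L) :
    c.flatApprox (n + 1) a x =
      c.flatApprox n a x + ninv R (n + 2) • c.contrCurv (c.flatApprox n) a x := by
  simp [flatApprox, proj_of_mem ha]

lemma flatApprox_succ_of_ne (n : ℕ) {m : ℕ} (hm : m ≠ n + 1) {a : 𝒮} (ha : a ∈ homog R L m) :
    c.flatApprox (n + 1) a = c.flatApprox n a := by
  simp [flatApprox, proj_of_mem_ne hm ha]

/-- On (yᵐ, y) each correction is a multiple of Ω(y, y) = 0. This keeps the normalization y ⋆ yᵐ =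
yᵐ⁺¹ + ∇_y yᵐ throughout. -/
lemma flatApprox_pow_self (n m : ℕ) (y : L) : c.flatApprox n (ι R y ^ m) y = 0 := by
  induction n with
  | zero => rfl
  | succ n ih =>
    by_cases hm : m = n + 1
    · subst hm
      rw [flatApprox_succ c n (pow_mem y _), ih, contrCurv_pow, curv_self, smul_zero, smul_zero,
        add_zero]
    · rw [flatApprox_succ_of_ne c n hm (pow_mem y m), ih]

lemma flatApprox_mem (n m : ℕ) (a : 𝒮) (ha : a ∈ homog R L m) (x : L) :
    c.flatApprox n a x ∈ filt R L m := by
  induction n generalizing m a x with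
  | zero => exact zero_mem _
  | succ n ih =>
    by_cases hm : m = n + 1
    · subst hm
      refine map_mem_of_pow_mem ((LinearMap.applyₗ x) ∘ₗ c.flatApprox (n + 1)) _ (fun y => ?_) ha
      change c.flatApprox (n + 1) (ι R y ^ (n + 1)) x ∈ _
      -- The correction on yⁿ⁺¹ is a multiple of the curvature applied to yⁿ, hence of degree at
      -- most n + 1 by `curv_star_mem`.
      rw [flatApprox_succ c n (pow_mem y _), contrCurv_pow]
      exact add_mem (ih _ _ (pow_mem y _) x) (Submodule.smul_mem _ _ (nsmul_mem
        (c.curv_star_mem ih y x (homog_le_filt le_rfl (pow_mem y n))) _))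
    · rw [flatApprox_succ_of_ne c n hm ha]
      exact ih m a ha x

lemma flatApprox_eq {m n : ℕ} (hmn : m ≤ n) {a : 𝒮} (ha : a ∈ homog R L m) :
    c.flatApprox n a = c.flatApprox m a := by
  induction hmn with
  | refl => rfl
  | step h ih => rw [flatApprox_succ_of_ne c _ (Nat.lt_succ_of_le h).ne ha, ih]

/-- If the two choices agree up to degree m, the curvature on degree m sees the change only through
the leading products y a and x a, which have degree m + 1. -/
lemma curv_star_congr {A A' : 𝒮 →ₗ[R] L →ₗ[R] 𝒮} {m : ℕ}
    (hA : ∀ m, ∀ a ∈ homog R L m, ∀ x, A a x ∈ filt R L m)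
    (h : ∀ k ≤ m, ∀ a ∈ homog R L k, A' a = A a) {a : 𝒮} (ha : a ∈ homog R L m) (x y : L) :
    (c.star A').curv x y a = (c.star A).curv x y a + (A' - A) (ι R y * a) x -
      (A' - A) (ι R x * a) y := by
  have hstar : ∀ a ∈ filt R L m, ∀ x, (c.star A').nab x a = (c.star A).nab x a := fun a ha x => by
    refine filt_induction (P := fun a => (c.star A').nab x a = (c.star A).nab x a)
      (fun k hk a ha => ?_) (fun a b ha hb => ?_) ha
    · rw [star_apply, star_apply, h k hk a ha]
    · rw [map_add, map_add, ha, hb]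
  have hdiff : ∀ a x, (c.star A').nab x a = (c.star A).nab x a + (A' - A) a x := fun a x => by
    simp only [star_apply, LinearMap.sub_apply]; abel
  have ha' : a ∈ filt R L m := homog_le_filt le_rfl ha
  have key : ∀ x y, (c.star A').nab x ((c.star A').nab y a) =
      (c.star A).nab x ((c.star A).nab y a) + (A' - A) (ι R y * a) x := fun x y => by
    have h1 : (c.star A).nab y a =
        ((c.star A).nab y a - ι R y * a) + ι R y * a := (sub_add_cancel _ _).symm
    rw [hstar a ha' y, h1, map_add, map_add, hstar _ (c.star_sub_mem hA y ha') x, hdiff (ι R y * a)]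
    abel
  rw [curv_apply, curv_apply, key, key, hstar a ha']
  abel

/-- The step from n to n + 1 alters the connection in degree n + 1 alone. Curvature below degree n
is unaffected, while in degree n it is removed first on the terms Ω(y, x)yⁿ and then, by the Bianchi
identity, everywhere. -/
lemma curv_flatApprox (n : ℕ) :
    ∀ m < n, ∀ a ∈ homog R L m, ∀ x y, (c.star (c.flatApprox n)).curv x y a = 0 := by
  induction n with
  | zero => intro m hm; omega
  | succ n ih =>
    have hcongr : ∀ m ≤ n, ∀ a ∈ homog R L m, c.flatApprox (n + 1) a = c.flatApprox n a :=
      fun m hm a ha => c.flatApprox_succ_of_ne n (by omega) ha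
    have hlow : ∀ m < n, ∀ a ∈ homog R L m, ∀ x y,
        (c.star (c.flatApprox (n + 1))).curv x y a = 0 := fun m hm a ha x y => by
      rw [c.curv_star_congr (c.flatApprox_mem n) (fun k hk => hcongr k (by omega)) ha,
        ih m hm a ha]
      simp only [LinearMap.sub_apply, hcongr (m + 1) hm _ (ι_mul_mem y ha),
        hcongr (m + 1) hm _ (ι_mul_mem x ha), sub_self, LinearMap.zero_apply, add_zero]
    have hlow' : ∀ m < n, ∀ a ∈ filt R L m, ∀ x y,
        (c.star (c.flatApprox (n + 1))).curv x y a = 0 := fun m hm a ha x y =>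
      filt_induction (P := fun a => (c.star (c.flatApprox (n + 1))).curv x y a = 0)
        (fun k hk a ha => hlow k (by omega) a ha x y)
        (fun a b ha hb => by rw [map_add, ha, hb, add_zero]) ha
    -- Write B for the correction and w for the old Ω(y, x)yⁿ. The new value is w + B(x yⁿ)(y) -
    -- B(yⁿ⁺¹)(x). As B(yⁿ⁺¹)(y) = 0, polarization gives (n + 1) B(x yⁿ)(y) = -B(yⁿ⁺¹)(x).
    -- Multiplying by n + 1 leaves (n + 1)w - (n + 2)B(yⁿ⁺¹)(x), which explains the factor 1/(n + 2)
    -- in `flatApprox`.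
    have hdiag : ∀ y x, (c.star (c.flatApprox (n + 1))).curv y x (ι R y ^ n) = 0 := fun y x => by
      let B : 𝒮 →ₗ[R] L →ₗ[R] 𝒮 := c.flatApprox (n + 1) - c.flatApprox n
      let w := (c.star (c.flatApprox n)).curv y x (ι R y ^ n)
      have hB : B (ι R y ^ (n + 1)) x = ninv R (n + 2) • (n + 1) • w := by
        simp only [B, LinearMap.sub_apply]
        rw [c.flatApprox_succ n (pow_mem y _), contrCurv_pow, add_sub_cancel_left]
      have hpol := polarize B.flip n (fun y => by
        simp only [B, LinearMap.flip_apply, LinearMap.sub_apply, flatApprox_pow_self, sub_zero]) x y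
      simp only [LinearMap.flip_apply] at hpol
      rw [c.curv_star_congr (c.flatApprox_mem n) hcongr (pow_mem y n), ← pow_succ']
      change w + B (ι R x * ι R y ^ n) y - B (ι R y ^ (n + 1)) x = 0
      refine eq_zero_of_nsmul R (n := n) ?_
      have h2 : (n + 1) • B (ι R x * ι R y ^ n) y = - B (ι R y ^ (n + 1)) x :=
        eq_neg_of_add_eq_zero_right hpol
      have h3 : (n + 2) • B (ι R y ^ (n + 1)) x = (n + 1) • w := by
        rw [hB, smul_comm, ninv_smul (n + 1)]
      rw [smul_sub, smul_add, h2, ← h3]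
      simp only [add_smul, one_smul, two_smul]
      abel
    intro m hm a ha x z
    rcases Nat.lt_succ_iff_lt_or_eq.1 hm with hm | rfl
    · exact hlow m hm a ha x z
    · refine eqOn_homog (f := (c.star (c.flatApprox (m + 1))).curv x z) (g := 0) (fun y => ?_) ha
      cases m with
      -- In degree 0 the power is 1 whatever its base, so every pair of arguments is already covered
      -- by `hdiag`.
      | zero => simpa using hdiag x z
      | succ k =>
        set Ω := (c.star (c.flatApprox (k + 1 + 1))).curv with hΩ
        have hb := (c.star (c.flatApprox (k + 1 + 1))).bianchi x y z (ι R y ^ k)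
        have hz := hlow k (by omega) _ (pow_mem y k)
        -- The curvature vanishes below the present degree, so w ⋆ yᵏ may be replaced by its leading
        -- term w yᵏ.
        have hs : ∀ u v w, Ω u v ((c.star (c.flatApprox (k + 1 + 1))).nab w (ι R y ^ k)) =
            Ω u v (ι R w * ι R y ^ k) := fun u v w => by
          rw [← sub_eq_zero, ← map_sub]
          exact hlow' k (by omega) _ (c.star_sub_mem (c.flatApprox_mem _) w
            (homog_le_filt le_rfl (pow_mem y k))) u v
        rw [← hΩ] at hb
        simp only [hs, hz, map_zero, zero_sub, sub_zero] at hb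
        have hp : ∀ u v, Ω u v (ι R y ^ (k + 1)) + (k + 1) • Ω y v (ι R u * ι R y ^ k) = 0 :=
          fun u v => polarize (Ω.flip v) k (fun y => hdiag y v) u y
        have h1 := hp x z
        have h2 := hp z x
        have e1 : Ω z x (ι R y ^ (k + 1)) = - Ω x z (ι R y ^ (k + 1)) := curv_swap _ _ _ _
        have e2 : Ω x y (ι R z * ι R y ^ k) = - Ω y x (ι R z * ι R y ^ k) := curv_swap _ _ _ _
        have e3 : Ω z x (ι R y * ι R y ^ k) = - Ω x z (ι R y ^ (k + 1)) := by
          rw [← pow_succ']; exact e1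
        rw [e1] at h2
        rw [e2, e3] at hb
        -- Bianchi on (x, y, z) and yᵏ gives Ω(y,z)(x yᵏ) + Ω(z,x)yᵏ⁺¹ + Ω(x,y)(z yᵏ) = 0.
        -- Multiplied by k + 1, the outer terms become multiples of Ω(x,z)yᵏ⁺¹ by polarization of
        -- `hdiag`, and in total (k + 3) Ω(x,z)yᵏ⁺¹ = 0.
        refine eq_zero_of_nsmul R (n := k + 2) ?_
        have hb' := congrArg ((k + 1) • ·) hb
        simp only [smul_add, smul_neg, smul_zero, neg_neg] at hb'
        have h1' := eq_neg_of_add_eq_zero_right h1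
        have h2' := eq_neg_of_add_eq_zero_right h2
        rw [h1', h2', neg_neg] at hb'
        rw [← hb']
        simp only [add_smul, one_smul, two_smul]
        abel

/-- The flat connection on `Sym L` whose value on powers is `x ⋆ xⁿ = xⁿ⁺¹ + ∇_x (xⁿ)`. -/
def flat : LRConn R L 𝒮 := c.star (glue c.flatApprox)

lemma glue_flatApprox_mem (m : ℕ) (a : 𝒮) (ha : a ∈ homog R L m) (x : L) :
    glue c.flatApprox a x ∈ filt R L m := by
  rw [glue_of_mem _ ha]
  exact c.flatApprox_mem m m a ha x

lemma flat_pow (y : L) (n : ℕ) :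
    c.flat.nab y (ι R y ^ n) = ι R y ^ (n + 1) + c.sym.nab y (ι R y ^ n) := by
  rw [flat, star_apply, glue_of_mem _ (pow_mem y n), flatApprox_pow_self, add_zero, pow_succ']

lemma flat_sub_mem (x : L) {m : ℕ} {a : 𝒮} (ha : a ∈ filt R L m) :
    c.flat.nab x a - ι R x * a ∈ filt R L m := c.star_sub_mem c.glue_flatApprox_mem x ha

lemma flat_mem (x : L) {m : ℕ} {a : 𝒮} (ha : a ∈ filt R L m) :
    c.flat.nab x a ∈ filt R L (m + 1) := c.star_mem c.glue_flatApprox_mem x ha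

/-- The curvature in degree n involves the connection in degrees at most n + 1, where the glued
correction is that of `flatApprox (n + 1)`. -/
lemma curv_flat (x y : L) (a : 𝒮) : c.flat.curv x y a = 0 := by
  induction a using homog_induction with
  | hom n a ha =>
    have hcongr : ∀ k ≤ n + 1, ∀ a ∈ homog R L k,
        glue c.flatApprox a = c.flatApprox (n + 1) a := fun k hk a ha => by
      rw [glue_of_mem _ ha, c.flatApprox_eq hk ha]
    rw [flat, c.curv_star_congr (c.flatApprox_mem (n + 1)) (fun k hk => hcongr k (by omega)) ha,
      c.curv_flatApprox (n + 1) n (by omega) a ha]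
    simp only [LinearMap.sub_apply, hcongr (n + 1) le_rfl _ (ι_mul_mem y ha),
      hcongr (n + 1) le_rfl _ (ι_mul_mem x ha), sub_self, LinearMap.zero_apply, add_zero]
  | add a b ha hb => rw [map_add, ha, hb, add_zero]

lemma flat_flat (x y : L) (a : 𝒮) : c.flat.nab x (c.flat.nab y a) =
    c.flat.nab y (c.flat.nab x a) + c.flat.nab ⁅x, y⁆ a := by
  have := c.curv_flat x y a
  rw [curv_apply, sub_eq_zero, sub_eq_iff_eq_add'] at this
  exact this

end Star

end LRConn

end Curv

end LieAlgd

end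

/-! ### The Poincaré–Birkhoff–Witt isomorphism of a connection. -/

noncomputable section

namespace LieAlgd

section PBW

open LieAlgd.Sym LRConn

variable {K R L : Type*} [CommRing K] [CommRing R] [Algebra K R] [LieRing L] [Module R L]
  [LieRingModule L R] [LieAlgebra K L] [LieRinehartRing R L] [LieRinehartAlgebra K R L]

local notation "𝒮" => SymmetricAlgebra R L

namespace UEnv

variable (K R L) in
/-- Left multiplication by elements of `L`, as a connection on the universal enveloping algebra. -/
def conn : LRConn R L (UEnv K R L) where
  nab :=
    { toFun := lmul
      map_add' := fun x y => by
        ext D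
        change iL K R L (x + y) * D = iL K R L x * D + iL K R L y * D
        rw [map_add, add_mul]
      map_smul' := fun r x => by
        ext D
        change iL K R L (r • x) * D = r • (iL K R L x * D)
        rw [← iR_mul_iL, smul_def, mul_assoc] }
  leibniz := lmul_smul

lemma conn_nab (x : L) (D : UEnv K R L) : (conn K R L).nab x D = iL K R L x * D := rfl

lemma iL_mul_mem_filtration (x : L) {n : ℕ} {D : UEnv K R L} (hD : D ∈ filtration K R L n) :
    iL K R L x * D ∈ filtration K R L (n + 1) := by
  induction hD using Submodule.span_induction with
  | mem D hD =>
    obtain ⟨l, hl, rfl⟩ := hD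
    exact Submodule.subset_span ⟨x :: l, by simpa using hl, by simp⟩
  | zero => simp
  | add a b _ _ ha hb => rw [mul_add]; exact add_mem ha hb
  | smul r a h ha =>
    rw [iL_mul_smul]
    refine add_mem (Submodule.smul_mem _ _ ha) (Submodule.smul_mem _ _ ?_)
    refine Submodule.span_mono ?_ h
    rintro _ ⟨l, hl, rfl⟩
    exact ⟨l, by omega, rfl⟩

lemma filtration_mono {m n : ℕ} (h : m ≤ n) : filtration K R L m ≤ filtration K R L n := by
  refine Submodule.span_mono ?_
  rintro _ ⟨l, hl, rfl⟩
  exact ⟨l, by omega, rfl⟩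

section orbit

variable {M : Type*} [AddCommGroup M] [Module R M] (d : LRConn R L M)
  (hd : ∀ x y m, d.nab x (d.nab y m) = d.nab y (d.nab x m) + d.nab ⁅x, y⁆ m) (m : M)

/-- The map `D ↦ D m` for an element `m` of a module with a flat connection. -/
def orbit : UEnv K R L →ₗ[R] M :=
  letI : Module K M := Module.compHom _ (algebraMap K R)
  haveI : IsScalarTower K R M := ⟨fun k r m => by rw [Algebra.smul_def k r, mul_smul]; rfl⟩
  { toFun := fun D => act (K := K) (fun x => d.nab x) (fun x y m => by simp) (fun r x m => by simp)
      (fun x r m => d.leibniz x r m) hd D m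
    map_add' := fun D E => by simp
    map_smul' := fun r D => act_smul _ _ _ _ _ r D m }

lemma orbit_one : orbit (K := K) d hd m 1 = m := by simp [orbit]

lemma orbit_iL_mul (x : L) (D : UEnv K R L) :
    orbit d hd m (iL K R L x * D) = d.nab x (orbit d hd m D) :=
  let _ : Module K M := Module.compHom _ (algebraMap K R)
  have _ : IsScalarTower K R M := ⟨fun k r m => by rw [Algebra.smul_def k r, mul_smul]; rfl⟩
  act_iL_mul _ _ _ _ _ x D m

end orbit

variable [Algebra ℚ R] (c : LRConn R L L)

variable (K) in
/-- The Poincaré--Birkhoff--Witt map `Sym L → 𝓤(L)` of a connection on `L`. -/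
def pbw : 𝒮 →ₗ[R] UEnv K R L := expApp c (conn K R L) 1

lemma pbw_one : pbw K c 1 = 1 := exp_one _ _ _

lemma pbw_pow_succ (y : L) (n : ℕ) : pbw K c (ι R y ^ (n + 1)) =
    iL K R L y * pbw K c (ι R y ^ n) - pbw K c (c.sym.nab y (ι R y ^ n)) :=
  exp_pow_succ c (conn K R L) y n 1

/-- The coproduct of 𝓤(L) intertwines left multiplication with its tensor square, so naturality of
`exp` and `exp_tensor` apply. -/
lemma comul_pbw (a : 𝒮) : comul (pbw K c a) =
    TensorProduct.map (pbw K c) (pbw K c) (Coalgebra.comul (R := R) a) := by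
  have := exp_apply_linearMap c (conn K R L) (tensor (conn K R L) (conn K R L)) comul
    (fun x D => comul_iL_mul x D) a 1
  rw [comul_one, exp_tensor] at this
  exact this.symm

variable (K R L) in
/-- The action of `L` on `R`, as a connection. -/
def _root_.LieAlgd.LRConn.anchor : LRConn R L R where
  nab :=
    { toFun := fun x => (LieModule.toEnd K L R x).toAddMonoidHom
      map_add' := fun x y => by ext; simp
      map_smul' := fun r x => by ext; simp }
  leibniz x r s := by simp

/-- The counit intertwines left multiplication with the anchor action on R, and anchors kill the
constant 1, so `exp` sends 1 to 0 in positive degree. -/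
lemma counit_pbw (a : 𝒮) : counit (pbw K c a) = Coalgebra.counit (R := R) a := by
  have h := exp_apply_linearMap c (conn K R L) (LRConn.anchor K R L) counit
    (fun x D => counit_iL_mul x D) a 1
  rw [counit_one] at h
  refine h.symm.trans ?_
  clear h
  induction a using rec_induction with
  | add a b ha hb => rw [map_add, map_add, AddMonoidHom.add_apply, ha, hb]
  | smul r a ha => rw [map_smul, map_smul, AddMonoidHom.smul_apply, ha]
  | one => rw [exp_one, Bialgebra.counit_one]
  | succ n y ih =>
    rw [exp_pow_succ, ih _ (pow_mem y n), ih _ (c.sym_mem y (pow_mem y n)), Bialgebra.counit_pow,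
      Bialgebra.counit_pow, SymmetricAlgebra.counit_ι]
    change ⁅y, (0 : R) ^ n⁆ - _ = _
    cases n with
    | zero => simp [lie_one_eq_zero, sym_one]
    | succ n => rw [sym_pow]; simp

variable (K) in
/-- The inverse `D ↦ D ⋆ 1` of the Poincaré--Birkhoff--Witt map. -/
def symb : UEnv K R L →ₗ[R] 𝒮 := orbit c.flat c.flat_flat 1

lemma symb_one : symb K c (1 : UEnv K R L) = 1 := orbit_one _ _ _

lemma symb_iL_mul (x : L) (D : UEnv K R L) :
    symb K c (iL K R L x * D) = c.flat.nab x (symb K c D) := orbit_iL_mul _ _ _ x D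

/-- The normalization `flat_pow` is exactly the recursion `pbw_pow_succ` transported to the
symmetric algebra. -/
lemma symb_pbw (a : 𝒮) : symb K c (pbw K c a) = a := by
  induction a using rec_induction with
  | add a b ha hb => rw [map_add, map_add, ha, hb]
  | smul r a ha => rw [map_smul, map_smul, ha]
  | one => rw [pbw_one, symb_one]
  | succ n y ih =>
    rw [pbw_pow_succ, map_sub, symb_iL_mul, ih _ (pow_mem y n), ih _ (c.sym_mem y (pow_mem y n)),
      flat_pow, add_sub_cancel_right]

variable (K) in
/-- The failure of `𝓤(L)`-linearity of the Poincaré--Birkhoff--Witt map. -/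
def pbwDefect : L →ₗ[R] 𝒮 →ₗ[R] UEnv K R L :=
  LinearMap.mk₂ R (fun x a => pbw K c (c.flat.nab x a) - iL K R L x * pbw K c a)
    (fun x y a => by
      simp only [map_add, AddMonoidHom.add_apply, add_mul]; abel)
    (fun r x a => by
      simp only [map_smul, AddMonoidHom.smul_apply, ← iR_mul_iL, smul_sub, smul_def, mul_assoc])
    (fun x a b => by simp only [map_add, mul_add]; abel)
    (fun r x a => by
      simp only [c.flat.leibniz, map_add, map_smul, iL_mul_smul, smul_sub]
      abel)

lemma pbwDefect_apply (x : L) (a : 𝒮) :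
    pbwDefect K c x a = pbw K c (c.flat.nab x a) - iL K R L x * pbw K c a := rfl

lemma pbwDefect_pow_self (y : L) (n : ℕ) : pbwDefect K c y (ι R y ^ n) = 0 := by
  rw [pbwDefect_apply, flat_pow, map_add, pbw_pow_succ]
  abel

lemma pbwDefect_eq_zero (n : ℕ) : ∀ a ∈ filt R L n, ∀ x, pbwDefect K c x a = 0 := by
  -- Flatness makes the defect symmetric: δ(z, y yⁿ) = δ(y, z yⁿ). Polarizing δ(y, yⁿ⁺¹) = 0 gives
  -- δ(z, yⁿ⁺¹) + (n + 1) δ(y, z yⁿ) = 0, so (n + 2) δ(z, yⁿ⁺¹) = 0.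
  have step : ∀ n, (∀ a ∈ filt R L n, ∀ x, pbwDefect K c x a = 0) →
      ∀ a ∈ homog R L (n + 1), ∀ x, pbwDefect K c x a = 0 := by
    intro n ih a ha z
    refine eqOn_homog (f := pbwDefect K c z) (g := 0) (fun y => ?_) ha
    have hpow : ι R y ^ n ∈ filt R L n := homog_le_filt le_rfl (pow_mem y n)
    -- The difference of y' ⋆ yⁿ and y' yⁿ has degree at most n, where the defect is already zero.
    have key : ∀ x y', pbw K c (c.flat.nab x (c.flat.nab y' (ι R y ^ n))) =
        iL K R L x * iL K R L y' * pbw K c (ι R y ^ n) +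
          pbwDefect K c x (ι R y' * ι R y ^ n) := by
      intro x y'
      have h1 := ih _ (c.flat_sub_mem y' hpow) x
      rw [map_sub, sub_eq_zero] at h1
      have h2 := ih _ hpow y'
      rw [pbwDefect_apply, sub_eq_zero] at h2
      rw [← h1, pbwDefect_apply, h2, mul_assoc]
      abel
    have h0 := ih _ hpow ⁅z, y⁆
    rw [pbwDefect_apply, sub_eq_zero] at h0
    have hflat := congrArg (pbw K c) (c.flat_flat z y (ι R y ^ n))
    rw [map_add, key, key, h0, iL_mul_iL K z y, add_mul] at hflat
    have hsym : pbwDefect K c z (ι R y * ι R y ^ n) = pbwDefect K c y (ι R z * ι R y ^ n) := by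
      rw [add_right_comm, add_left_inj] at hflat
      simpa [add_assoc, add_comm] using hflat
    have hpol := polarize (pbwDefect K c) n (fun y => pbwDefect_pow_self c y _) z y
    rw [← hsym, ← pow_succ'] at hpol
    refine eq_zero_of_nsmul R (n := n + 1) ?_
    rw [succ_nsmul _ (n + 1), add_comm]
    exact hpol
  induction n with
  | zero =>
    intro a ha x
    refine filt_induction (P := fun a => pbwDefect K c x a = 0) (fun k hk a ha => ?_)
      (fun a b ha hb => by rw [map_add, ha, hb, add_zero]) ha
    obtain rfl : k = 0 := by omega
    refine eqOn_homog (f := pbwDefect K c x) (g := 0) (fun y => ?_) ha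
    simpa using pbwDefect_pow_self c x 0
  | succ n ih =>
    intro a ha x
    refine filt_induction (P := fun a => pbwDefect K c x a = 0) (fun k hk a ha => ?_)
      (fun a b ha hb => by rw [map_add, ha, hb, add_zero]) ha
    rcases Nat.le_succ_iff.1 hk with hk | rfl
    · exact ih a (homog_le_filt hk ha) x
    · exact step n ih a ha x

lemma pbw_flat (x : L) (a : 𝒮) : pbw K c (c.flat.nab x a) = iL K R L x * pbw K c a := by
  obtain ⟨n, hn⟩ := exists_mem_filt a
  exact sub_eq_zero.1 (pbwDefect_eq_zero c n a hn x)

/-- `symb` sends D to D ⋆ 1, and `pbw` is 𝓤(L)-linear and sends 1 to 1. -/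
lemma pbw_symb (D : UEnv K R L) : pbw K c (symb K c D) = D := by
  induction D using UEnv.induction with
  | one => rw [symb_one, pbw_one]
  | add a b ha hb => rw [map_add, map_add, ha, hb]
  | smul r a ha => rw [map_smul, map_smul, ha]
  | mul x a ha => rw [symb_iL_mul, pbw_flat, ha]

variable (K) in
/-- The Poincaré--Birkhoff--Witt isomorphism `Sym L ≃ 𝓤(L)` of a connection on `L`. -/
def pbwEquiv : 𝒮 ≃ₗ[R] UEnv K R L :=
  LinearEquiv.ofLinearMap (pbw K c) (symb K c) (LinearMap.ext (pbw_symb c)) (LinearMap.ext (symb_pbw c))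

/-- With `symb_mem_filt` this matches the order filtration with the degree filtration, which is what
translates continuity conditions on jets into conditions on the symmetric algebra. -/
lemma pbw_mem_filtration {n : ℕ} {a : 𝒮} (ha : a ∈ filt R L n) :
    pbw K c a ∈ filtration K R L n := by
  have key : ∀ n, ∀ a ∈ homog R L n, pbw K c a ∈ filtration K R L n := by
    intro n
    induction n with
    | zero =>
      intro a ha
      refine map_mem_of_pow_mem (pbw K c) _ (fun y => ?_) ha
      rw [pow_zero, pbw_one]
      exact Submodule.subset_span ⟨[], by simp, by simp⟩
    | succ n ih =>
      intro a ha
      refine map_mem_of_pow_mem (pbw K c) _ (fun y => ?_) ha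
      rw [pbw_pow_succ]
      exact sub_mem (iL_mul_mem_filtration y (ih _ (pow_mem y n)))
        (filtration_mono n.le_succ (ih _ (c.sym_mem y (pow_mem y n))))
  exact filt_induction (P := fun a => pbw K c a ∈ filtration K R L n)
    (fun k hk a ha => filtration_mono hk (key k a ha))
    (fun a b ha hb => by rw [map_add]; exact add_mem ha hb) ha

lemma symb_mem_filt {n : ℕ} {D : UEnv K R L} (hD : D ∈ filtration K R L n) :
    symb K c D ∈ filt R L n := by
  induction hD using Submodule.span_induction with
  | mem D hD =>
    obtain ⟨l, hl, rfl⟩ := hD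
    refine filt_mono hl ?_
    clear hl
    induction l with
    | nil => simpa [symb_one] using homog_le_filt le_rfl one_mem
    | cons x l ih =>
      rw [List.map_cons, List.prod_cons, symb_iL_mul]
      exact c.flat_mem x ih
  | zero => simp
  | add a b _ _ ha hb => rw [map_add]; exact add_mem ha hb
  | smul r a _ ha => rw [map_smul]; exact Submodule.smul_mem _ _ ha

section Map

variable {R' L' : Type*} [CommRing R'] [Algebra K R'] [LieRing L'] [Module R' L']
  [LieRingModule L' R'] [LieAlgebra K L'] [LieRinehartRing R' L'] [LieRinehartAlgebra K R' L']
  [Algebra ℚ R'] {σ : R →ₐ[K] R'} (F : LieRinehartAlgebra.Hom σ L L') (c' : LRConn R' L' L')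
  (F' : L →ₛₗ[(σ : R →+* R')] L') (hF' : ∀ x, F' x = F x)
  (hc : ∀ x y, F' (c.nab x y) = c'.nab (F' x) (F' y))

include hF' hc in
-- By `exp_map`: functoriality of 𝓤 intertwines the left multiplications. Hence the isomorphisms
-- over the open sets form one of presheaves.
lemma map_pbw (a : 𝒮) : map F (pbw K c a) = pbw K c' (symMap F' a) := by
  have := exp_map F' (fun x r => (F.apply_lie r x).trans (by rw [hF']; rfl)) c c' hc
    (conn K R L) (conn K R' L') (mapₛₗ F)
    (fun x D => by rw [mapₛₗ_apply, conn_nab, map_mul, map_iL, hF']; rfl) a 1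
  rw [mapₛₗ_apply, map_one] at this
  exact this.symm

end Map

end UEnv

end PBW

end LieAlgd

end

/-! ### Local criteria for associated sheaves; duals of isomorphic coalgebras. -/

noncomputable section

namespace LieAlgd

section Sheafification

variable {X : TopCat.{u}} {R : X.Sheaf CommRingCat.{u}}

namespace ModPresheaf

variable (P : ModPresheaf R)

lemma exists_toSheafify_eq_res {U : Opens X} (s : P.sheafify.obj U) {x : X} (hx : x ∈ U) :
    ∃ (V : Opens X) (hV : V ≤ U), x ∈ V ∧ ∃ t, P.toSheafify V t = P.sheafify.res hV s := by
  let f := CategoryTheory.toSheafify (Opens.grothendieckTopology X) P.ab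
  obtain ⟨V, g, ⟨t, ht⟩, hxV⟩ := Presheaf.imageSieve_mem (Opens.grothendieckTopology X) f
    (U := op U) s x hx
  exact ⟨V, leOfHom g, hxV, t, ht⟩

variable {P} {S : X.Sheaf CommRingCat.{u}} {Q : ModPresheaf S}

lemma IsSheaf.ext_of_locally (hQ : Q.IsSheaf) {U : Opens X} {s t : Q.obj U}
    (H : ∀ x ∈ U, ∃ (V : Opens X) (hV : V ≤ U), x ∈ V ∧ Q.res hV s = Q.res hV t) : s = t := by
  choose V hV hxV h using H
  refine hQ.ext (fun x : U => V x.1 x.2) (fun x => hV x.1 x.2) (fun x hx => ?_)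
    (fun x => h x.1 x.2)
  exact Opens.mem_iSup.2 ⟨⟨x, hx⟩, hxV x hx⟩

/-- Local solutions of a condition that is stable under restriction and has at most one solution
agree on overlaps, hence glue. -/
lemma IsSheaf.exists_glue (hQ : Q.IsSheaf) {U : Opens X} (A : ∀ V : Opens X, V ≤ U → Q.obj V → Prop)
    (hres : ∀ {V W : Opens X} (hV : V ≤ U) (h : W ≤ V) q, A V hV q → A W (h.trans hV) (Q.res h q))
    (huniq : ∀ {V : Opens X} (hV : V ≤ U) q q', A V hV q → A V hV q' → q = q')
    (hloc : ∀ x ∈ U, ∃ (V : Opens X) (hV : V ≤ U), x ∈ V ∧ ∃ q, A V hV q) :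
    ∃ q : Q.obj U, ∀ x ∈ U, ∃ (V : Opens X) (hV : V ≤ U), x ∈ V ∧ A V hV (Q.res hV q) := by
  choose V hV hxV q hq using hloc
  obtain ⟨t, ht, -⟩ := Q.isSheaf_iff.1 hQ (fun x : U => V x.1 x.2) U (fun x => hV x.1 x.2)
    (fun x hx => Opens.mem_iSup.2 ⟨⟨x, hx⟩, hxV x hx⟩) (fun x => q x.1 x.2)
    (fun x y => huniq (inf_le_left.trans (hV x.1 x.2)) _ _ (hres _ _ _ (hq x.1 x.2))
      (hres (hV y.1 y.2) inf_le_right _ (hq y.1 y.2)))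
  refine ⟨t, fun x hx => ⟨V x hx, hV x hx, hxV x hx, ?_⟩⟩
  rw [ht ⟨x, hx⟩]
  exact hq x hx

variable (hQ : Q.IsSheaf) (f : ∀ U, P.obj U →+ Q.obj U)
  (hf : ∀ {U V : Opens X} (h : V ≤ U) (m : P.obj U), f V (P.res h m) = Q.res h (f U m))

lemma sheafifyLift_res {U V : Opens X} (h : V ≤ U) (s : P.sheafify.obj U) :
    P.sheafifyLift Q hQ f hf V (P.sheafify.res h s) =
      Q.res h (P.sheafifyLift Q hQ f hf U s) :=
  ConcreteCategory.congr_hom ((CategoryTheory.sheafifyLift (Opens.grothendieckTopology X)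
    ({ app := fun U => AddCommGrpCat.ofHom (f U.unop)
       naturality := fun U V g => by
        ext m
        exact hf (leOfHom g.unop) m } : P.ab ⟶ Q.ab) hQ).naturality (homOfLE h).op) s

/-- Local injectivity is first upgraded to injectivity on all sections; this uniqueness then allows
local preimages to be glued. -/
lemma sheafifyLift_bijective
    (hinj : ∀ {U : Opens X} (t : P.obj U), f U t = 0 → ∀ x ∈ U,
      ∃ (V : Opens X) (hV : V ≤ U), x ∈ V ∧ P.res hV t = 0)
    (hsurj : ∀ {U : Opens X} (q : Q.obj U), ∀ x ∈ U,
      ∃ (V : Opens X) (hV : V ≤ U), x ∈ V ∧ ∃ t, f V t = Q.res hV q)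
    (U : Opens X) : Function.Bijective (P.sheafifyLift Q hQ f hf U) := by
  have inj : ∀ U, Function.Injective (P.sheafifyLift Q hQ f hf U) := fun U => by
    rw [injective_iff_map_eq_zero]
    intro s hs
    refine P.isSheaf_sheafify.ext_of_locally fun x hx => ?_
    obtain ⟨V, hV, hxV, t, ht⟩ := P.exists_toSheafify_eq_res s hx
    have h0 : f V t = 0 := by
      rw [← P.sheafifyLift_toSheafify Q hQ f hf V t, ht, sheafifyLift_res, hs, map_zero]
    obtain ⟨W, hW, hxW, h⟩ := hinj t h0 x hxV
    refine ⟨W, hW.trans hV, hxW, ?_⟩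
    rw [map_zero, ← P.sheafify.res_res hV hW, ← ht, ← toSheafify_res, h, map_zero]
  refine ⟨inj U, fun q => ?_⟩
  obtain ⟨s, hs⟩ := P.isSheaf_sheafify.exists_glue (U := U)
    (fun V hV s => P.sheafifyLift Q hQ f hf V s = Q.res hV q)
    (fun hV h s hs => by rw [sheafifyLift_res, hs, Q.res_res])
    (fun hV s s' hs hs' => inj _ (hs.trans hs'.symm))
    (fun x hx => by
      obtain ⟨V, hV, hxV, t, ht⟩ := hsurj q x hx
      exact ⟨V, hV, hxV, P.toSheafify V t, by rw [sheafifyLift_toSheafify, ht]⟩)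
  refine ⟨s, hQ.ext_of_locally fun x hx => ?_⟩
  obtain ⟨V, hV, hxV, h⟩ := hs x hx
  exact ⟨V, hV, hxV, by rw [← h, sheafifyLift_res]⟩

end ModPresheaf

end Sheafification

section Dual

variable {X : TopCat.{u}} {R : X.Sheaf CommRingCat.{u}} {C D : CoalgPresheaf R}

namespace CoalgPresheaf

/-- An isomorphism of presheaves of coalgebras. -/
structure Iso (C D : CoalgPresheaf R) where
  equiv : ∀ U, C.obj U ≃ₗ[Sec R U] D.obj U
  counit_equiv : ∀ {U : Opens X} (a : C.obj U),
    Coalgebra.counit (R := Sec R U) (equiv U a) = Coalgebra.counit (R := Sec R U) a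
  comul_equiv : ∀ {U : Opens X} (a : C.obj U), Coalgebra.comul (R := Sec R U) (equiv U a) =
    TensorProduct.map (equiv U).toLinearMap (equiv U).toLinearMap
      (Coalgebra.comul (R := Sec R U) a)
  equiv_res : ∀ {U V : Opens X} (h : V ≤ U) (a : C.obj U),
    equiv V (C.res h a) = D.res h (equiv U a)

namespace Iso

variable (e : Iso C D)

/-- The isomorphism of rings of sections of the duals. -/
def dualEquiv (U : Opens X) : DualSec D U ≃+* DualSec C U where
  toFun φ := ⟨fun V => WithConv.toConv ((φ.app V.2) ∘ₗ (e.equiv V.1).toLinearMap), fun V W h a => by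
    change φ.app W.2 (e.equiv W.1 (C.res h a)) = res R h (φ.app V.2 (e.equiv V.1 a))
    rw [e.equiv_res]
    exact φ.app_res V.2 h _⟩
  invFun φ := ⟨fun V => WithConv.toConv ((φ.app V.2) ∘ₗ (e.equiv V.1).symm.toLinearMap),
    fun V W h a => by
      change φ.app W.2 ((e.equiv W.1).symm (D.res h a)) =
        res R h (φ.app V.2 ((e.equiv V.1).symm a))
      have h1 : (e.equiv W.1).symm (D.res h a) = C.res h ((e.equiv V.1).symm a) := by
        rw [LinearEquiv.symm_apply_eq, e.equiv_res, LinearEquiv.apply_symm_apply]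
      rw [h1]
      exact φ.app_res V.2 h _⟩
  left_inv φ := DualSec.ext fun V h a => congrArg (φ.app h) ((e.equiv V).apply_symm_apply a)
  right_inv φ := DualSec.ext fun V h a => congrArg (φ.app h) ((e.equiv V).symm_apply_apply a)
  map_add' φ ψ := rfl
  map_mul' φ ψ := DualSec.ext fun V h a => by
    change LinearMap.mul' (Sec R V) (Sec R V) (TensorProduct.map (φ.app h) (ψ.app h)
      (Coalgebra.comul (R := Sec R V) (e.equiv V a))) =
      LinearMap.mul' (Sec R V) (Sec R V) (TensorProduct.map
        (φ.app h ∘ₗ (e.equiv V).toLinearMap) (ψ.app h ∘ₗ (e.equiv V).toLinearMap)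
        (Coalgebra.comul (R := Sec R V) a))
    rw [e.comul_equiv, TensorProduct.map_comp]
    rfl

/-- The isomorphism of sheaves of rings dual to an isomorphism of presheaves of coalgebras. -/
def dualIso : D.dual ≅ C.dual where
  hom := mkHom (R := D.dual) (S := C.dual) (fun U => (e.dualEquiv U).toRingHom) (fun _ _ => rfl)
  inv := mkHom (R := C.dual) (S := D.dual) (fun U => (e.dualEquiv U).symm.toRingHom)
    (fun _ _ => rfl)
  hom_inv_id := by
    refine ObjectProperty.hom_ext _ (NatTrans.ext (funext fun U => CommRingCat.hom_ext
      (RingHom.ext fun φ => ?_)))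
    exact (e.dualEquiv U.unop).symm_apply_apply φ
  inv_hom_id := by
    refine ObjectProperty.hom_ext _ (NatTrans.ext (funext fun U => CommRingCat.hom_ext
      (RingHom.ext fun φ => ?_)))
    exact (e.dualEquiv U.unop).apply_symm_apply φ

end Iso

end CoalgPresheaf

end Dual

end LieAlgd

end

/-! ### Jets and the isomorphism j_L. -/

noncomputable section

namespace LieAlgd

open LRConn

variable {K : Type u} [Field K] [CharZero K] {S : RingedSpaceOver K}

/-- Through this structure the characteristic 0 hypothesis on K makes polarization available on
sections. -/
instance ratAlgebra (U : Opens S.X) : Algebra ℚ (Sec S.O U) :=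
  ((algebraMap K (Sec S.O U)).comp (algebraMap ℚ K)).toAlgebra

namespace LieAlgebroid

variable (L : LieAlgebroid S)

/-- The connection on the sections over `U` given by a connection on sheaves. -/
def _root_.LieAlgd.Connection.lr {L : LieAlgebroid S} {M : ModPresheaf S.O} (d : Connection L M)
    (U : Opens S.X) : LRConn (LieAlgd.Sec S.O U) (L.Sec U) (M.obj U) where
  nab :=
    { toFun := fun x => (d.nab U x).toAddMonoidHom
      map_add' := fun x y => by rw [map_add]; rfl
      map_smul' := fun r x => by rw [map_smul]; rfl }
  leibniz x r m := d.leibniz x r m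

variable {L} (dL : Connection L L.mod)

/-- The connection on the Lie--Rinehart algebra of sections over `U`. -/
def lrL (U : Opens S.X) : LRConn (LieAlgd.Sec S.O U) (L.Sec U) (L.Sec U) := dL.lr U

variable (L) in
/-- Restriction of sections of `L` as a semilinear map. -/
def resₛₗ {U V : Opens S.X} (h : V ≤ U) : L.Sec U →ₛₗ[LieAlgd.res S.O h] L.Sec V := L.mod.res h

lemma lrL_res {U V : Opens S.X} (h : V ≤ U) (x y : L.Sec U) :
    L.resₛₗ h ((lrL dL U).nab x y) = (lrL dL V).nab (L.resₛₗ h x) (L.resₛₗ h y) :=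
  dL.res_nab h x y

lemma resₛₗ_anchor {U V : Opens S.X} (h : V ≤ U) (x : L.Sec U) (r : LieAlgd.Sec S.O U) :
    LieAlgd.res S.O h ⁅x, r⁆ = ⁅L.resₛₗ h x, LieAlgd.res S.O h r⁆ := L.res_anchor h x r

/-- The Poincaré--Birkhoff--Witt isomorphism of presheaves of coalgebras. -/
def pbwIso : CoalgPresheaf.Iso (symCoalg L.mod) L.univ where
  equiv U := UEnv.pbwEquiv K (lrL dL U)
  counit_equiv {U} a := UEnv.counit_pbw (lrL dL U) a
  comul_equiv {U} a := UEnv.comul_pbw (lrL dL U) a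
  equiv_res {U V} h a := (UEnv.map_pbw (lrL dL U) (L.resHom h) (lrL dL V) (L.resₛₗ h)
    (fun _ => rfl) (lrL_res dL h) a).symm

/-- The connection `∇⁽²⁾` on the jets over `U`, as a module through `α₂`. -/
def lrJets (U : Opens S.X) : LRConn (LieAlgd.Sec S.O U) (L.Sec U) (AlgVia L.α₂ U) where
  nab :=
    { toFun := fun x => L.nabla₂ x
      map_add' := fun x y => by
        ext φ
        refine L.jet_ext fun V h D => ?_
        change L.jetApp φ h (D * UEnv.iL K _ _ (L.res h (x + y))) =
          L.jetApp φ h (D * UEnv.iL K _ _ (L.res h x)) +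
            L.jetApp φ h (D * UEnv.iL K _ _ (L.res h y))
        rw [← map_add, ← mul_add, ← map_add]
        exact congrArg (fun z => L.jetApp φ h (D * UEnv.iL K _ _ z)) (map_add (L.resₛₗ h) x y)
      map_smul' := fun r x => by
        ext φ
        refine L.jet_ext fun V h D => ?_
        change L.jetApp φ h (D * UEnv.iL K _ _ (L.res h (r • x))) =
          L.jetApp (L.α₂Fun U r * L.nabla₂ x φ) h D
        rw [jetApp_α₂Fun_mul]
        change _ = L.jetApp φ h (D * UEnv.iR K _ (L.Sec V) _ * UEnv.iL K _ _ (L.res h x))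
        rw [mul_assoc, UEnv.iR_mul_iL]
        exact congrArg (fun z => L.jetApp φ h (D * UEnv.iL K _ _ z))
          (LinearMap.map_smulₛₗ (L.resₛₗ h) r x) }
  leibniz x r φ := L.nabla₂_leibniz x r φ

/-- The map `D ↦ φ(- D)`. -/
def jetOrbit {U : Opens S.X} (φ : LieAlgd.Sec L.jets U) :
    UEnv K (LieAlgd.Sec S.O U) (L.Sec U) →ₗ[LieAlgd.Sec S.O U] AlgVia L.α₂ U where
  toFun D := L.jetRmul (fun _ h => UEnv.map (L.resHom h) D)
    (fun h h' => L.univ.res_res h h' D) φ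
  map_add' D E := L.jet_ext fun V h F => by
    change L.jetApp φ h (F * UEnv.map (L.resHom h) (D + E)) =
      L.jetApp φ h (F * UEnv.map (L.resHom h) D) + L.jetApp φ h (F * UEnv.map (L.resHom h) E)
    rw [map_add, mul_add, map_add]
  map_smul' r D := L.jet_ext fun V h F => by
    refine Eq.trans ?_ (L.jetApp_α₂Fun_mul r _ h F).symm
    change L.jetApp φ h (F * UEnv.map (L.resHom h) (r • D)) =
      L.jetApp φ h (F * UEnv.iR K _ _ _ * UEnv.map (L.resHom h) D)
    rw [UEnv.map_smul', mul_assoc]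
    rfl

lemma jetApp_jetOrbit {U V : Opens S.X} (φ : LieAlgd.Sec L.jets U)
    (D : UEnv K (LieAlgd.Sec S.O U) (L.Sec U)) (h : V ≤ U)
    (F : UEnv K (LieAlgd.Sec S.O V) (L.Sec V)) :
    L.jetApp (jetOrbit φ D) h F = L.jetApp φ h (F * UEnv.map (L.resHom h) D) := rfl

/-- D ↦ φ(- D) intertwines left multiplication on 𝓤(L) with ∇⁽²⁾, where jets are modules through α₂;
so the exponential on jets is read off from `pbw`. -/
lemma jetApp_exp_lrJets {U V : Opens S.X} (φ : LieAlgd.Sec L.jets U) (h : V ≤ U)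
    (a : SymmetricAlgebra (LieAlgd.Sec S.O U) (L.Sec U))
    (F : UEnv K (LieAlgd.Sec S.O V) (L.Sec V)) :
    L.jetApp (exp (lrL dL U) (lrJets U) a φ) h F =
      L.jetApp φ h (F * UEnv.map (L.resHom h) (UEnv.pbw K (lrL dL U) a)) := by
  have key := exp_apply_linearMap (lrL dL U) (UEnv.conn K _ (L.Sec U)) (lrJets U) (jetOrbit φ)
    (fun x D => L.jet_ext fun V h F => by
      refine (jetApp_jetOrbit φ _ h F).trans ?_
      change _ = L.jetApp φ h (F * UEnv.iL K _ _ (L.res h x) * UEnv.map (L.resHom h) D)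
      rw [UEnv.conn_nab, map_mul (UEnv.map (L.resHom h)), UEnv.map_iL, mul_assoc]
      rfl) a 1
  have h1 : jetOrbit φ 1 = φ := L.jet_ext fun V h F => by
    refine (jetApp_jetOrbit φ _ h F).trans ?_
    rw [map_one, mul_one]
  rw [h1] at key
  rw [key]
  rfl

lemma jetApp_exp_one {U : Opens S.X} (φ : LieAlgd.Sec L.jets U)
    (a : SymmetricAlgebra (LieAlgd.Sec S.O U) (L.Sec U)) :
    L.jetApp (exp (lrL dL U) (lrJets U) a φ) le_rfl 1 =
      L.jetApp φ le_rfl (UEnv.pbw K (lrL dL U) a) := by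
  rw [jetApp_exp_lrJets, one_mul]
  exact congrArg (L.jetApp φ le_rfl) (L.univ.res_self le_rfl _)

/-- The isomorphism `𝓙(L) ≅ Sym^(L^∨)` of sheaves of rings dual to the Poincaré--Birkhoff--Witt
isomorphism. -/
def jIso : L.jets ≅ L.symHat := (pbwIso dL).dualIso

lemma symHatApp_jIso_prod {U : Opens S.X} (φ : LieAlgd.Sec L.jets U) (n : ℕ)
    (x : Fin n → L.Sec U) :
    L.symHatApp (homApp (jIso dL).hom U φ) le_rfl
        (List.ofFn fun i => SymmetricAlgebra.ι (LieAlgd.Sec S.O U) (L.mod.obj U) (x i)).prod =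
      ((n.factorial : K)⁻¹) •
        L.jetApp (symDpow (L.nabL dL U) (fun y => L.nabla₂ y) n φ x) le_rfl 1 := by
  have h := symDpow_eq (lrL dL U) (lrJets U) n φ x
  have h' : symDpow (L.nabL dL U) (fun y => L.nabla₂ y) n φ x =
      n.factorial • exp (lrL dL U) (lrJets U) (∏ i, Sym.ι _ (x i)) φ := h
  have hsmul : ∀ ψ : LieAlgd.Sec L.jets U, L.jetApp (n.factorial • ψ) le_rfl 1 =
      n.factorial • L.jetApp ψ le_rfl 1 := fun ψ =>
    map_nsmul (AddMonoidHom.mk' (fun ψ : LieAlgd.Sec L.jets U => L.jetApp ψ le_rfl 1)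
      fun _ _ => rfl) _ _
  rw [h', List.prod_ofFn]
  change L.jetApp φ le_rfl (UEnv.pbw K (lrL dL U) (∏ i, Sym.ι _ (x i))) = _
  refine Eq.trans ?_ (congrArg _ (hsmul _).symm)
  rw [jetApp_exp_one, ← Nat.cast_smul_eq_nsmul K, inv_smul_smul₀ (Nat.cast_ne_zero.2 n.factorial_ne_zero)]

lemma jIso_α₁ (U : Opens S.X) (f : LieAlgd.Sec S.O U) :
    homApp (jIso dL).hom U (homApp L.α₁ U f) = homApp L.symHatUnit U f :=
  CoalgPresheaf.DualSec.ext (C := symCoalg L.mod) fun V h a => by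
    change LieAlgd.res S.O h f * UEnv.counit (UEnv.pbw K (lrL dL V) a) =
      LieAlgd.res S.O h f * Coalgebra.counit (R := LieAlgd.Sec S.O V) a
    exact congrArg _ (UEnv.counit_pbw (lrL dL V) a)

end LieAlgebroid

end LieAlgd

end

/-! ### Convolution action of the dual of a coalgebra on maps out of it. -/

noncomputable section

namespace LieAlgd

section ConvAct

variable {R C Q : Type*} [CommRing R] [AddCommGroup C] [Module R C] [Coalgebra R C]
  [AddCommGroup Q] [Module R Q]

/-- The action `(ψ f)(a) = ψ(a₍₁₎) f(a₍₂₎)` of the dual of a coalgebra. -/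
def convAct (ψ : C →ₗ[R] R) (f : C →ₗ[R] Q) : C →ₗ[R] Q :=
  (TensorProduct.lid R Q).toLinearMap ∘ₗ TensorProduct.map ψ f ∘ₗ Coalgebra.comul

lemma convAct_apply (ψ : C →ₗ[R] R) (f : C →ₗ[R] Q) (a : C) : convAct ψ f a =
    TensorProduct.lid R Q (TensorProduct.map ψ f (Coalgebra.comul (R := R) a)) := rfl

lemma convAct_counit (f : C →ₗ[R] Q) : convAct Coalgebra.counit f = f := by
  ext a
  have h : TensorProduct.map (Coalgebra.counit (R := R) (A := C)) f =
      TensorProduct.map LinearMap.id f ∘ₗ (Coalgebra.counit (R := R) (A := C)).rTensor C := by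
    ext; simp
  rw [convAct_apply, h, LinearMap.comp_apply, Coalgebra.rTensor_counit_comul]
  simp

lemma convAct_smulRight (ψ : C →ₗ[R] R) (q : Q) :
    convAct ψ ((Coalgebra.counit (R := R) (A := C)).smulRight q) = ψ.smulRight q := by
  ext a
  have h : TensorProduct.map ψ ((Coalgebra.counit (R := R) (A := C)).smulRight q) =
      TensorProduct.map ψ (LinearMap.toSpanSingleton R Q q) ∘ₗ
        (Coalgebra.counit (R := R) (A := C)).lTensor C := by
    ext; simp
  rw [convAct_apply, h, LinearMap.comp_apply, Coalgebra.lTensor_counit_comul]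
  simp

/-- This is coassociativity: both sides are a single map on the triple tensor product applied to the
iterated coproduct. -/
lemma convAct_convAct (ψ χ : C →ₗ[R] R) (f : C →ₗ[R] Q) : convAct ψ (convAct χ f) =
    convAct (LinearMap.mul' R R ∘ₗ TensorProduct.map ψ χ ∘ₗ Coalgebra.comul) f := by
  ext a
  let G : C ⊗[R] (C ⊗[R] C) →ₗ[R] Q := (TensorProduct.lid R Q).toLinearMap ∘ₗ
    TensorProduct.map ψ ((TensorProduct.lid R Q).toLinearMap ∘ₗ TensorProduct.map χ f)
  have h1 : (TensorProduct.lid R Q).toLinearMap ∘ₗ TensorProduct.map ψ (convAct χ f) =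
      G ∘ₗ (Coalgebra.comul (R := R) (A := C)).lTensor C := by
    ext; rfl
  have h2 : (TensorProduct.lid R Q).toLinearMap ∘ₗ
      TensorProduct.map (LinearMap.mul' R R ∘ₗ TensorProduct.map ψ χ) f =
      G ∘ₗ (TensorProduct.assoc R C C C).toLinearMap := by
    ext x y z
    simp only [G, TensorProduct.AlgebraTensorModule.curry_apply, TensorProduct.curry_apply,
      LinearMap.restrictScalars_self, LinearMap.comp_apply, LinearEquiv.coe_coe,
      TensorProduct.map_tmul, TensorProduct.assoc_tmul, TensorProduct.lid_tmul,
      LinearMap.mul'_apply, mul_smul]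
  have h3 : (TensorProduct.lid R Q).toLinearMap ∘ₗ TensorProduct.map
      (LinearMap.mul' R R ∘ₗ TensorProduct.map ψ χ ∘ₗ Coalgebra.comul) f =
      G ∘ₗ (TensorProduct.assoc R C C C).toLinearMap ∘ₗ
        (Coalgebra.comul (R := R) (A := C)).rTensor C := by
    rw [← LinearMap.comp_assoc _ _ G, ← h2]
    ext; rfl
  have h4 := DFunLike.congr_fun h1 (Coalgebra.comul (R := R) a)
  have h5 := DFunLike.congr_fun h3 (Coalgebra.comul (R := R) a)
  have h6 := Coalgebra.coassoc_apply (R := R) a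
  simp only [LinearMap.comp_apply, LinearEquiv.coe_coe] at h4 h5
  rw [convAct_apply, convAct_apply, h4, h5, h6]

lemma convAct_add (ψ : C →ₗ[R] R) (f g : C →ₗ[R] Q) :
    convAct ψ (f + g) = convAct ψ f + convAct ψ g := by
  simp only [convAct, TensorProduct.map_add_right, LinearMap.add_comp, LinearMap.comp_add]

lemma add_convAct (ψ χ : C →ₗ[R] R) (f : C →ₗ[R] Q) :
    convAct (ψ + χ) f = convAct ψ f + convAct χ f := by
  simp only [convAct, TensorProduct.map_add_left, LinearMap.add_comp, LinearMap.comp_add]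

variable {R' C' Q' : Type*} [CommRing R'] [AddCommGroup C'] [Module R' C'] [Coalgebra R' C']
  [AddCommGroup Q'] [Module R' Q'] {σ : R →+* R'}

lemma convAct_map (F : C →ₛₗ[σ] C') (G : Q →ₛₗ[σ] Q') {ψ : C →ₗ[R] R} {ψ' : C' →ₗ[R'] R'}
    {f : C →ₗ[R] Q} {f' : C' →ₗ[R'] Q'} (hψ : ∀ a, ψ' (F a) = σ (ψ a))
    (hf : ∀ a, f' (F a) = G (f a)) {a : C}
    (ha : Coalgebra.comul (R := R') (F a) = TensorProduct.map F F (Coalgebra.comul (R := R) a)) :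
    convAct ψ' f' (F a) = G (convAct ψ f a) := by
  rw [convAct_apply, convAct_apply, ha]
  generalize Coalgebra.comul (R := R) a = t
  induction t with
  | zero => simp
  | add s t hs ht => simp only [map_add, hs, ht]
  | tmul x y => simp only [TensorProduct.map_tmul, TensorProduct.lid_tmul, hψ, hf,
      LinearMap.map_smulₛₗ]

end ConvAct

section DualAct

variable {X : TopCat.{u}} {R : X.Sheaf CommRingCat.{u}} {C : CoalgPresheaf R} {Q : ModPresheaf R}

namespace CoalgPresheaf

open ModPresheaf

/-- For C = Sym L and Q = E, this internal Hom is the common target in which 𝓙(L;E) and Sym^(L^∨) ⊗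
E are compared. -/
instance (U : Opens X) : SMul (Sec C.dual U) (HomSec C.toModPresheaf Q U) where
  smul ψ f := ⟨fun V => convAct (DualSec.app (C := C) ψ V.2) (f.app V.2), fun V _ h a =>
    convAct_map (C.res h) (Q.res h) (fun a => DualSec.app_res (C := C) ψ V.2 h a)
      (fun a => f.app_res V.2 h a) (C.comul_res h a)⟩

instance (U : Opens X) : Module (Sec C.dual U) (HomSec C.toModPresheaf Q U) where
  one_smul f := HomSec.ext fun V h a => DFunLike.congr_fun (convAct_counit (f.app h)) a
  mul_smul ψ χ f := HomSec.ext fun V h a => DFunLike.congr_fun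
    (convAct_convAct (DualSec.app (C := C) ψ h) (DualSec.app (C := C) χ h) (f.app h)).symm a
  smul_zero ψ := HomSec.ext fun V h a => by
    change convAct (DualSec.app (C := C) ψ h) (0 : C.obj V →ₗ[Sec R V] Q.obj V) a = 0
    simp [convAct]
  smul_add ψ f g := HomSec.ext fun V h a => DFunLike.congr_fun (convAct_add _ _ _) a
  add_smul ψ χ f := HomSec.ext fun V h a => DFunLike.congr_fun (add_convAct _ _ _) a
  zero_smul f := HomSec.ext fun V h a => by
    change convAct (0 : C.obj V →ₗ[Sec R V] Sec R V) (f.app h) a = 0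
    simp [convAct]

/-- The constant map `a ↦ ε(a) q`. -/
def constHom (U : Opens X) : Q.obj U →+ HomSec C.toModPresheaf Q U where
  toFun q := ⟨fun V => (Coalgebra.counit (R := Sec R V.1)).smulRight (Q.res V.2 q), fun _ _ h a => by
    simp only [LinearMap.smulRight_apply, C.counit_res, LinearMap.map_smulₛₗ, Q.res_res]⟩
  map_zero' := HomSec.ext fun V h a => by
    change Coalgebra.counit (R := Sec R V) a • Q.res h 0 = 0
    rw [map_zero, smul_zero]
  map_add' q q' := HomSec.ext fun V h a => by
    change Coalgebra.counit (R := Sec R V) a • Q.res h (q + q') =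
      Coalgebra.counit (R := Sec R V) a • Q.res h q + Coalgebra.counit (R := Sec R V) a • Q.res h q'
    rw [map_add, smul_add]

lemma smul_constHom_app {U V : Opens X} (ψ : Sec C.dual U) (q : Q.obj U) (h : V ≤ U)
    (a : C.obj V) : (ψ • constHom U q : HomSec C.toModPresheaf Q U).app h a =
      DualSec.app (C := C) ψ h a • Q.res h q :=
  DFunLike.congr_fun (convAct_smulRight (DualSec.app (C := C) ψ h) (Q.res h q)) a

lemma constHom_res {U V : Opens X} (h : V ≤ U) (q : Q.obj U) :
    (constHom V (Q.res h q) : HomSec C.toModPresheaf Q V) = (constHom U q).res h :=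
  HomSec.ext fun W h' a => by
    change Coalgebra.counit (R := Sec R W) a • Q.res h' (Q.res h q) =
      Coalgebra.counit (R := Sec R W) a • Q.res (h'.trans h) q
    rw [Q.res_res]

end CoalgPresheaf

end DualAct

end LieAlgd

end

/-! ### Units of the completed symmetric algebra. -/

noncomputable section

namespace LieAlgd

open LieAlgd.Sym

lemma Sym.comul_pow {R M : Type*} [CommRing R] [AddCommGroup M] [Module R M] (y : M) (n : ℕ) :
    Coalgebra.comul (R := R) (ι R y ^ n) =
      ∑ k ∈ Finset.range (n + 1), n.choose k • ((ι R y ^ k) ⊗ₜ[R] (ι R y ^ (n - k))) := by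
  rw [Bialgebra.comul_pow, SymmetricAlgebra.comul_ι, (Commute.all _ _).add_pow]
  refine Finset.sum_congr rfl fun k _ => ?_
  rw [Algebra.TensorProduct.tmul_pow, Algebra.TensorProduct.tmul_pow,
    Algebra.TensorProduct.tmul_mul_tmul, one_pow, one_pow, one_mul, mul_one, nsmul_eq_mul, mul_comm]

section Unit

variable {K : Type u} [Field K] [CharZero K] {S : RingedSpaceOver K} {M : ModPresheaf S.O}
  {U : Opens S.X}

open CoalgPresheaf

namespace SymHat

/-- The component over `V` of a section of the dual of the symmetric algebra. -/
def app (ψ : DualSec (symCoalg M) U) {V : Opens S.X} (h : V ≤ U) :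
    SymmetricAlgebra (Sec S.O V) (M.obj V) →ₗ[Sec S.O V] Sec S.O V :=
  DualSec.app ψ h

lemma app_res (ψ : DualSec (symCoalg M) U) {V W : Opens S.X} (h : V ≤ U) (h' : W ≤ V)
    (a : SymmetricAlgebra (Sec S.O V) (M.obj V)) :
    app ψ (h'.trans h) (symMap (M.res h') a) = res S.O h' (app ψ h a) := DualSec.app_res ψ h h' a

lemma sum_app (f : ℕ → DualSec (symCoalg M) U) (s : Finset ℕ) {V : Opens S.X} (h : V ≤ U)
    (a : SymmetricAlgebra (Sec S.O V) (M.obj V)) : app (∑ i ∈ s, f i) h a = ∑ i ∈ s, app (f i) h a :=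
  map_sum (AddMonoidHom.mk' (fun ψ : DualSec (symCoalg M) U => app ψ h a) fun _ _ => rfl) f s

lemma mul_app_pow (ψ χ : DualSec (symCoalg M) U) {V : Opens S.X} (h : V ≤ U) (y : M.obj V)
    (n : ℕ) : app (ψ * χ) h (ι _ y ^ n) = ∑ k ∈ Finset.range (n + 1),
      n.choose k • (app ψ h (ι _ y ^ k) * app χ h (ι _ y ^ (n - k))) := by
  change LinearMap.mul' _ _ (TensorProduct.map (app ψ h) (app χ h)
    (Coalgebra.comul (R := Sec S.O V) (A := SymmetricAlgebra (Sec S.O V) (M.obj V))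
      (ι (Sec S.O V) y ^ n))) = _
  rw [comul_pow, map_sum, map_sum]
  refine Finset.sum_congr rfl fun k _ => ?_
  rw [map_nsmul, map_nsmul, TensorProduct.map_tmul, LinearMap.mul'_apply]

/-- Each factor of ηᵏ consumes at least one of the n available factors y. Thus in each degree the
geometric series is a finite sum. -/
lemma pow_app_pow_of_lt {η : DualSec (symCoalg M) U}
    (hη : ∀ (V : Opens S.X) (h : V ≤ U), app η h 1 = 0)
    {V : Opens S.X} (h : V ≤ U) (y : M.obj V) (k n : ℕ) (hn : n < k) :
    app (η ^ k) h (ι _ y ^ n) = 0 := by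
  induction k generalizing n with
  | zero => omega
  | succ k ih =>
    rw [pow_succ', mul_app_pow]
    refine Finset.sum_eq_zero fun i hi => ?_
    have hi := Finset.mem_range.1 hi
    rcases Nat.eq_zero_or_pos i with rfl | hi0
    · rw [pow_zero, hη, zero_mul, smul_zero]
    · rw [ih (n - i) (by omega), mul_zero, smul_zero]

/-- The geometric series of a section that vanishes at `1`. -/
def geom (η : DualSec (symCoalg M) U) : DualSec (symCoalg M) U :=
  ⟨fun V => WithConv.toConv (glue fun n => ∑ i ∈ Finset.range (n + 1), app (η ^ i) V.2),
    fun V W h a => by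
      change glue (fun n => ∑ i ∈ Finset.range (n + 1), app (η ^ i) W.2) (symMap (M.res h) a) =
        res S.O h (glue (fun n => ∑ i ∈ Finset.range (n + 1), app (η ^ i) V.2) a)
      have hp : ∀ (n : ℕ) (y : M.obj V.1),
          glue (fun n => ∑ i ∈ Finset.range (n + 1), app (η ^ i) W.2)
            (symMap (M.res h) (ι _ y ^ n)) = res S.O h
              (glue (fun n => ∑ i ∈ Finset.range (n + 1), app (η ^ i) V.2) (ι _ y ^ n)) := by
        intro n y
        have h1 : symMap (M.res h) (ι (Sec S.O V.1) y ^ n) = ι _ (M.res h y) ^ n := by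
          rw [map_pow, symMap_ι]
        rw [h1, glue_of_mem _ (pow_mem _ n), glue_of_mem _ (pow_mem _ n), LinearMap.sum_apply,
          LinearMap.sum_apply, map_sum]
        refine Finset.sum_congr rfl fun i _ => ?_
        rw [← h1]
        exact app_res (η ^ i) V.2 h _
      induction a using rec_induction with
      | add a b ha hb => simp only [map_add, ha, hb]
      | smul r a ha => simp only [symMap_smul, map_smul, smul_eq_mul, map_mul, ha]
      | one => simpa using hp 0 0
      | succ n y _ => exact hp (n + 1) y⟩

lemma geom_app_pow (η : DualSec (symCoalg M) U) {V : Opens S.X} (h : V ≤ U) (y : M.obj V) (n : ℕ) :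
    app (geom η) h (ι _ y ^ n) = ∑ i ∈ Finset.range (n + 1), app (η ^ i) h (ι _ y ^ n) := by
  change glue (fun n => ∑ i ∈ Finset.range (n + 1), app (η ^ i) h) (ι _ y ^ n) = _
  rw [glue_of_mem _ (pow_mem _ n), LinearMap.sum_apply]

/-- Write ψ = 1 - η with η vanishing at 1 and invert by the geometric series. -/
lemma isUnit_of_app_one {ψ : DualSec (symCoalg M) U} (hψ : app ψ le_rfl 1 = 1) : IsUnit ψ := by
  obtain ⟨η, rfl⟩ : ∃ η, ψ = 1 - η := ⟨1 - ψ, (sub_sub_cancel 1 ψ).symm⟩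
  have one_sub : ∀ {V : Opens S.X} (h : V ≤ U) (χ : DualSec (symCoalg M) U) a,
      app (1 - χ) h a = app 1 h a - app χ h a := fun _ _ _ => rfl
  have one_app : ∀ {V : Opens S.X} (h : V ≤ U), app (1 : DualSec (symCoalg M) U) h 1 = 1 :=
    fun {V} _ => Bialgebra.counit_one (R := Sec S.O V) (A := SymmetricAlgebra _ (M.obj V))
  have hη : ∀ (V : Opens S.X) (h : V ≤ U), app η h 1 = 0 := by
    intro V h
    have h1 := app_res (1 - η) le_rfl h 1
    rwa [map_one (symMap (M.res h)), hψ, map_one (res S.O h), one_sub, one_app, sub_eq_self] at h1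
  refine IsUnit.of_mul_eq_one (geom η) (DualSec.ext fun V h => DFunLike.congr_fun
    (linearMap_ext (f := app ((1 - η) * geom η) h) (g := app 1 h) fun n y => ?_))
  -- In degree n the series may be cut off after ηⁿ, uniformly in k, because the added powers vanish
  -- in degree n - k. The finite geometric sum then leaves 1 - ηⁿ⁺¹.
  have h1 : app ((1 - η) * geom η) h (ι _ y ^ n) =
      app ((1 - η) * ∑ i ∈ Finset.range (n + 1), η ^ i) h (ι _ y ^ n) := by
    rw [mul_app_pow, mul_app_pow]
    refine Finset.sum_congr rfl fun k hk => ?_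
    rw [geom_app_pow, sum_app]
    congr 2
    refine Finset.sum_subset (Finset.range_mono (by omega)) fun i _ hi => ?_
    exact pow_app_pow_of_lt hη h y i _ (by simpa using hi)
  rw [h1, mul_comm, geom_sum_mul_neg, one_sub,
    pow_app_pow_of_lt hη h y (n + 1) n (Nat.lt_succ_self n), sub_zero]

end SymHat

end Unit

end LieAlgd

end

/-! ### Frames and bases of modules of maps. -/

noncomputable section

namespace LieAlgd

section Algebra

variable {m : ℕ} {D H : Type*} [CommRing D] [AddCommGroup H] [Module D H]

lemma bijective_sum_smul_of_isUnit_det {β τ : Fin m → H} (Θ : Matrix (Fin m) (Fin m) D)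
    (hΘ : IsUnit Θ.det) (hτ : ∀ p, τ p = ∑ q, Θ p q • β q)
    (hβ : Function.Bijective fun c : Fin m → D => ∑ p, c p • β p) :
    Function.Bijective fun c : Fin m → D => ∑ p, c p • τ p := by
  have hΘ' : IsUnit Θ := (Matrix.isUnit_iff_isUnit_det Θ).2 hΘ
  have h : (fun c : Fin m → D => ∑ p, c p • τ p) =
      (fun c : Fin m → D => ∑ p, c p • β p) ∘ fun c => Matrix.vecMul c Θ := by
    funext c
    simp only [hτ, Function.comp, Matrix.vecMul, dotProduct, Finset.sum_smul, Finset.smul_sum,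
      mul_smul]
    exact Finset.sum_comm
  rw [h]
  exact hβ.comp ⟨Matrix.vecMul_injective_of_isUnit hΘ', Matrix.vecMul_surjective_iff_isUnit.2 hΘ'⟩

/-- Since the b p generate Q, every tensor is some ∑ c p ⊗ b p. The composite of this surjective
parametrization with F is bijective, hence so is F. -/
lemma bijective_of_tmul {R A Q : Type*} [CommRing R] [CommRing A] [Algebra R A] [AddCommGroup Q]
    [Module R Q] {b : Fin m → Q} {β : Fin m → H} {e : A → D} (F : A ⊗[R] Q →+ H)
    (hF : ∀ a p, F (a ⊗ₜ[R] b p) = e a • β p) (he : Function.Bijective e)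
    (hb : Function.Surjective fun c : Fin m → R => ∑ p, c p • b p)
    (hβ : Function.Bijective fun c : Fin m → D => ∑ p, c p • β p) : Function.Bijective F := by
  let g : (Fin m → A) → A ⊗[R] Q := fun c => ∑ p, c p ⊗ₜ[R] b p
  have hg : Function.Surjective g := by
    intro t
    induction t with
    | zero => exact ⟨0, by simp [g]⟩
    | add s t hs ht =>
      obtain ⟨c, rfl⟩ := hs
      obtain ⟨d, rfl⟩ := ht
      exact ⟨c + d, by simp [g, TensorProduct.add_tmul, Finset.sum_add_distrib]⟩
    | tmul a q =>
      obtain ⟨c, rfl⟩ := hb q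
      exact ⟨fun p => c p • a, by simp [g, TensorProduct.tmul_sum, TensorProduct.smul_tmul]⟩
  have hc : F ∘ g = (fun c : Fin m → D => ∑ p, c p • β p) ∘ fun c p => e (c p) := by
    funext c
    simp only [g, Function.comp, map_sum, hF]
  have hbij : Function.Bijective (F ∘ g) := by
    rw [hc]
    refine hβ.comp ⟨fun c d h => funext fun p => he.1 (congrFun h p), fun d => ?_⟩
    choose c hc using fun p => he.2 (d p)
    exact ⟨c, funext hc⟩
  exact ⟨Function.Injective.of_comp_right hbij.1 hg, Function.Surjective.of_comp hbij.2⟩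

end Algebra

section Frame

variable {X : TopCat.{u}} {R : X.Sheaf CommRingCat.{u}} {Q : ModPresheaf R} {m : ℕ}

/-- The sections `b` of `Q` over `U` restrict to bases over all smaller open sets. -/
def IsFrame (Q : ModPresheaf R) {U : Opens X} (b : Fin m → Q.obj U) : Prop :=
  ∀ (V : Opens X) (h : V ≤ U),
    Function.Bijective fun c : Fin m → Sec R V => ∑ i, c i • Q.res h (b i)

namespace IsFrame

variable {U : Opens X} {b : Fin m → Q.obj U} (hb : IsFrame Q b)

include hb

lemma res {V : Opens X} (h : V ≤ U) : IsFrame Q fun i => Q.res h (b i) := fun W h' => by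
  simpa only [Q.res_res] using hb W (h'.trans h)

lemma self : Function.Bijective fun c : Fin m → Sec R U => ∑ i, c i • b i := by
  simpa only [Q.res_self] using hb U le_rfl

/-- The coordinates with respect to a frame. -/
def equiv {V : Opens X} (h : V ≤ U) : (Fin m → Sec R V) ≃ₗ[Sec R V] Q.obj V :=
  LinearEquiv.ofBijective (Fintype.linearCombination (Sec R V) fun i => Q.res h (b i)) (hb V h)

lemma equiv_apply {V : Opens X} (h : V ≤ U) (c : Fin m → Sec R V) :
    hb.equiv h c = ∑ i, c i • Q.res h (b i) := rfl

lemma equiv_symm_res {V W : Opens X} (h : V ≤ U) (h' : W ≤ V) (q : Q.obj V) (i : Fin m) :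
    (hb.equiv (h'.trans h)).symm (Q.res h' q) i = LieAlgd.res R h' ((hb.equiv h).symm q i) := by
  obtain ⟨c, rfl⟩ := (hb.equiv h).surjective q
  have h1 : Q.res h' (hb.equiv h c) = hb.equiv (h'.trans h) fun i => LieAlgd.res R h' (c i) := by
    simp only [equiv_apply, map_sum, LinearMap.map_smulₛₗ, Q.res_res]
  rw [h1, LinearEquiv.symm_apply_apply, LinearEquiv.symm_apply_apply]

end IsFrame

open CoalgPresheaf ModPresheaf

lemma ModPresheaf.HomSec.sum_app {P : ModPresheaf R} {U V : Opens X} {ι : Type*} (s : Finset ι)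
    (f : ι → HomSec P Q U) (h : V ≤ U) (a : P.obj V) :
    (∑ i ∈ s, f i).app h a = ∑ i ∈ s, (f i).app h a :=
  map_sum (AddMonoidHom.mk' (fun f : HomSec P Q U => f.app h a) fun _ _ => rfl) f s

variable {U : Opens X} {b : Fin m → Q.obj U}

/-- The coordinates of a map C → Q in the frame are functionals on C, compatible with restriction
because the frame restricts to frames. -/
lemma IsFrame.constHom_bijective {C : CoalgPresheaf R} (hb : IsFrame Q b) :
    Function.Bijective fun ψ : Fin m → Sec C.dual U =>
      (∑ p, ψ p • constHom U (b p) : HomSec C.toModPresheaf Q U) := by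
  have happ : ∀ (ψ : Fin m → Sec C.dual U) {V : Opens X} (h : V ≤ U) a,
      (∑ p, ψ p • constHom U (b p) : HomSec C.toModPresheaf Q U).app h a =
        ∑ p, DualSec.app (C := C) (ψ p) h a • Q.res h (b p) := fun ψ V h a => by
    rw [HomSec.sum_app]
    exact Finset.sum_congr rfl fun p _ => smul_constHom_app _ _ h a
  constructor
  · intro ψ χ hψ
    funext p
    refine DualSec.ext (C := C) fun V h a => ?_
    have h1 := congrArg (fun f : HomSec C.toModPresheaf Q U => f.app h a) hψ
    simp only [happ] at h1
    exact congrFun ((hb V h).1 h1) p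
  · intro f
    refine ⟨fun p => (⟨fun V => WithConv.toConv
      (LinearMap.proj p ∘ₗ (hb.equiv V.2).symm.toLinearMap ∘ₗ f.app V.2), fun V W h a => ?_⟩ :
        DualSec C U), HomSec.ext fun V h a => ?_⟩
    · change (hb.equiv W.2).symm (f.app W.2 (C.res h a)) p =
        LieAlgd.res R h ((hb.equiv V.2).symm (f.app V.2 a) p)
      rw [← hb.equiv_symm_res V.2 h, ← f.app_res V.2 h]
    · refine (happ _ h a).trans ?_
      exact (hb.equiv h).apply_symm_apply (f.app h a)

end Frame

end LieAlgd

end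

/-! ### The exponential of sections of E. -/

noncomputable section

namespace LieAlgd

open LRConn CoalgPresheaf

lemma map_tmul_eq_lid {R A C Q : Type*} [CommRing R] [AddCommGroup A] [Module R A] [AddCommGroup C]
    [Module R C] [AddCommGroup Q] [Module R Q] (F : A ⊗[R] Q →+ Q) {f : C →ₗ[R] A}
    {g g' : C →ₗ[R] Q} {ψ : C →ₗ[R] R} (h : ∀ x y, F (f x ⊗ₜ g y) = ψ x • g' y) (t : C ⊗[R] C) :
    F (TensorProduct.map f g t) = TensorProduct.lid R Q (TensorProduct.map ψ g' t) := by
  induction t with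
  | zero => simp
  | add s t hs ht => simp only [map_add, hs, ht]
  | tmul x y => rw [TensorProduct.map_tmul, h, TensorProduct.map_tmul, TensorProduct.lid_tmul]

variable {K : Type u} [Field K] [CharZero K] {S : RingedSpaceOver K}

namespace LieAlgebroid

variable {L : LieAlgebroid S} {E : S.Modules}

/-- The maps `Sym L → E`. -/
abbrev SymHom (L : LieAlgebroid S) (E : S.Modules) (U : Opens S.X) : Type u :=
  ModPresheaf.HomSec (symCoalg L.mod).toModPresheaf (ModPresheaf.ofSheaf E) U

instance (U : Opens S.X) : Module (LieAlgd.Sec L.symHat U) (SymHom L E U) :=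
  inferInstanceAs (Module (LieAlgd.Sec (symCoalg L.mod).dual U) (SymHom L E U))

lemma symHat_smul_res {U V : Opens S.X} (ψ : LieAlgd.Sec L.symHat U) (f : SymHom L E U)
    (h : V ≤ U) : (ψ • f).res h = LieAlgd.res L.symHat h ψ • f.res h := rfl

lemma symHat_smul_constHom_app {U V : Opens S.X} (ψ : LieAlgd.Sec L.symHat U)
    (e : (ModPresheaf.ofSheaf E).obj U) (h : V ≤ U) (a : (symCoalg L.mod).obj V) :
    (ψ • constHom U e : SymHom L E U).app h a =
      L.symHatApp ψ h a • (ModPresheaf.ofSheaf E).res h e :=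
  smul_constHom_app (C := symCoalg L.mod) (Q := ModPresheaf.ofSheaf E) ψ e h a

lemma preSymHatEApp_tmul {U : Opens S.X} (ψ : LieAlgd.Sec L.symHat U)
    (e : (ModPresheaf.ofSheaf E).obj U) :
    L.preSymHatEApp E U ((AlgVia.of L.symHatUnit U ψ) ⊗ₜ[LieAlgd.Sec S.O U] e) =
      ψ • (constHom U e : SymHom L E U) :=
  ModPresheaf.HomSec.ext fun _ h a => (symHat_smul_constHom_app ψ e h a).symm

lemma preSymHatEApp_smul {U : Opens S.X} (ψ : LieAlgd.Sec L.symHat U)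
    (t : (L.preSymHatE E).obj U) : L.preSymHatEApp E U (ψ • t) = ψ • L.preSymHatEApp E U t := by
  refine TensorProduct.induction_on (R := LieAlgd.Sec S.O U) (M := AlgVia L.symHatUnit U)
    (N := (ModPresheaf.ofSheaf E).obj U)
    (motive := fun t => L.preSymHatEApp E U (ψ • (show (L.preSymHatE E).obj U from t)) =
      ψ • L.preSymHatEApp E U t) t ?_ (fun (χ : LieAlgd.Sec L.symHat U) e => ?_) (fun s t hs ht => ?_)
  · exact (congrArg (L.preSymHatEApp E U) (smul_zero ψ)).trans ((map_zero (L.preSymHatEApp E U)).trans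
      ((smul_zero ψ).symm.trans (congrArg (ψ • ·) (map_zero (L.preSymHatEApp E U)).symm)))
  · refine (preSymHatEApp_tmul (ψ * χ) e).trans ?_
    refine (mul_smul ψ χ _).trans ?_
    exact congrArg (ψ • ·) (preSymHatEApp_tmul χ e).symm
  · refine (congrArg (L.preSymHatEApp E U) (smul_add ψ _ _)).trans
      ((map_add (L.preSymHatEApp E U) _ _).trans ?_)
    refine (congrArg₂ (· + ·) hs ht).trans ?_
    exact (smul_add ψ _ _).symm.trans (congrArg (ψ • ·) (map_add (L.preSymHatEApp E U) _ _).symm)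

lemma preSymHatEApp_bijective {m : ℕ} {U : Opens S.X} {b : Fin m → (ModPresheaf.ofSheaf E).obj U}
    (hb : IsFrame (ModPresheaf.ofSheaf E) b) : Function.Bijective (L.preSymHatEApp E U) :=
  bijective_of_tmul (R := LieAlgd.Sec S.O U) (A := AlgVia L.symHatUnit U)
    (D := LieAlgd.Sec L.symHat U)
    (β := fun p => (constHom U (b p) : SymHom L E U)) (e := fun ψ => ψ)
    (L.preSymHatEApp E U) (fun ψ p => preSymHatEApp_tmul (ψ : LieAlgd.Sec L.symHat U) (b p))
    Function.bijective_id hb.self.2 (hb.constHom_bijective (C := symCoalg L.mod))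

variable (dL : Connection L L.mod) (dE : Connection L (ModPresheaf.ofSheaf E))

/-- The symmetrized exponential of a section of `E`. -/
def expHom (U : Opens S.X) : (ModPresheaf.ofSheaf E).obj U →+ SymHom L E U where
  toFun e := ⟨fun V => expApp (lrL dL V.1) (dE.lr V.1) ((ModPresheaf.ofSheaf E).res V.2 e),
    fun V W h a => by
      refine Eq.trans ?_ (exp_map (L.resₛₗ h) (resₛₗ_anchor h) (lrL dL V.1) (lrL dL W.1)
        (lrL_res dL h) (dE.lr V.1) (dE.lr W.1) ((ModPresheaf.ofSheaf E).res h)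
        (fun x e => dE.res_nab h x e) a ((ModPresheaf.ofSheaf E).res V.2 e))
      rw [ModPresheaf.res_res]
      rfl⟩
  map_zero' := ModPresheaf.HomSec.ext fun V h a => by
    change exp (lrL dL V) (dE.lr V) a ((ModPresheaf.ofSheaf E).res h 0) = 0
    rw [map_zero, map_zero]
  map_add' e f := ModPresheaf.HomSec.ext fun V h a => by
    change exp (lrL dL V) (dE.lr V) a ((ModPresheaf.ofSheaf E).res h (e + f)) =
      exp (lrL dL V) (dE.lr V) a ((ModPresheaf.ofSheaf E).res h e) +
        exp (lrL dL V) (dE.lr V) a ((ModPresheaf.ofSheaf E).res h f)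
    rw [map_add, map_add]

lemma expHom_app {U V : Opens S.X} (h : V ≤ U) (e : (ModPresheaf.ofSheaf E).obj U)
    (a : (symCoalg L.mod).obj V) : (expHom dL dE U e).app h a =
      exp (lrL dL V) (dE.lr V) a ((ModPresheaf.ofSheaf E).res h e) := rfl

lemma expHom_res {U V : Opens S.X} (h : V ≤ U) (e : (ModPresheaf.ofSheaf E).obj U) :
    expHom dL dE V ((ModPresheaf.ofSheaf E).res h e) = (expHom dL dE U e).res h :=
  ModPresheaf.HomSec.ext fun W h' a => by
    rw [expHom_app, ModPresheaf.res_res]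
    rfl

/-- The connection on the jets of `E` over `U`. -/
def lrJetsE (U : Opens S.X) :
    LRConn (LieAlgd.Sec S.O U) (L.Sec U)
      (AlgVia L.α₂ U ⊗[LieAlgd.Sec S.O U] (ModPresheaf.ofSheaf E).obj U) :=
  LRConn.tensor (lrJets U) (dE.lr U)

/-- By `exp_tensor`, a acts on φ ⊗ e through Δ(a). Evaluating at 1 turns the first factor into
j_L(φ), and what results is the convolution product. This formula governs all of j. -/
lemma ev₁_exp_tmul {U : Opens S.X} (φ : LieAlgd.Sec L.jets U)
    (e : (ModPresheaf.ofSheaf E).obj U)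
    (a : SymmetricAlgebra (LieAlgd.Sec S.O U) (L.Sec U)) : L.ev₁ E U (exp (lrL dL U) (lrJetsE dE U) a
      ((AlgVia.of L.α₂ U φ) ⊗ₜ[LieAlgd.Sec S.O U] e)) =
      (homApp (jIso dL).hom U φ • expHom dL dE U e).app le_rfl a := by
  refine (congrArg (L.ev₁ E U) (exp_tensor (lrJets U) (dE.lr U) (lrL dL U) a (AlgVia.of L.α₂ U φ) e)).trans ?_
  refine map_tmul_eq_lid (A := AlgVia L.α₂ U) (L.ev₁ E U)
    (f := expApp (lrL dL U) (lrJets U) (AlgVia.of L.α₂ U φ)) (g := expApp (lrL dL U) (dE.lr U) e)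
    (g' := (expHom dL dE U e).app le_rfl) (ψ := L.symHatApp (homApp (jIso dL).hom U φ) le_rfl)
    (fun x y => ?_) _
  change L.jetApp (exp (lrL dL U) (lrJets U) x φ) le_rfl 1 • exp (lrL dL U) (dE.lr U) y e =
    L.jetApp φ le_rfl (UEnv.pbw K (lrL dL U) x) •
      exp (lrL dL U) (dE.lr U) y ((ModPresheaf.ofSheaf E).res le_rfl e)
  rw [jetApp_exp_one, ModPresheaf.res_self]

end LieAlgebroid

end LieAlgd

end

/-! ### The map j on the presheaf tensor product. -/

noncomputable section

namespace LieAlgd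

open LRConn CoalgPresheaf

variable {K : Type u} [Field K] [CharZero K] {S : RingedSpaceOver K}

namespace LieAlgebroid

variable {L : LieAlgebroid S} {E : S.Modules}
  (dL : Connection L L.mod) (dE : Connection L (ModPresheaf.ofSheaf E))

/-- The right-hand side depends only on a tensor over O through α₂; this shows that the left-hand
side is balanced, as needed to define `preJ`. -/
lemma jIso_smul_expHom_app {U V : Opens S.X} (h : V ≤ U) (φ : LieAlgd.Sec L.jets U)
    (e : (ModPresheaf.ofSheaf E).obj U) (a : SymmetricAlgebra (LieAlgd.Sec S.O V) (L.Sec V)) :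
    (homApp (jIso dL).hom U φ • expHom dL dE U e).app h a =
      L.ev₁ E V (exp (lrL dL V) (lrJetsE dE V) a (AlgVia.res L.α₂ h (AlgVia.of L.α₂ U φ)
        ⊗ₜ[LieAlgd.Sec S.O V] (ModPresheaf.ofSheaf E).res h e)) := by
  refine Eq.trans ?_ (ev₁_exp_tmul dL dE (LieAlgd.res L.jets h φ) _ a).symm
  rw [expHom_res]
  rfl

/-- The map `ev₁ ∘ exp(D)` on the presheaf of jets of `E`. -/
def preJ (U : Opens S.X) : (L.preJetsE E).obj U →+ SymHom L E U :=
  TensorProduct.liftAddHom (R := LieAlgd.Sec S.O U) (M := AlgVia L.α₂ U)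
    (N := (ModPresheaf.ofSheaf E).obj U)
    (AddMonoidHom.mk' (fun φ : AlgVia L.α₂ U => AddMonoidHom.mk'
      (fun e => homApp (jIso dL).hom U φ • expHom dL dE U e)
      (fun e f => by rw [map_add, smul_add]))
      (fun φ ψ => by
        ext e
        refine Eq.trans (congrArg (· • expHom dL dE U e) (map_add (homApp (jIso dL).hom U) φ ψ)) ?_
        exact add_smul _ _ _))
    (fun r (φ : AlgVia L.α₂ U) e => ModPresheaf.HomSec.ext fun V h a => by
      refine (jIso_smul_expHom_app dL dE h (r • φ) e a).trans
        (Eq.trans ?_ (jIso_smul_expHom_app dL dE h φ (r • e) a).symm)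
      congr 2
      refine Eq.trans (congrArg (fun z => z ⊗ₜ[LieAlgd.Sec S.O V] _)
        (LinearMap.map_smulₛₗ (AlgVia.res L.α₂ h) r φ)) ?_
      rw [TensorProduct.smul_tmul, LinearMap.map_smulₛₗ]
      rfl)

lemma preJ_tmul {U : Opens S.X} (φ : LieAlgd.Sec L.jets U) (e : (ModPresheaf.ofSheaf E).obj U) :
    preJ dL dE U (AlgVia.of L.α₂ U φ ⊗ₜ[LieAlgd.Sec S.O U] e) =
      homApp (jIso dL).hom U φ • expHom dL dE U e := rfl

/-- Two additive maps on the jets of `E` are equal if they agree on tensors. -/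
lemma preJetsE_hom_ext {U : Opens S.X} {H : Type*} [AddCommGroup H]
    {F G : (L.preJetsE E).obj U →+ H}
    (h : ∀ (φ : LieAlgd.Sec L.jets U) (e : (ModPresheaf.ofSheaf E).obj U),
      F (AlgVia.of L.α₂ U φ ⊗ₜ[LieAlgd.Sec S.O U] e) =
        G (AlgVia.of L.α₂ U φ ⊗ₜ[LieAlgd.Sec S.O U] e)) : F = G :=
  DFunLike.ext _ _ fun t => TensorProduct.induction_on (R := LieAlgd.Sec S.O U)
    (M := AlgVia L.α₂ U) (N := (ModPresheaf.ofSheaf E).obj U) (motive := fun t => F t = G t) t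
    ((map_zero F).trans (map_zero G).symm) h
    (fun s t hs ht => (map_add F s t).trans ((congrArg₂ (· + ·) hs ht).trans (map_add G s t).symm))

lemma preJ_smul {U : Opens S.X} (φ : LieAlgd.Sec L.jets U) (t : (L.preJetsE E).obj U) :
    preJ dL dE U (φ • t) = homApp (jIso dL).hom U φ • preJ dL dE U t := by
  have := preJetsE_hom_ext (L := L) (E := E)
    (F := (preJ dL dE U).comp (AddMonoidHom.mk' (fun t => φ • t) (smul_add φ)))
    (G := (AddMonoidHom.mk' (fun f => homApp (jIso dL).hom U φ • f) (smul_add _)).comp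
      (preJ dL dE U)) (fun ψ e => by
      refine (preJ_tmul dL dE (φ * ψ) e).trans ?_
      rw [map_mul]
      exact mul_smul _ _ _)
  exact DFunLike.congr_fun this t

lemma preJ_res {U V : Opens S.X} (h : V ≤ U) (t : (L.preJetsE E).obj U) :
    preJ dL dE V ((L.preJetsE E).res h t) =
      (ModPresheaf.ihom (symCoalg L.mod).toModPresheaf (ModPresheaf.ofSheaf E)).res h
        (preJ dL dE U t) := by
  have := preJetsE_hom_ext (L := L) (E := E)
    (F := (preJ dL dE V).comp ((L.preJetsE E).res h).toAddMonoidHom)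
    (G := ((ModPresheaf.ihom (symCoalg L.mod).toModPresheaf
      (ModPresheaf.ofSheaf E)).res h).toAddMonoidHom.comp (preJ dL dE U)) (fun φ e => by
      refine (preJ_tmul dL dE (LieAlgd.res L.jets h φ) ((ModPresheaf.ofSheaf E).res h e)).trans ?_
      rw [expHom_res, homApp_res]
      rfl)
  exact DFunLike.congr_fun this t

lemma preJ_app {U : Opens S.X} (t : (L.preJetsE E).obj U)
    (a : SymmetricAlgebra (LieAlgd.Sec S.O U) (L.Sec U)) :
    (preJ dL dE U t).app le_rfl a = L.ev₁ E U (exp (lrL dL U) (lrJetsE dE U) a t) := by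
  have := preJetsE_hom_ext (L := L) (E := E)
    (F := (AddMonoidHom.mk' (fun f : SymHom L E U => f.app le_rfl a) fun _ _ => rfl).comp
      (preJ dL dE U))
    (G := (L.ev₁ E U).comp (exp (lrL dL U) (lrJetsE dE U) a)) (fun φ e =>
      (ev₁_exp_tmul dL dE φ e a).symm)
  exact DFunLike.congr_fun this t

lemma preJ_app_prod {U : Opens S.X} (t : (L.preJetsE E).obj U) (n : ℕ) (x : Fin n → L.Sec U) :
    (preJ dL dE U t).app le_rfl
        (List.ofFn fun i => SymmetricAlgebra.ι (LieAlgd.Sec S.O U) (L.mod.obj U) (x i)).prod =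
      ((n.factorial : K)⁻¹) •
        L.ev₁ E U (symDpow (L.nabL dL U) (fun y => L.nablaJetsE E dE y) n t x) := by
  have h' : symDpow (L.nabL dL U) (fun y => L.nablaJetsE E dE y) n t x =
      n.factorial • exp (lrL dL U) (lrJetsE dE U) (∏ i, Sym.ι _ (x i)) t :=
    symDpow_eq (lrL dL U) (lrJetsE dE U) n t x
  rw [h', List.prod_ofFn]
  refine (preJ_app dL dE t (∏ i, Sym.ι _ (x i))).trans ?_
  refine Eq.trans ?_ (congrArg _ (map_nsmul (L.ev₁ E U) _ _).symm)
  rw [← Nat.cast_smul_eq_nsmul K, inv_smul_smul₀ (Nat.cast_ne_zero.2 n.factorial_ne_zero)]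

/-- The evaluation at `1` of sections of `Sym^(L^∨)` is a morphism of rings. -/
def symHatEv (U : Opens S.X) : LieAlgd.Sec L.symHat U →+* LieAlgd.Sec S.O U where
  toFun ψ := L.symHatApp ψ le_rfl 1
  map_one' := Bialgebra.counit_one (R := LieAlgd.Sec S.O U)
    (A := SymmetricAlgebra _ (L.mod.obj U))
  map_mul' ψ χ := by
    change LinearMap.mul' _ _ (TensorProduct.map (L.symHatApp ψ le_rfl) (L.symHatApp χ le_rfl)
      (Coalgebra.comul (R := LieAlgd.Sec S.O U)
        (1 : SymmetricAlgebra (LieAlgd.Sec S.O U) (L.mod.obj U)))) = _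
    rw [Bialgebra.comul_one, Algebra.TensorProduct.one_def, TensorProduct.map_tmul,
      LinearMap.mul'_apply]
  map_zero' := rfl
  map_add' _ _ := rfl

variable (L) in
/-- The unit of the symmetric algebra, as a section of the presheaf of coalgebras `Sym L`. -/
def symOne (U : Opens S.X) : (symCoalg L.mod).obj U :=
  (1 : SymmetricAlgebra (LieAlgd.Sec S.O U) (L.mod.obj U))

lemma symHat_smul_constHom_app_one {U : Opens S.X} (ψ : LieAlgd.Sec L.symHat U)
    (e : (ModPresheaf.ofSheaf E).obj U) :
    (ψ • constHom U e : SymHom L E U).app le_rfl (symOne L U) = symHatEv U ψ • e := by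
  refine (symHat_smul_constHom_app ψ e le_rfl (symOne L U)).trans ?_
  rw [ModPresheaf.res_self]
  rfl

lemma expHom_app_one {U : Opens S.X} (e : (ModPresheaf.ofSheaf E).obj U) :
    (expHom dL dE U e).app le_rfl (symOne L U) = e :=
  (expHom_app dL dE le_rfl e (symOne L U)).trans
    ((exp_one (lrL dL U) (dE.lr U) _).trans (ModPresheaf.res_self _ _ _))

/-- Θ expresses the exponentials of the frame in the basis of constant maps. Its determinant is a
unit, so the exponentials form a basis over Sym^(L^∨), and `bijective_of_tmul` concludes. -/
lemma preJ_bijective {m : ℕ} {U : Opens S.X} {b : Fin m → (ModPresheaf.ofSheaf E).obj U}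
    (hb : IsFrame (ModPresheaf.ofSheaf E) b) : Function.Bijective (preJ dL dE U) := by
  have hβ := hb.constHom_bijective (C := symCoalg L.mod)
  choose Θ hΘ using fun p => hβ.2 (expHom dL dE U (b p))
  -- At 1 the exponential of b p is b p itself, so the values of Θ at 1 form the identity matrix.
  have h1 : (Matrix.of Θ).map (symHatEv (L := L) U) = 1 := by
    ext p q
    have h2 : ∑ q, symHatEv (L := L) U (Θ p q) • b q =
        ∑ q, (1 : Matrix (Fin m) (Fin m) (LieAlgd.Sec S.O U)) p q • b q := by
      have h3 := congrArg (fun f : SymHom L E U => f.app le_rfl (symOne L U)) (hΘ p)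
      refine Eq.trans (Finset.sum_congr rfl fun q _ => ?_)
        ((ModPresheaf.HomSec.sum_app _ _ _ _).symm.trans (h3.trans ?_))
      · exact (symHat_smul_constHom_app_one (Θ p q) (b q)).symm
      · refine (expHom_app_one dL dE (b p)).trans ?_
        simp [Matrix.one_apply]
    exact congrFun (hb.self.1 h2) q
  -- Evaluation at 1 is a ring homomorphism, so the determinant has value 1 there.
  have hdet : IsUnit (Matrix.of Θ).det := by
    refine SymHat.isUnit_of_app_one (M := L.mod) (ψ := (Matrix.of Θ).det) ?_
    have h2 := (RingHom.map_det (symHatEv (L := L) U) (Matrix.of Θ)).trans (congrArg _ h1)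
    rw [Matrix.det_one] at h2
    exact h2
  refine bijective_of_tmul (R := LieAlgd.Sec S.O U) (A := AlgVia L.α₂ U)
    (D := LieAlgd.Sec L.symHat U) (β := fun p => expHom dL dE U (b p))
    (e := homApp (jIso dL).hom U) (preJ dL dE U) (fun φ p => preJ_tmul dL dE φ (b p))
    ((pbwIso dL).dualEquiv U).bijective hb.self.2 ?_
  exact bijective_sum_smul_of_isUnit_det (Matrix.of Θ) hdet (fun p => (hΘ p).symm) hβ

end LieAlgebroid

end LieAlgd

end

/-! ### The isomorphism j of sheaves. -/

noncomputable section

namespace LieAlgd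

open LRConn CoalgPresheaf

variable {K : Type u} [Field K] [CharZero K] {S : RingedSpaceOver K}

lemma IsLocallyFreeOfRank.exists_frame {E : S.Modules} {m : ℕ} (hE : IsLocallyFreeOfRank E m)
    {U : Opens S.X} {x : S.X} (hx : x ∈ U) : ∃ (V : Opens S.X) (_ : V ≤ U), x ∈ V ∧
      ∃ b : Fin m → (ModPresheaf.ofSheaf E).obj V, IsFrame (ModPresheaf.ofSheaf E) b := by
  obtain ⟨W, hxW, b, hb⟩ := hE x
  have hb' : IsFrame (ModPresheaf.ofSheaf E) b := hb
  exact ⟨U ⊓ W, inf_le_left, ⟨hx, hxW⟩, _, hb'.res inf_le_right⟩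

namespace LieAlgebroid

variable {L : LieAlgebroid S} {E : S.Modules}

lemma isSheaf_symHom : (ModPresheaf.ihom (symCoalg L.mod).toModPresheaf
    (ModPresheaf.ofSheaf E)).IsSheaf := ModPresheaf.isSheaf_ihom (ModPresheaf.isSheaf_ofSheaf E)

lemma SymHom.ext_of_locally {U : Opens S.X} {f g : SymHom L E U}
    (H : ∀ x ∈ U, ∃ (V : Opens S.X) (hV : V ≤ U), x ∈ V ∧ f.res hV = g.res hV) : f = g :=
  isSheaf_symHom.ext_of_locally H

section Lift

variable {A : S.X.Sheaf CommRingCat.{u}} {P : ModPresheaf A} (f : ∀ U, P.obj U →+ SymHom L E U)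
  (hf : ∀ {U V : Opens S.X} (h : V ≤ U) (t : P.obj U), f V (P.res h t) = (f U t).res h)

/-- The extension to the associated sheaf of a map to the sheaf of maps `Sym L → E`. -/
def symLift (U : Opens S.X) : P.sheafify.obj U →+ SymHom L E U :=
  P.sheafifyLift _ isSheaf_symHom f hf U

lemma symLift_toSheafify {U : Opens S.X} (t : P.obj U) :
    symLift f hf U (P.toSheafify U t) = f U t :=
  P.sheafifyLift_toSheafify _ isSheaf_symHom f hf U t

lemma symLift_res {U V : Opens S.X} (h : V ≤ U) (s : P.sheafify.obj U) :
    symLift f hf V (P.sheafify.res h s) = (symLift f hf U s).res h :=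
  ModPresheaf.sheafifyLift_res isSheaf_symHom f hf h s

/-- Every point has a neighbourhood on which E has a frame, so bijectivity over such open sets gives
both local conditions. It serves for 𝓙(L;E) and for Sym^(L^∨) ⊗ E. -/
lemma symLift_bijective {m : ℕ} (hE : IsLocallyFreeOfRank E m)
    (hbij : ∀ {U : Opens S.X} {b : Fin m → (ModPresheaf.ofSheaf E).obj U},
      IsFrame (ModPresheaf.ofSheaf E) b → Function.Bijective (f U)) (U : Opens S.X) :
    Function.Bijective (symLift f hf U) := by
  refine ModPresheaf.sheafifyLift_bijective isSheaf_symHom f hf (fun {U} t ht x hx => ?_)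
    (fun q x hx => ?_) U
  · obtain ⟨V, hV, hxV, b, hb⟩ := hE.exists_frame hx
    refine ⟨V, hV, hxV, (hbij hb).1 ((hf hV t).trans ?_)⟩
    rw [show f U t = 0 from ht, map_zero]
    rfl
  · obtain ⟨V, hV, hxV, b, hb⟩ := hE.exists_frame hx
    exact ⟨V, hV, hxV, (hbij hb).2 _⟩

lemma symLift_smul (α : A ⟶ L.symHat)
    (hsmul : ∀ {U : Opens S.X} (r : LieAlgd.Sec A U) (t : P.obj U),
      f U (r • t) = homApp α U r • f U t)
    {U : Opens S.X} (r : LieAlgd.Sec A U) (s : P.sheafify.obj U) :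
    symLift f hf U (r • s) = homApp α U r • symLift f hf U s := by
  refine SymHom.ext_of_locally fun x hx => ?_
  obtain ⟨V, hV, hxV, t, ht⟩ := P.exists_toSheafify_eq_res s hx
  refine ⟨V, hV, hxV, ?_⟩
  rw [symHat_smul_res, ← symLift_res, ← symLift_res, LinearMap.map_smulₛₗ, ← ht,
    ← P.toSheafify_smul, symLift_toSheafify, symLift_toSheafify, hsmul, homApp_res]

end Lift

lemma symHatEApp_bijective {m : ℕ} (hE : IsLocallyFreeOfRank E m) (U : Opens S.X) :
    Function.Bijective (L.symHatEApp E U) :=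
  symLift_bijective (L.preSymHatEApp E) (L.preSymHatEApp_res E) hE
    preSymHatEApp_bijective U

lemma symHatEApp_smul {U : Opens S.X} (ψ : LieAlgd.Sec L.symHat U) (s : (L.symHatE E).obj U) :
    L.symHatEApp E U (ψ • s) = ψ • L.symHatEApp E U s :=
  symLift_smul (L.preSymHatEApp E) (L.preSymHatEApp_res E) (𝟙 L.symHat) preSymHatEApp_smul ψ s

lemma symHatEApp_res {U V : Opens S.X} (h : V ≤ U) (s : (L.symHatE E).obj U) :
    L.symHatEApp E V ((L.symHatE E).res h s) = (L.symHatEApp E U s).res h :=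
  symLift_res (L.preSymHatEApp E) (L.preSymHatEApp_res E) h s

variable (dL : Connection L L.mod) (dE : Connection L (ModPresheaf.ofSheaf E))

/-- The map `ev₁ ∘ exp(D)` on the sheaf of jets of `E`. -/
def jHat (U : Opens S.X) : (L.jetsE E).obj U →+ SymHom L E U :=
  symLift (preJ dL dE) (preJ_res dL dE) U

lemma jHat_toSheafify {U : Opens S.X} (t : (L.preJetsE E).obj U) :
    jHat dL dE U ((L.preJetsE E).toSheafify U t) = preJ dL dE U t :=
  symLift_toSheafify (preJ dL dE) (preJ_res dL dE) t

lemma jHat_res {U V : Opens S.X} (h : V ≤ U) (s : (L.jetsE E).obj U) :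
    jHat dL dE V ((L.jetsE E).res h s) = (jHat dL dE U s).res h :=
  symLift_res (preJ dL dE) (preJ_res dL dE) h s

lemma jHat_smul {U : Opens S.X} (φ : LieAlgd.Sec L.jets U) (s : (L.jetsE E).obj U) :
    jHat dL dE U (φ • s) = homApp (jIso dL).hom U φ • jHat dL dE U s :=
  symLift_smul (preJ dL dE) (preJ_res dL dE) (jIso dL).hom (preJ_smul dL dE) φ s

lemma jHat_bijective {m : ℕ} (hE : IsLocallyFreeOfRank E m) (U : Opens S.X) :
    Function.Bijective (jHat dL dE U) :=
  symLift_bijective (preJ dL dE) (preJ_res dL dE) hE (preJ_bijective dL dE) U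

variable {m : ℕ} (hE : IsLocallyFreeOfRank E m)

/-- The bijection on sections underlying `j`. -/
def jEquiv (U : Opens S.X) : (L.jetsE E).obj U ≃+ (L.symHatE E).obj U :=
  (AddEquiv.ofBijective _ (jHat_bijective dL dE hE U)).trans
    (AddEquiv.ofBijective _ (symHatEApp_bijective hE U)).symm

lemma symHatEApp_jEquiv {U : Opens S.X} (s : (L.jetsE E).obj U) :
    L.symHatEApp E U (jEquiv dL dE hE U s) = jHat dL dE U s :=
  (AddEquiv.ofBijective _ (symHatEApp_bijective hE U)).apply_symm_apply (jHat dL dE U s)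

/-- The isomorphism `𝓙(L; E) ≅ Sym^(L^∨) ⊗ E`. -/
def jEIso : ModPresheaf.IsoOver (jIso dL).hom (L.jetsE E) (L.symHatE E) where
  toEquiv := jEquiv dL dE hE
  map_smul {U} φ s := (symHatEApp_bijective hE U).1 <| by
    rw [symHatEApp_jEquiv, symHatEApp_smul, symHatEApp_jEquiv, jHat_smul]
  naturality {U V} h s := (symHatEApp_bijective hE V).1 <| by
    rw [symHatEApp_jEquiv, symHatEApp_res, symHatEApp_jEquiv, jHat_res]

end LieAlgebroid

end LieAlgd

end

/-! ### Monomial bases of the symmetric algebra. -/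

noncomputable section

namespace LieAlgd

namespace Sym

open Module

section Monomial

variable {R M κ : Type*} [CommRing R] [AddCommGroup M] [Module R M] (b : Basis κ R M)

lemma symmetricAlgebra_repr (a : SymmetricAlgebra R M) (α : κ →₀ ℕ) :
    b.symmetricAlgebra.repr a α = (SymmetricAlgebra.equivMvPolynomial b a).coeff α := by
  rw [Basis.symmetricAlgebra_repr_apply]
  rfl

lemma equivMvPolynomial_ι_isHomogeneous (y : M) :
    (SymmetricAlgebra.equivMvPolynomial b (ι R y)).IsHomogeneous 1 := by
  have h := Basis.mem_span b y
  induction h using Submodule.span_induction with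
  | mem y hy =>
    obtain ⟨i, rfl⟩ := hy
    rw [SymmetricAlgebra.equivMvPolynomial_ι_apply]
    exact MvPolynomial.isHomogeneous_X R i
  | zero => rw [map_zero, map_zero]; exact MvPolynomial.isHomogeneous_zero _ _ _
  | add x y _ _ hx hy => rw [map_add, map_add]; exact hx.add hy
  | smul r y _ hy =>
    rw [map_smul, map_smul, MvPolynomial.smul_eq_C_mul]
    exact hy.C_mul r

/-- Under the identification with polynomials an element of L becomes a linear form, so its k-th
power is homogeneous of degree k. -/
lemma repr_eq_zero_of_mem_filt {n : ℕ} {a : SymmetricAlgebra R M} (ha : a ∈ filt R M n)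
    {α : κ →₀ ℕ} (hα : n < α.degree) : b.symmetricAlgebra.repr a α = 0 := by
  refine filt_induction (P := fun a => b.symmetricAlgebra.repr a α = 0) (fun k hk a ha => ?_)
    (fun a a' h h' => by rw [map_add, Finsupp.add_apply, h, h', add_zero]) ha
  refine eqOn_homog (f := b.symmetricAlgebra.coord α) (g := (0 : SymmetricAlgebra R M →ₗ[R] R))
    (fun y => ?_) ha
  rw [Basis.coord_apply, symmetricAlgebra_repr, map_pow]
  exact ((equivMvPolynomial_ι_isHomogeneous b y).pow k).coeff_eq_zero (by omega)

lemma eq_zero_of_mem_filt {Q : Type*} [AddCommGroup Q] [Module R Q] (F : SymmetricAlgebra R M →ₗ[R] Q)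
    {n : ℕ} (hF : ∀ α : κ →₀ ℕ, α.degree ≤ n → F (b.symmetricAlgebra α) = 0)
    {a : SymmetricAlgebra R M} (ha : a ∈ filt R M n) : F a = 0 := by
  rw [← b.symmetricAlgebra.linearCombination_repr a, Finsupp.linearCombination_apply, Finsupp.sum,
    map_sum]
  refine Finset.sum_eq_zero fun α _ => ?_
  rw [map_smul]
  rcases le_or_gt α.degree n with h | h
  · rw [hF α h, smul_zero]
  · rw [repr_eq_zero_of_mem_filt b ha h, zero_smul]

/-- The left tensor factors in Δ(yᵏ) are powers of y of degree at most k ≤ n, and ψ kills them. -/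
lemma convAct_eq_zero_of_mem_filt {Q : Type*} [AddCommGroup Q] [Module R Q] {n : ℕ}
    {ψ : SymmetricAlgebra R M →ₗ[R] R} (hψ : ∀ a ∈ filt R M n, ψ a = 0)
    (f : SymmetricAlgebra R M →ₗ[R] Q) {a : SymmetricAlgebra R M} (ha : a ∈ filt R M n) :
    convAct ψ f a = 0 := by
  refine filt_induction (P := fun a => convAct ψ f a = 0) (fun k hk a ha => ?_)
    (fun a a' h h' => by rw [map_add, h, h', add_zero]) ha
  refine eqOn_homog (f := convAct ψ f) (g := (0 : SymmetricAlgebra R M →ₗ[R] Q))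
    (fun y => ?_) ha
  rw [convAct_apply, comul_pow, map_sum, map_sum]
  refine Finset.sum_eq_zero fun i hi => ?_
  rw [map_nsmul, map_nsmul, TensorProduct.map_tmul, TensorProduct.lid_tmul,
    hψ _ (homog_le_filt ((Nat.lt_succ_iff.1 (Finset.mem_range.1 hi)).trans hk) (pow_mem y i)),
    zero_smul, smul_zero]

variable {R' M' : Type*} [CommRing R'] [AddCommGroup M'] [Module R' M'] {σ : R →+* R'}
  (F : M →ₛₗ[σ] M') (b' : Basis κ R' M') (hF : ∀ i, F (b i) = b' i)

include hF

lemma equivMvPolynomial_symMap (a : SymmetricAlgebra R M) :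
    SymmetricAlgebra.equivMvPolynomial b' (symMap F a) =
      MvPolynomial.map σ (SymmetricAlgebra.equivMvPolynomial b a) := by
  induction a using SymmetricAlgebra.induction with
  | algebraMap r =>
    rw [symMap_algebraMap, AlgEquiv.commutes, AlgEquiv.commutes, MvPolynomial.algebraMap_eq,
      MvPolynomial.algebraMap_eq, MvPolynomial.map_C]
  | mul x y hx hy => simp only [map_mul, hx, hy]
  | add x y hx hy => simp only [map_add, hx, hy]
  | ι y =>
    rw [symMap_ι]
    have h := Basis.mem_span b y
    induction h using Submodule.span_induction with
    | mem y hy =>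
      obtain ⟨i, rfl⟩ := hy
      rw [hF, SymmetricAlgebra.equivMvPolynomial_ι_apply,
        SymmetricAlgebra.equivMvPolynomial_ι_apply, MvPolynomial.map_X]
    | zero => simp only [map_zero]
    | add x y _ _ hx hy => simp only [map_add, hx, hy]
    | smul r y _ hy =>
      simp only [LinearMap.map_smulₛₗ, map_smul, hy, MvPolynomial.smul_eq_C_mul, map_mul,
        MvPolynomial.map_C]

lemma repr_symMap (a : SymmetricAlgebra R M) (α : κ →₀ ℕ) :
    b'.symmetricAlgebra.repr (symMap F a) α = σ (b.symmetricAlgebra.repr a α) := by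
  rw [symmetricAlgebra_repr, symmetricAlgebra_repr, equivMvPolynomial_symMap b F b' hF,
    MvPolynomial.coeff_map]

lemma symMap_symmetricAlgebra (α : κ →₀ ℕ) :
    symMap F (b.symmetricAlgebra α) = b'.symmetricAlgebra α := by
  refine b'.symmetricAlgebra.repr.injective (Finsupp.ext fun β => ?_)
  classical
  rw [repr_symMap b F b' hF, Basis.repr_self, Basis.repr_self, Finsupp.single_apply,
    Finsupp.single_apply]
  split_ifs <;> simp

end Monomial

end Sym

section Basis

variable {X : TopCat.{u}} {R : X.Sheaf CommRingCat.{u}} {Q : ModPresheaf R} {m : ℕ}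
  {U : Opens X} {b : Fin m → Q.obj U} (hb : IsFrame Q b)

/-- The basis of the sections over a smaller open set given by a frame. -/
def IsFrame.basis {V : Opens X} (h : V ≤ U) : Module.Basis (Fin m) (Sec R V) (Q.obj V) :=
  Module.Basis.ofEquivFun (hb.equiv h).symm

lemma IsFrame.basis_apply {V : Opens X} (h : V ≤ U) (i : Fin m) :
    hb.basis h i = Q.res h (b i) := by
  rw [IsFrame.basis, Module.Basis.coe_ofEquivFun]
  simp [IsFrame.equiv_apply, Pi.single_apply]

lemma IsFrame.res_basis {V W : Opens X} (h : V ≤ U) (h' : W ≤ V) (i : Fin m) :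
    Q.res h' (hb.basis h i) = hb.basis (h'.trans h) i := by
  rw [IsFrame.basis_apply, IsFrame.basis_apply, Q.res_res]

end Basis

end LieAlgd

end

/-! ### The pairing of Sym L ⊗ End E with jets, and continuity. -/

noncomputable section

namespace LieAlgd

open LRConn CoalgPresheaf LieAlgd.Sym

lemma smul_convAct {R C Q : Type*} [CommRing R] [AddCommGroup C] [Module R C] [Coalgebra R C]
    [AddCommGroup Q] [Module R Q] (r : R) (ψ : C →ₗ[R] R) (f : C →ₗ[R] Q) :
    convAct (r • ψ) f = r • convAct ψ f := by
  simp only [convAct, TensorProduct.map_smul_left, LinearMap.smul_comp, LinearMap.comp_smul]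

lemma Sym.symMap_mem_filt {R M R' M' : Type*} [CommRing R] [AddCommGroup M] [Module R M]
    [CommRing R'] [AddCommGroup M'] [Module R' M'] {σ : R →+* R'} (F : M →ₛₗ[σ] M') {n : ℕ}
    {a : SymmetricAlgebra R M} (ha : a ∈ filt R M n) : symMap F a ∈ filt R' M' n := by
  refine filt_induction (P := fun a => symMap F a ∈ filt R' M' n) (fun k hk a ha => ?_)
    (fun a a' h h' => by rw [map_add]; exact add_mem h h') ha
  refine homog_le_filt hk ?_
  induction ha using Submodule.span_induction with
  | mem a ha =>
    obtain ⟨y, rfl⟩ := ha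
    simp only [map_pow, symMap_ι]
    exact pow_mem _ _
  | zero => rw [map_zero]; exact zero_mem _
  | add x y _ _ hx hy => rw [map_add]; exact add_mem hx hy
  | smul r y _ hy => rw [symMap_smul]; exact Submodule.smul_mem _ _ hy

variable {K : Type u} [Field K] [CharZero K] {S : RingedSpaceOver K}

namespace LieAlgebroid

variable {L : LieAlgebroid S} {E : S.Modules}

/-- The endomorphisms of `E` over `U`. -/
abbrev EndSec (E : S.Modules) (U : Opens S.X) : Type u :=
  ModPresheaf.HomSec (ModPresheaf.ofSheaf E) (ModPresheaf.ofSheaf E) U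

/-- The jets of `E` as a presheaf of `O`-modules through `α₁`. -/
abbrev jetsE₁ (L : LieAlgebroid S) (E : S.Modules) : ModPresheaf S.O :=
  (L.jetsE E).restrictScalars L.α₁

/-- The unit map sends r to r ε and ε acts as the identity; this makes j linear over O acting
through α₁. -/
lemma symHatUnit_smul {U : Opens S.X} (r : LieAlgd.Sec S.O U) (f : SymHom L E U) :
    homApp L.symHatUnit U r • f = r • f :=
  ModPresheaf.HomSec.ext fun V h a => by
    refine DFunLike.congr_fun ((smul_convAct (LieAlgd.res S.O h r)
      (Coalgebra.counit (R := LieAlgd.Sec S.O V)) (f.app h)).trans ?_) a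
    rw [convAct_counit]
    rfl

/-- The evaluation of maps `Sym L → E`. -/
def evalAt {U : Opens S.X} (a : (symCoalg L.mod).obj U) :
    SymHom L E U →ₗ[LieAlgd.Sec S.O U] (ModPresheaf.ofSheaf E).obj U where
  toFun f := f.app le_rfl a
  map_add' _ _ := rfl
  map_smul' r f := by
    rw [ModPresheaf.HomSec.smul_app, LieAlgd.res_self]
    rfl

variable (dL : Connection L L.mod) (dE : Connection L (ModPresheaf.ofSheaf E))

/-- The map `jHat` as a linear map over `O`. -/
def jLin (U : Opens S.X) : (jetsE₁ L E).obj U →ₗ[LieAlgd.Sec S.O U] SymHom L E U where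
  toFun s := jHat dL dE U s
  map_add' s t := map_add (jHat dL dE U) s t
  map_smul' r s := by
    refine (jHat_smul dL dE (homApp L.α₁ U r) s).trans ?_
    rw [jIso_α₁, symHatUnit_smul]
    rfl

lemma jLin_apply {U : Opens S.X} (s : (L.jetsE E).obj U) :
    jLin dL dE U (ModPresheaf.ofScalars L.α₁ (L.jetsE E) U s) = jHat dL dE U s := rfl

lemma jLin_res {U V : Opens S.X} (h : V ≤ U) (s : (jetsE₁ L E).obj U) :
    jLin dL dE V ((jetsE₁ L E).res h s) = (jLin dL dE U s).res h := jHat_res dL dE h s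

lemma jIso_vanishes {U : Opens S.X} {k : ℕ} {φ : LieAlgd.Sec L.jets U} (hφ : L.JetVanishes k φ)
    {V : Opens S.X} (h : V ≤ U) {a : SymmetricAlgebra (LieAlgd.Sec S.O V) (L.Sec V)}
    (ha : a ∈ filt _ _ k) : L.symHatApp (homApp (jIso dL).hom U φ) h a = 0 :=
  hφ V h _ (UEnv.pbw_mem_filtration (lrL dL V) ha)

/-- The pairing of `Sym L` and `End E` with the jets of `E`. -/
def pairHom {U : Opens S.X} (a : (symCoalg L.mod).obj U) (T : EndSec E U) :
    ModPresheaf.HomSec (jetsE₁ L E) (ModPresheaf.ofSheaf E) U :=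
  ⟨fun V => T.app V.2 ∘ₗ evalAt ((symCoalg L.mod).res V.2 a) ∘ₗ jLin dL dE V.1, fun V W h s => by
    change T.app W.2 ((jLin dL dE W.1 ((jetsE₁ L E).res h s)).app le_rfl
      ((symCoalg L.mod).res W.2 a)) = (ModPresheaf.ofSheaf E).res h
        (T.app V.2 ((jLin dL dE V.1 s).app le_rfl ((symCoalg L.mod).res V.2 a)))
    rw [← T.app_res V.2 h, ← ModPresheaf.HomSec.app_res _ le_rfl h, jLin_res,
      (symCoalg L.mod).res_res]
    rfl⟩

lemma pairHom_app {U V : Opens S.X} (a : (symCoalg L.mod).obj U) (T : EndSec E U) (h : V ≤ U)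
    (s : (jetsE₁ L E).obj V) : (pairHom dL dE a T).app h s =
      T.app h ((jLin dL dE V s).app le_rfl ((symCoalg L.mod).res h a)) := rfl

lemma pairHom_mem {U : Opens S.X} (a : (symCoalg L.mod).obj U) (T : EndSec E U) :
    pairHom dL dE a T ∈ L.contSub E U := by
  intro x hx
  -- The order k is a bound for the degree of a: if φ vanishes to order k, then j_L(φ) vanishes in
  -- degrees at most k, and so does its convolution with j(s).
  obtain ⟨k, hk⟩ := exists_mem_filt
    (show SymmetricAlgebra (LieAlgd.Sec S.O U) (L.mod.obj U) from a)
  refine ⟨U, le_rfl, hx, k, fun W h φ s hφ => ?_⟩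
  rw [pairHom_app, jLin_apply, jHat_smul]
  have h1 : (homApp (jIso dL).hom W φ • jHat dL dE W s).app le_rfl ((symCoalg L.mod).res h a) =
      0 :=
    convAct_eq_zero_of_mem_filt (fun b hb => jIso_vanishes dL hφ le_rfl hb)
      ((jHat dL dE W s).app le_rfl) (symMap_mem_filt (L.mod.res h) hk)
  rw [h1, map_zero]

/-- The pairing of `Sym L ⊗ End E` with the jets of `E`. -/
def preS (U : Opens S.X) :
    (L.preSymEnd E).obj U →ₗ[LieAlgd.Sec S.O U] (L.univE E).obj U :=
  TensorProduct.lift (R := LieAlgd.Sec S.O U) (M := (symCoalg L.mod).obj U) (N := EndSec E U)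
    (P₂ := L.contSub E U) <| LinearMap.mk₂ (LieAlgd.Sec S.O U)
    (fun a T => ⟨pairHom dL dE a T, pairHom_mem dL dE a T⟩)
    (fun a a' T => Subtype.ext (ModPresheaf.HomSec.ext fun V h s => by
      change (pairHom dL dE (a + a') T).app h s =
        (pairHom dL dE a T).app h s + (pairHom dL dE a' T).app h s
      simp only [pairHom_app, map_add]))
    (fun r a T => Subtype.ext (ModPresheaf.HomSec.ext fun V h s => by
      change (pairHom dL dE (r • a) T).app h s =
        LieAlgd.res S.O h r • (pairHom dL dE a T).app h s
      simp only [pairHom_app, LinearMap.map_smulₛₗ, map_smul]))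
    (fun a T T' => rfl) (fun r a T => rfl)

lemma preS_res {U V : Opens S.X} (h : V ≤ U) (t : (L.preSymEnd E).obj U) :
    preS dL dE V ((L.preSymEnd E).res h t) = (L.univE E).res h (preS dL dE U t) := by
  refine TensorProduct.induction_on (R := LieAlgd.Sec S.O U) (M := (symCoalg L.mod).obj U)
    (N := (ModPresheaf.ihom (ModPresheaf.ofSheaf E) (ModPresheaf.ofSheaf E)).obj U)
    (motive := fun t => preS dL dE V ((L.preSymEnd E).res h t) =
      (L.univE E).res h (preS dL dE U t)) t ?_ (fun a (T : EndSec E U) => ?_)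
    (fun s t hs ht => ?_)
  · exact (congrArg _ (map_zero ((L.preSymEnd E).res h))).trans ((map_zero _).trans
      ((map_zero _).symm.trans (congrArg _ (map_zero (preS dL dE U)).symm)))
  · refine Subtype.ext (ModPresheaf.HomSec.ext fun W h' s => ?_)
    change T.app _ ((jLin dL dE W s).app le_rfl
      ((symCoalg L.mod).res h' ((symCoalg L.mod).res h a))) =
      T.app _ ((jLin dL dE W s).app le_rfl ((symCoalg L.mod).res (h'.trans h) a))
    rw [(symCoalg L.mod).res_res]
  · refine (congrArg _ (map_add ((L.preSymEnd E).res h) s t)).trans ((map_add _ _ _).trans ?_)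
    refine (congrArg₂ (· + ·) hs ht).trans ?_
    exact (map_add _ _ _).symm.trans (congrArg _ (map_add (preS dL dE U) s t).symm)

/-- Morphisms glue in the internal Hom, and continuity is a local condition, inherited from the
members of the cover. -/
lemma isSheaf_univE : (L.univE E).IsSheaf := by
  rw [ModPresheaf.isSheaf_iff]
  intro ι U V hle hcov s hs
  obtain ⟨t, ht, hu⟩ := (ModPresheaf.isSheaf_iff _).1 (ModPresheaf.isSheaf_ihom
    (P := jetsE₁ L E) (ModPresheaf.isSheaf_ofSheaf E)) U V hle hcov (fun i => (s i).1)
    (fun i j => congrArg Subtype.val (hs i j))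
  refine ⟨⟨t, fun x hx => ?_⟩, fun i => Subtype.ext (ht i), fun t' ht' => Subtype.ext
    (hu t'.1 fun i => congrArg Subtype.val (ht' i))⟩
  obtain ⟨i, hi⟩ := Opens.mem_iSup.1 (hcov hx)
  obtain ⟨W, hW, hxW, k, H⟩ := (s i).2 x hi
  refine ⟨W, hW.trans (hle i), hxW, k, fun W' h' φ σ hφ => ?_⟩
  refine Eq.trans ?_ (H W' h' φ σ hφ)
  exact congrArg (fun f : ModPresheaf.HomSec (jetsE₁ L E) (ModPresheaf.ofSheaf E) (U i) =>
    f.app (h'.trans hW) (ModPresheaf.ofScalars L.α₁ (L.jetsE E) W' (φ • σ))) (ht i)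

end LieAlgebroid

end LieAlgd

end

/-! ### Dual monomials and injectivity of the pairing. -/

noncomputable section

namespace LieAlgd

open LRConn CoalgPresheaf LieAlgd.Sym

variable {K : Type u} [Field K] [CharZero K] {S : RingedSpaceOver K}

namespace LieAlgebroid

variable {L : LieAlgebroid S} {E : S.Modules}

section Frame

variable {n : ℕ} {U : Opens S.X} {b : Fin n → L.mod.obj U} (hb : IsFrame L.mod b)

/-- The monomials in the sections of a frame. -/
def mono {V : Opens S.X} (h : V ≤ U) (α : Fin n →₀ ℕ) : (symCoalg L.mod).obj V :=
  (hb.basis h).symmetricAlgebra α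

lemma res_mono {V W : Opens S.X} (h : V ≤ U) (h' : W ≤ V) (α : Fin n →₀ ℕ) :
    (symCoalg L.mod).res h' (mono hb h α) = mono hb (h'.trans h) α :=
  symMap_symmetricAlgebra (hb.basis h) (L.mod.res h') (hb.basis (h'.trans h))
    (hb.res_basis h h') α

/-- The section of `Sym^(L^∨)` whose values are the coefficients of a monomial. -/
def dualMono (α : Fin n →₀ ℕ) : LieAlgd.Sec L.symHat U :=
  (⟨fun V => WithConv.toConv ((hb.basis V.2).symmetricAlgebra.coord α), fun V W h a =>
    repr_symMap (hb.basis V.2) (L.mod.res h) (hb.basis W.2) (hb.res_basis V.2 h) a α⟩ :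
    DualSec (symCoalg L.mod) U)

lemma dualMono_mono {V : Opens S.X} (h : V ≤ U) (α β : Fin n →₀ ℕ) :
    L.symHatApp (dualMono hb α) h (mono hb h β) = if β = α then 1 else 0 := by
  change (hb.basis h).symmetricAlgebra.repr ((hb.basis h).symmetricAlgebra β) α = _
  rw [Module.Basis.repr_self, Finsupp.single_apply]

end Frame

/-- Multiplication of a section of `Sym^(L^∨)` with constant maps. -/
def mulConst {U : Opens S.X} (ψ : LieAlgd.Sec L.symHat U) :
    (ModPresheaf.ofSheaf E).obj U →ₗ[LieAlgd.Sec S.O U] SymHom L E U where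
  toFun e := ψ • constHom U e
  map_add' e f := by rw [map_add, smul_add]
  map_smul' r e := ModPresheaf.HomSec.ext fun V h a => by
    refine (symHat_smul_constHom_app ψ (r • e) h a).trans ?_
    refine Eq.trans ?_ (congrArg (LieAlgd.res S.O h r • ·) (symHat_smul_constHom_app ψ e h a).symm)
    rw [LinearMap.map_smulₛₗ, smul_comm]

lemma mulConst_app {U V : Opens S.X} (ψ : LieAlgd.Sec L.symHat U)
    (e : (ModPresheaf.ofSheaf E).obj U) (h : V ≤ U) (a : (symCoalg L.mod).obj V) :
    (mulConst ψ e : SymHom L E U).app h a =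
      L.symHatApp ψ h a • (ModPresheaf.ofSheaf E).res h e := symHat_smul_constHom_app ψ e h a

lemma mulConst_res {U V : Opens S.X} (h : V ≤ U) (ψ : LieAlgd.Sec L.symHat U)
    (e : (ModPresheaf.ofSheaf E).obj U) :
    (mulConst (LieAlgd.res L.symHat h ψ) ((ModPresheaf.ofSheaf E).res h e) : SymHom L E V) =
      (mulConst ψ e).res h := by
  change LieAlgd.res L.symHat h ψ • (constHom V _ : SymHom L E V) =
    (ψ • (constHom U e : SymHom L E U)).res h
  rw [constHom_res, symHat_smul_res]

variable (dL : Connection L L.mod) (dE : Connection L (ModPresheaf.ofSheaf E))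
  {m : ℕ} (hE : IsLocallyFreeOfRank E m)

/-- The map `jHat` as a linear equivalence. -/
def jLinEquiv (U : Opens S.X) : (jetsE₁ L E).obj U ≃ₗ[LieAlgd.Sec S.O U] SymHom L E U :=
  LinearEquiv.ofBijective (jLin dL dE U) (jHat_bijective dL dE hE U)

lemma jLinEquiv_apply {U : Opens S.X} (s : (jetsE₁ L E).obj U) :
    jLinEquiv dL dE hE U s = jLin dL dE U s := rfl

lemma jLinEquiv_symm_res {U V : Opens S.X} (h : V ≤ U) (f : SymHom L E U) :
    (jLinEquiv dL dE hE V).symm (f.res h) =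
      (jetsE₁ L E).res h ((jLinEquiv dL dE hE U).symm f) := by
  rw [LinearEquiv.symm_apply_eq, jLinEquiv_apply, jLin_res, ← jLinEquiv_apply dL dE hE,
    LinearEquiv.apply_symm_apply]

lemma jLinEquiv_symm_smul {U : Opens S.X} (φ : LieAlgd.Sec L.jets U) (f : SymHom L E U) :
    (jLinEquiv dL dE hE U).symm (homApp (jIso dL).hom U φ • f) =
      ModPresheaf.ofScalars L.α₁ (L.jetsE E) U
        (φ • (ModPresheaf.ofScalars L.α₁ (L.jetsE E) U).symm ((jLinEquiv dL dE hE U).symm f)) := by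
  rw [LinearEquiv.symm_apply_eq, jLinEquiv_apply, jLin_apply, jHat_smul, ← jLin_apply,
    AddEquiv.apply_symm_apply, ← jLinEquiv_apply dL dE hE, LinearEquiv.apply_symm_apply]

/-- The coefficient of a map of jets of `E` to `E` with respect to a section of `Sym^(L^∨)`. -/
def coefHom {U : Opens S.X} (f : ModPresheaf.HomSec (jetsE₁ L E) (ModPresheaf.ofSheaf E) U)
    (ψ : LieAlgd.Sec L.symHat U) : EndSec E U :=
  ⟨fun V => f.app V.2 ∘ₗ (jLinEquiv dL dE hE V.1).symm.toLinearMap ∘ₗ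
    mulConst (LieAlgd.res L.symHat V.2 ψ), fun V W h e => by
      change f.app W.2 ((jLinEquiv dL dE hE W.1).symm (mulConst (LieAlgd.res L.symHat W.2 ψ)
        ((ModPresheaf.ofSheaf E).res h e))) = (ModPresheaf.ofSheaf E).res h (f.app V.2
          ((jLinEquiv dL dE hE V.1).symm (mulConst (LieAlgd.res L.symHat V.2 ψ) e)))
      rw [← LieAlgd.res_res L.symHat V.2 h, mulConst_res, jLinEquiv_symm_res, f.app_res V.2 h]⟩

lemma coefHom_app {U V : Opens S.X}
    (f : ModPresheaf.HomSec (jetsE₁ L E) (ModPresheaf.ofSheaf E) U)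
    (ψ : LieAlgd.Sec L.symHat U) (h : V ≤ U) (e : (ModPresheaf.ofSheaf E).obj V) :
    (coefHom dL dE hE f ψ).app h e = f.app h
      ((jLinEquiv dL dE hE V).symm (mulConst (LieAlgd.res L.symHat h ψ) e)) := rfl

lemma preS_sum_app {ι : Type*} {U V : Opens S.X} (s : Finset ι) (a : ι → (symCoalg L.mod).obj U)
    (T : ι → EndSec E U) (h : V ≤ U) (σ : (jetsE₁ L E).obj V) :
    (preS dL dE U (∑ i ∈ s, a i ⊗ₜ[LieAlgd.Sec S.O U] T i :
      (symCoalg L.mod).obj U ⊗[LieAlgd.Sec S.O U] EndSec E U)).1.app h σ =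
      ∑ i ∈ s, (T i).app h ((jLin dL dE V σ).app le_rfl ((symCoalg L.mod).res h (a i))) := by
  let F : (symCoalg L.mod).obj U ⊗[LieAlgd.Sec S.O U] EndSec E U →+ (ModPresheaf.ofSheaf E).obj V :=
    (AddMonoidHom.mk' (fun f : L.contSub E U => f.1.app h σ) fun _ _ => rfl).comp
      (preS dL dE U).toAddMonoidHom
  exact map_sum F (fun i => a i ⊗ₜ[LieAlgd.Sec S.O U] T i) s

variable {n : ℕ} {U : Opens S.X} {b : Fin n → L.mod.obj U} (hb : IsFrame L.mod b)

include hE hb in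
-- Expand t in the monomial basis with coefficients in End E. Pairing with the jet that corresponds
-- to the dual monomial of α times e isolates the α-th coefficient applied to e.
lemma preS_injective : Function.Injective (preS (E := E) dL dE U) := by
  rw [injective_iff_map_eq_zero]
  intro t ht
  obtain ⟨c, hc⟩ := TensorProduct.eq_repr_basis_left (R := LieAlgd.Sec S.O U)
    (N := (ModPresheaf.ihom (ModPresheaf.ofSheaf E) (ModPresheaf.ofSheaf E)).obj U)
    (hb.basis le_rfl).symmetricAlgebra t
  have hc' : t = (∑ α ∈ c.support, mono hb le_rfl α ⊗ₜ[LieAlgd.Sec S.O U] (c α : EndSec E U) :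
      (symCoalg L.mod).obj U ⊗[LieAlgd.Sec S.O U] EndSec E U) := hc.symm
  have h0 : ∀ α ∈ c.support, c α = 0 := by
    intro α hα
    refine ModPresheaf.HomSec.ext fun V h e => ?_
    -- The test section is the preimage under j of this element; j is invertible because E is
    -- locally free.
    have h1 := preS_sum_app dL dE c.support (mono hb le_rfl) c h
      ((jLinEquiv dL dE hE V).symm (mulConst (LieAlgd.res L.symHat h (dualMono hb α)) e))
    rw [← hc', ht] at h1
    rw [← jLinEquiv_apply dL dE hE, LinearEquiv.apply_symm_apply] at h1
    refine Eq.trans ?_ h1.symm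
    rw [Finset.sum_eq_single α]
    · rw [res_mono, mulConst_app]
      have h2 := dualMono_mono hb h α α
      rw [if_pos rfl] at h2
      refine congrArg ((c α).app h) (Eq.trans ?_ (congrArg (· • _) h2).symm)
      rw [one_smul, ModPresheaf.res_self]
    · intro β _ hβ
      rw [res_mono, mulConst_app]
      have h2 := dualMono_mono hb h α β
      rw [if_neg hβ] at h2
      refine (congrArg (fun z => (c β).app h (z • _)) h2).trans ?_
      rw [zero_smul, map_zero]
    · intro h; exact absurd hα h
  rw [hc']
  refine Finset.sum_eq_zero fun α hα => ?_
  rw [h0 α hα]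
  exact TensorProduct.tmul_zero _ _

end LieAlgebroid

end LieAlgd

end

/-! ### Surjectivity of the pairing and the isomorphism j*. -/

noncomputable section

namespace LieAlgd

open LRConn CoalgPresheaf LieAlgd.Sym

lemma ModPresheaf.sheafifyLift_smul {X : TopCat.{u}} {R : X.Sheaf CommRingCat.{u}}
    {P Q : ModPresheaf R} (hQ : Q.IsSheaf) (f : ∀ U, P.obj U →+ Q.obj U)
    (hf : ∀ {U V : Opens X} (h : V ≤ U) (m : P.obj U), f V (P.res h m) = Q.res h (f U m))
    (hsmul : ∀ {U : Opens X} (r : Sec R U) (m : P.obj U), f U (r • m) = r • f U m)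
    {U : Opens X} (r : Sec R U) (s : P.sheafify.obj U) :
    P.sheafifyLift Q hQ f hf U (r • s) = r • P.sheafifyLift Q hQ f hf U s := by
  refine hQ.ext_of_locally fun x hx => ?_
  obtain ⟨V, hV, hxV, t, ht⟩ := P.exists_toSheafify_eq_res s hx
  refine ⟨V, hV, hxV, ?_⟩
  rw [LinearMap.map_smulₛₗ, ← ModPresheaf.sheafifyLift_res, ← ModPresheaf.sheafifyLift_res,
    LinearMap.map_smulₛₗ, ← ht, ← P.toSheafify_smul, sheafifyLift_toSheafify,
    sheafifyLift_toSheafify, hsmul]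

variable {K : Type u} [Field K] [CharZero K] {S : RingedSpaceOver K}

namespace LieAlgebroid

variable {L : LieAlgebroid S} {E : S.Modules}
  (dL : Connection L L.mod) (dE : Connection L (ModPresheaf.ofSheaf E))
  {m : ℕ} (hE : IsLocallyFreeOfRank E m)

/-- The jet corresponding to a section of `Sym^(L^∨)`. -/
def jInv (U : Opens S.X) (ψ : LieAlgd.Sec L.symHat U) : LieAlgd.Sec L.jets U :=
  ((pbwIso dL).dualEquiv U).symm ψ

lemma jIso_jInv {U : Opens S.X} (ψ : LieAlgd.Sec L.symHat U) :
    homApp (jIso dL).hom U (jInv dL U ψ) = ψ := ((pbwIso dL).dualEquiv U).apply_symm_apply ψ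

lemma jInv_vanishes {U : Opens S.X} {k : ℕ} {ψ : LieAlgd.Sec L.symHat U}
    (hψ : ∀ (V : Opens S.X) (h : V ≤ U), ∀ a ∈ filt (LieAlgd.Sec S.O V) (L.mod.obj V) k,
      L.symHatApp ψ h a = 0) : L.JetVanishes k (jInv dL U ψ) :=
  fun V h _ hD => hψ V h _ (UEnv.symb_mem_filt (lrL dL V) hD)

variable {n : ℕ} {U : Opens S.X} {b : Fin n → L.mod.obj U} (hb : IsFrame L.mod b)

/-- A map that kills jets vanishing to order k sees of j(s) only its values on monomials of degree
at most k. -/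
lemma app_eq_zero_of_vanishes {f : ModPresheaf.HomSec (jetsE₁ L E) (ModPresheaf.ofSheaf E) U}
    {k : ℕ} (hf : ∀ (W : Opens S.X) (h : W ≤ U) (φ : LieAlgd.Sec L.jets W) (s : (L.jetsE E).obj W),
      L.JetVanishes k φ → f.app h (ModPresheaf.ofScalars L.α₁ (L.jetsE E) W (φ • s)) = 0)
    {V : Opens S.X} (h : V ≤ U) {e : Fin m → (ModPresheaf.ofSheaf E).obj V}
    (he : IsFrame (ModPresheaf.ofSheaf E) e) (g : SymHom L E V)
    (hg : ∀ α : Fin n →₀ ℕ, α.degree ≤ k → g.app le_rfl (mono hb h α) = 0) :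
    f.app h ((jLinEquiv dL dE hE V).symm g) = 0 := by
  -- In the basis of constant maps, the coefficients of g vanish on the same monomials, and over
  -- every smaller open set as well. They therefore come from jets vanishing to order k.
  obtain ⟨ψ, rfl⟩ : ∃ ψ : Fin m → LieAlgd.Sec L.symHat V,
      (∑ p, mulConst (ψ p) (e p) : SymHom L E V) = g :=
    (he.constHom_bijective (C := symCoalg L.mod)).2 g
  have hψ : ∀ p, L.JetVanishes k (jInv dL V (ψ p)) := by
    intro p
    refine jInv_vanishes dL fun W h' a ha => ?_
    refine eq_zero_of_mem_filt (hb.basis (h'.trans h)) (L.symHatApp (ψ p) h') (fun α hα => ?_) ha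
    have h1 := congrArg ((ModPresheaf.ofSheaf E).res h') (hg α hα)
    rw [← ModPresheaf.HomSec.app_res _ le_rfl h', res_mono, map_zero,
      ModPresheaf.HomSec.sum_app] at h1
    have h2 : ∑ p, L.symHatApp (ψ p) h' (mono hb (h'.trans h) α) • (ModPresheaf.ofSheaf E).res h' (e p)
        = ∑ p, (0 : Fin m → LieAlgd.Sec S.O W) p • (ModPresheaf.ofSheaf E).res h' (e p) := by
      refine Eq.trans (Finset.sum_congr rfl fun p _ => ?_) (h1.trans ?_)
      · exact (mulConst_app (ψ p) (e p) h' _).symm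
      · simp
    exact congrFun ((he W h').1 h2) p
  rw [map_sum, map_sum]
  refine Finset.sum_eq_zero fun p _ => ?_
  have h1 : (mulConst (ψ p) (e p) : SymHom L E V) =
      homApp (jIso dL).hom V (jInv dL V (ψ p)) • constHom V (e p) := by
    rw [jIso_jInv]
    rfl
  rw [h1, jLinEquiv_symm_smul]
  exact hf V h _ _ (hψ p)

include hE hb in
-- The preimage sums, over the finitely many monomials of degree at most k, the monomial tensored
-- with the coefficient of f along its dual.
lemma preS_surjective_of_frame {e : Fin m → (ModPresheaf.ofSheaf E).obj U}
    (he : IsFrame (ModPresheaf.ofSheaf E) e) (f : L.contSub E U) {k : ℕ}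
    (hf : ∀ (W : Opens S.X) (h : W ≤ U) (φ : LieAlgd.Sec L.jets W) (s : (L.jetsE E).obj W),
      L.JetVanishes k φ → f.1.app h (ModPresheaf.ofScalars L.α₁ (L.jetsE E) W (φ • s)) = 0) :
    ∃ t, preS dL dE U t = f := by
  let F : Finset (Fin n →₀ ℕ) := (Finsupp.finite_of_degree_le k).toFinset
  have hF : ∀ α, α ∈ F ↔ α.degree ≤ k := fun α => by simp [F]
  refine ⟨(∑ α ∈ F, mono hb le_rfl α ⊗ₜ[LieAlgd.Sec S.O U]
    coefHom dL dE hE f.1 (dualMono hb α) :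
      (symCoalg L.mod).obj U ⊗[LieAlgd.Sec S.O U] EndSec E U),
    Subtype.ext (ModPresheaf.HomSec.ext fun V h s => ?_)⟩
  refine (preS_sum_app dL dE F _ _ h s).trans ?_
  obtain ⟨g, rfl⟩ := (jLinEquiv dL dE hE V).symm.surjective s
  -- c is the truncation of g to degrees at most k. The pairing computes f on c, and f agrees on c
  -- and g because they coincide on monomials of degree at most k.
  let c : SymHom L E V := ∑ α ∈ F, mulConst (LieAlgd.res L.symHat h (dualMono hb α))
    (g.app le_rfl (mono hb h α))
  have hc : ∑ α ∈ F, (coefHom dL dE hE f.1 (dualMono hb α)).app h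
      ((jLin dL dE V ((jLinEquiv dL dE hE V).symm g)).app le_rfl
        ((symCoalg L.mod).res h (mono hb le_rfl α))) =
      f.1.app h ((jLinEquiv dL dE hE V).symm c) := by
    rw [map_sum, map_sum]
    refine Finset.sum_congr rfl fun α _ => ?_
    rw [coefHom_app, ← jLinEquiv_apply dL dE hE, LinearEquiv.apply_symm_apply, res_mono]
  rw [hc, ← sub_eq_zero, ← map_sub, ← map_sub]
  refine app_eq_zero_of_vanishes dL dE hE hb hf h (he.res h) _ fun β hβ => ?_
  have hsub : (c - g).app le_rfl (mono hb h β) =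
    c.app le_rfl (mono hb h β) - g.app le_rfl (mono hb h β) := rfl
  rw [hsub, sub_eq_zero]
  refine (ModPresheaf.HomSec.sum_app F _ le_rfl _).trans ?_
  rw [Finset.sum_eq_single_of_mem β ((hF β).2 hβ)]
  · rw [mulConst_app, ModPresheaf.res_self]
    have h2 := dualMono_mono hb h β β
    rw [if_pos rfl] at h2
    exact (congrArg (· • _) h2).trans (one_smul _ _)
  · intro α _ hα
    rw [mulConst_app]
    have h2 := dualMono_mono hb h α β
    rw [if_neg hα.symm] at h2
    exact (congrArg (· • _) h2).trans (zero_smul _ _)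

variable {r : ℕ} (hL : IsLocallyFreeOfRank L.sheaf r)

/-- The map underlying `j^*` on sections. -/
def jStarHom (U : Opens S.X) : (L.symEnd E).obj U →+ (L.univE E).obj U :=
  (L.preSymEnd E).sheafifyLift _ isSheaf_univE (fun U => (preS dL dE U).toAddMonoidHom)
    (preS_res dL dE) U

include hL hE in
lemma jStarHom_bijective (U : Opens S.X) : Function.Bijective (jStarHom (E := E) dL dE U) := by
  refine ModPresheaf.sheafifyLift_bijective isSheaf_univE _ (preS_res dL dE)
    (fun {U} t ht x hx => ?_) (fun {U} f x hx => ?_) U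
  · obtain ⟨V, hV, hxV, b, hb⟩ := hL.exists_frame hx
    refine ⟨V, hV, hxV, preS_injective dL dE hE hb ?_⟩
    have ht' : preS dL dE U t = 0 := ht
    rw [preS_res, ht', map_zero, map_zero]
  -- A common order k exists only locally, so the neighbourhood is shrunk first for k and then for
  -- frames of L and of E.
  · obtain ⟨V₁, hV₁, hxV₁, k, hk⟩ := f.2 x hx
    obtain ⟨V₂, hV₂, hxV₂, b, hb⟩ := hL.exists_frame hxV₁
    obtain ⟨V, hV, hxV, e, he⟩ := hE.exists_frame hxV₂
    refine ⟨V, hV.trans (hV₂.trans hV₁), hxV, ?_⟩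
    exact preS_surjective_of_frame dL dE hE (hb.res hV) he _ (k := k) fun W h φ s hφ =>
      hk W (h.trans (hV.trans hV₂)) φ s hφ

/-- The isomorphism `Sym L ⊗ End E ≅ 𝓤(L; E)`. -/
def jStarIso : ModPresheaf.Iso (L.symEnd E) (L.univE E) where
  toEquiv U := LinearEquiv.ofBijective
    ({ toFun := jStarHom dL dE U
       map_add' := map_add _
       map_smul' := fun r s => ModPresheaf.sheafifyLift_smul isSheaf_univE
        (fun U => (preS dL dE U).toAddMonoidHom) (preS_res dL dE)
        (fun {U} r t => (preS dL dE U).map_smul r t) r s } : (L.symEnd E).obj U →ₗ[LieAlgd.Sec S.O U] (L.univE E).obj U)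
    (jStarHom_bijective dL dE hE hL U)
  naturality h s := ModPresheaf.sheafifyLift_res isSheaf_univE
    (fun U => (preS dL dE U).toAddMonoidHom) (preS_res dL dE) h s

lemma jStarIso_toSheafify (U : Opens S.X) (t : (L.preSymEnd E).obj U) :
    (jStarIso dL dE hE hL).toEquiv U ((L.preSymEnd E).toSheafify U t) = preS dL dE U t :=
  (L.preSymEnd E).sheafifyLift_toSheafify _ isSheaf_univE
    (fun U => (preS dL dE U).toAddMonoidHom) (preS_res dL dE) U t

end LieAlgebroid

end LieAlgd

end

/-! ### Proof of the theorem. -/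

open LieAlgd

theorem mainTheorem8 {K : Type u} [Field K] [CharZero K] (S : RingedSpaceOver K)
    (L : LieAlgebroid S) (r : ℕ) (hL : IsLocallyFreeOfRank L.sheaf r)
    (E : S.Modules) (m : ℕ) (hE : IsLocallyFreeOfRank E m)
    (dL : Connection L L.mod) (dE : Connection L (ModPresheaf.ofSheaf E)) :
    ∃ (jL : L.jets ≅ L.symHat)
      (j : ModPresheaf.IsoOver jL.hom (L.jetsE E) (L.symHatE E))
      (jstar : ModPresheaf.Iso (L.symEnd E) (L.univE E)),
      (∀ (U : Opens S.X) (φ : Sec L.jets U) (n : ℕ) (x : Fin n → L.Sec U),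
        L.symHatApp (homApp jL.hom U φ) le_rfl
            (List.ofFn fun i => SymmetricAlgebra.ι (Sec S.O U) (L.mod.obj U) (x i)).prod =
          ((n.factorial : K)⁻¹) •
            L.jetApp (symDpow (L.nabL dL U) (fun y => L.nabla₂ y) n φ x) le_rfl 1) ∧
      (∀ (U : Opens S.X) (t : (L.preJetsE E).obj U) (n : ℕ) (x : Fin n → L.Sec U),
        (L.symHatEApp E U (j.toEquiv U ((L.preJetsE E).toSheafify U t))).app le_rfl
            (List.ofFn fun i => SymmetricAlgebra.ι (Sec S.O U) (L.mod.obj U) (x i)).prod =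
          ((n.factorial : K)⁻¹) •
            L.ev₁ E U (symDpow (L.nabL dL U) (fun y => L.nablaJetsE E dE y) n t x)) ∧
      (∀ (U : Opens S.X) (f : Sec S.O U),
        homApp jL.hom U (homApp L.α₁ U f) = homApp L.symHatUnit U f) ∧
      (∀ (U : Opens S.X) (φ : Sec L.jets U) (s : (L.jetsE E).obj U),
        j.toEquiv U (φ • s) = homApp jL.hom U φ • j.toEquiv U s) ∧
      (∀ (U : Opens S.X) (f : Sec S.O U) (s : (L.jetsE E).obj U),
        j.toEquiv U (homApp L.α₁ U f • s) = homApp L.symHatUnit U f • j.toEquiv U s) ∧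
      (∀ (U : Opens S.X) (a : (symCoalg L.mod).obj U)
        (T : ModPresheaf.HomSec (ModPresheaf.ofSheaf E) (ModPresheaf.ofSheaf E) U)
        (s : (L.jetsE E).obj U),
        (jstar.toEquiv U ((L.preSymEnd E).toSheafify U (a ⊗ₜ[Sec S.O U] T))).1.app le_rfl
            (ModPresheaf.ofScalars L.α₁ (L.jetsE E) U s) =
          T.app le_rfl ((L.symHatEApp E U (j.toEquiv U s)).app le_rfl a)) := by
  refine ⟨LieAlgebroid.jIso dL, LieAlgebroid.jEIso dL dE hE, LieAlgebroid.jStarIso dL dE hE hL,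
    fun U φ n x => LieAlgebroid.symHatApp_jIso_prod dL φ n x, fun U t n x => ?_,
    LieAlgebroid.jIso_α₁ dL, fun U φ s => (LieAlgebroid.jEIso dL dE hE).map_smul φ s,
    fun U f s => ?_, fun U a T s => ?_⟩
  · refine (congrArg (fun f : LieAlgebroid.SymHom L E U => f.app le_rfl _)
      ((LieAlgebroid.symHatEApp_jEquiv dL dE hE _).trans
        (LieAlgebroid.jHat_toSheafify dL dE t))).trans ?_
    exact LieAlgebroid.preJ_app_prod dL dE t n x
  -- Linearity over O through α₁ is the special case φ = α₁(f) of linearity over the jets.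
  · rw [(LieAlgebroid.jEIso dL dE hE).map_smul, LieAlgebroid.jIso_α₁]
  · refine (congrArg (fun f : L.contSub E U =>
      f.1.app le_rfl (ModPresheaf.ofScalars L.α₁ (L.jetsE E) U s))
      (LieAlgebroid.jStarIso_toSheafify dL dE hE hL U (a ⊗ₜ[Sec S.O U] T))).trans ?_
    change T.app le_rfl ((LieAlgebroid.jHat dL dE U s).app le_rfl ((symCoalg L.mod).res le_rfl a)) =
      T.app le_rfl
        ((L.symHatEApp E U (LieAlgebroid.jEquiv dL dE hE U s)).app le_rfl a)
    rw [LieAlgebroid.symHatEApp_jEquiv, (symCoalg L.mod).res_self]
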